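/- **Theorem (existence of the solution in the hyperbolic case).** Let $1/2<H<1$ and $\alpha_H=H(2H-1)$. Write $\mathcal F\varphi(\xi)=\int_{\mathbb R^d}e^{-i\xi\cdot x}\varphi(x)\,dx$. *Operator.* Let $X=(X_t)_{t\ge 0}$ be a $d$-dimensional Lévy process with characteristic exponent $\Psi$, i.e. $E(e^{-i\xi\cdot X_t})=e^{-t\Psi(\xi)}$ for all $t\geq 0$, $\xi\in\mathbb R^d$, and let $\mathcal L$ be the $L^2(\mathbb R^d)$-generator of $X$, which is the Fourier multiplier with symbol $-\Psi$. Assume that $X$ is symmetric: $\operatorname{Im}\Psi(\xi)=0$ for all $\xi\in\mathbb R^d$. *Noise.* Let $f:\mathbb R^d\to[0,\infty]$ be a measurable, locally integrable function which is the Fourier transform in $\mathcal S'(\mathbb R^d)$ of a tempered measure $\mu$, i.e. $\int f(x)\varphi(x)\,dx=\int\mathcal F\varphi(\xi)\,\mu(d\xi)$ for all $\varphi\in\mathcal S(\mathbb R^d)$. Let $\mathcal E$ be the linear span of the functions $1_{[0,a]}(t)\psi(x)$ with $a>0$, $\psi\in\mathcal S(\mathbb R^d)$, and let $W=\{W(h)\}$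 be a zero-mean Gaussian process indexed by the real-valued $h\in\mathcal E$ with covariance $$E[W(h_1)W(h_2)]=\alpha_H\int_0^\infty\!\!\int_0^\infty\!\!\int_{\mathbb R^d}\!\int_{\mathbb R^d}|t-s|^{2H-2}f(x-y)h_1(t,x)h_2(s,y)\,dx\,dy\,dt\,ds .$$ Extend $W$ to complex-valued $h\in\mathcal E$ by linearity, and put $\mathcal FW(h)=W(\mathcal Fh)$ for complex-valued $h\in\mathcal E$, where $\mathcal F$ acts on the $x$ variable. Then $E|\mathcal FW(h)|^2=\|h\|^2_{\widehat{\mathcal{HP}}}$, where $$\|h\|^2_{\widehat{\mathcal{HP}}}=\alpha_H(2\pi)^{2d}\int_{\mathbb R^d}\int_0^\infty\!\!\int_0^\infty|r-s|^{2H-2}h(r,\xi)\overline{h(s,\xi)}\,dr\,ds\,\mu(d\xi),$$ and $h\mapsto\mathcal FW(h)=\int_0^\infty\int_{\mathbb R^d} h(t,\xi)\,\mathcal FW(dt,d\xi)$ is extended by $L^2(\Omega)$-continuity to the functions $h$ in the completion of $\mathcal E$ for this norm. *Weak solution.* The weak solution of $$\frac{\partial^2u}{\partial t^2}=\mathcal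 Lu+\dot W\quad (t>0,\ x\in\mathbb R^d),\qquad u(0,x)=0,\quad \frac{\partial u}{\partial t}(0,x)=0 \tag{1}$$ is the process indexed by $t\ge 0$ and $\varphi\in\mathcal S(\mathbb R^d)$ $$u(t,\varphi)=\frac1{(2\pi)^d}\int_0^t\!\int_{\mathbb R^d}\frac{\sin(\sqrt{\Psi(\xi)}\,(t-s))}{\sqrt{\Psi(\xi)}}\,\overline{\mathcal F\varphi(\xi)}\;\mathcal FW(ds,d\xi),$$ where the quotient means $t-s$ when $\Psi(\xi)=0$. *Random field solution.* Let $M_t$ be the completion of $\mathcal S(\mathbb R^d)$ with respect to the norm given by $\|\varphi\|_t^2=E|u(t,\varphi)|^2$. By the isometry above, $\|\varphi\|_t$ is the $\widehat{\mathcal{HP}}$-norm of the integrand defining $u(t,\varphi)$; in this form $\|\cdot\|_t$ extends to differences of Schwartz functions and tempered distributions whose Fourier transform is a continuous function. Such a distribution $T$ belongs to $M_t$ if $\|\varphi_n-T\|_t\to0$ for some sequence $(\varphi_n)$ in $\mathcal S(\mathbb R^d)$, and $u(t,T)$ is then the $L^2(\Omega)$-limit of $u(t,\varphi_n)$. Equation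 (1) has a *random field solution* if $\delta_x\in\bigcap_{t>0}M_t$ for every $x\in\mathbb R^d$; the solution is then $u(t,x)=u(t,\delta_x)$, $t\ge0$, $x\in\mathbb R^d$. **Claim.** Equation (1) has a random field solution if and only if $$\int_{\mathbb R^d}\left(\frac1{1+\Psi(\xi)}\right)^{H+1/2}\mu(d\xi)<\infty .$$ -/

import Mathlib

open MeasureTheory ProbabilityTheory Filter Set
open scoped ENNReal NNReal Topology SchwartzMap FourierTransform ComplexConjugate

noncomputable section

namespace FractionalSPDE

/-- The space `ℝ^d` with its Euclidean norm and inner product. -/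
abbrev Space (d : ℕ) : Type := EuclideanSpace ℝ (Fin d)

/-! ### Fourier transform with the normalisation `∫ e^{-i ξ·x} φ(x) dx` -/

/-- The dilation `ξ ↦ ξ / (2π)` of `ℝ^d`. -/
def dilation (d : ℕ) : Space d ≃L[ℝ] Space d :=
  ContinuousLinearEquiv.smulLeft (Units.mk0 ((2 * Real.pi)⁻¹ : ℝ) (by positivity))

/-- The Fourier transform on the Schwartz space in the normalisation
`(F φ)(ξ) = ∫ e^{-i ξ·x} φ(x) dx`, see `fourierS_apply`. -/
def fourierS {d : ℕ} (φ : 𝓢(Space d, ℂ)) : 𝓢(Space d, ℂ) :=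
  SchwartzMap.compCLMOfContinuousLinearEquiv ℂ (dilation d) (𝓕 φ)

theorem fourierS_apply {d : ℕ} (φ : 𝓢(Space d, ℂ)) (ξ : Space d) :
    fourierS φ ξ = ∫ x, Complex.exp (-Complex.I * ((inner ℝ ξ x : ℝ) : ℂ)) * φ x := by
  have h : fourierS φ ξ = 𝓕 (φ : Space d → ℂ) ((2 * Real.pi)⁻¹ • ξ) := by
    rw [← SchwartzMap.fourier_coe]
    rfl
  rw [h, Real.fourier_eq']
  congr 1
  ext x
  have hpi : (Real.pi : ℂ) ≠ 0 := by exact_mod_cast Real.pi_ne_zero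
  rw [inner_smul_right, real_inner_comm, smul_eq_mul]
  congr 2
  push_cast
  field_simp

theorem fourierS_zero {d : ℕ} : fourierS (0 : 𝓢(Space d, ℂ)) = 0 := by
  ext ξ
  simp [fourierS_apply]

/-! ### The spatial covariance kernel and its spectral measure -/

/-- `f : ℝ^d → [0,∞]` is a measurable, locally integrable function which is the Fourier transform,
in the space of tempered distributions, of the tempered measure `μ`. -/
structure IsSpectralPair {d : ℕ} (f : Space d → ℝ≥0∞) (μ : Measure (Space d)) : Prop where
  measurable : Measurable f
  locallyIntegrable : ∀ K : Set (Space d), IsCompact K → ∫⁻ x in K, f x < ∞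
  tempered : μ.HasTemperateGrowth
  integrable : ∀ φ : 𝓢(Space d, ℂ), Integrable (fun x => ((f x).toReal : ℂ) * φ x)
  fourier : ∀ φ : 𝓢(Space d, ℂ),
    ∫ x, ((f x).toReal : ℂ) * φ x = ∫ ξ, fourierS φ ξ ∂μ

/-! ### Elementary functions -/

/-- The space of elementary functions: the linear span of the functions
`(t, x) ↦ 1_{[0,a]}(t) ψ(x)`, `a > 0`, `ψ` a Schwartz function. Every element of that span is
`∑_a 1_{[0,a]}(t) ψ_a(x)` for exactly one finitely supported family `(ψ_a)_{a > 0}`, and that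
family is the datum recorded here; the function itself is `Elem.eval`. -/
abbrev Elem (d : ℕ) (𝕜 : Type) [NormedAddCommGroup 𝕜] [NormedSpace ℝ 𝕜] : Type :=
  {a : ℝ // 0 < a} →₀ 𝓢(Space d, 𝕜)

/-- The function `(t, x) ↦ ∑_a 1_{[0,a]}(t) ψ_a(x)`. -/
def Elem.eval {d : ℕ} {𝕜 : Type} [NormedAddCommGroup 𝕜] [NormedSpace ℝ 𝕜]
    (h : Elem d 𝕜) (t : ℝ) (x : Space d) : 𝕜 :=
  h.sum fun a ψ => (Icc (0 : ℝ) a).indicator (fun _ => ψ x) t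

/-- The Fourier transform, in the space variable, of an elementary function. -/
def Elem.fourier {d : ℕ} (h : Elem d ℂ) : Elem d ℂ :=
  h.mapRange fourierS fourierS_zero

/-- The real part of a complex elementary function. -/
def Elem.re {d : ℕ} (h : Elem d ℂ) : Elem d ℝ :=
  h.mapRange (SchwartzMap.postcompCLM (𝕜 := ℝ) Complex.reCLM) (map_zero _)

/-- The imaginary part of a complex elementary function. -/
def Elem.im {d : ℕ} (h : Elem d ℂ) : Elem d ℝ :=
  h.mapRange (SchwartzMap.postcompCLM (𝕜 := ℝ) Complex.imCLM) (map_zero _)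

/-! ### The noise -/

/-- `α_H = H (2H - 1)`. -/
def alphaH (H : ℝ) : ℝ := H * (2 * H - 1)

/-- The inner product
`α_H ∫_0^∞ ∫_0^∞ ∫ ∫ |t-s|^{2H-2} f(x-y) h₁(t,x) h₂(s,y) dx dy dt ds`. -/
def innerHP {d : ℕ} (H : ℝ) (f : Space d → ℝ≥0∞) (h₁ h₂ : Elem d ℝ) : ℝ :=
  alphaH H * ∫ t in Ioi (0 : ℝ), ∫ s in Ioi (0 : ℝ), ∫ x : Space d, ∫ y : Space d,
    |t - s| ^ (2 * H - 2) * (f (x - y)).toReal * h₁.eval t x * h₂.eval s y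

/-- `W` is a zero-mean Gaussian process indexed by the (real) elementary functions, with
covariance `E[W(h₁) W(h₂)] = ⟨h₁, h₂⟩_{HP}`. -/
structure IsNoise {d : ℕ} {Ω : Type*} [MeasurableSpace Ω] (P : Measure Ω)
    (H : ℝ) (f : Space d → ℝ≥0∞) (W : Elem d ℝ → Ω → ℝ) : Prop where
  gaussian : IsGaussianProcess W P
  mean_zero : ∀ h, ∫ ω, W h ω ∂P = 0
  covariance : ∀ h₁ h₂, ∫ ω, W h₁ ω * W h₂ ω ∂P = innerHP H f h₁ h₂

/-- The Fourier transform of the noise on (complex) elementary functions: `FW(h) = W(F h)`, where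
`W` is extended to complex integrands by `W(g) = W(Re g) + i W(Im g)`. -/
def fourierNoise {d : ℕ} {Ω : Type*} (W : Elem d ℝ → Ω → ℝ) (h : Elem d ℂ) (ω : Ω) : ℂ :=
  (W h.fourier.re ω : ℂ) + Complex.I * (W h.fourier.im ω : ℂ)

open Classical in
/-- `α_H ∫_0^∞ ∫_0^∞ |r-s|^{2H-2} φ(r) conj(φ(s)) dr ds`, set to `∞` if the double integral does
not converge absolutely. -/
def timeNormSq (H : ℝ) (φ : ℝ → ℂ) : ℝ≥0∞ :=
  if IntegrableOn (fun p : ℝ × ℝ => ((|p.1 - p.2| ^ (2 * H - 2) : ℝ) : ℂ) * φ p.1 * conj (φ p.2))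
      (Ioi (0 : ℝ) ×ˢ Ioi (0 : ℝ)) then
    ENNReal.ofReal (alphaH H * (∫ p in Ioi (0 : ℝ) ×ˢ Ioi (0 : ℝ),
      ((|p.1 - p.2| ^ (2 * H - 2) : ℝ) : ℂ) * φ p.1 * conj (φ p.2)).re)
  else ∞

/-- The squared norm
`α_H (2π)^{2d} ∫ ∫_0^∞ ∫_0^∞ |r-s|^{2H-2} h(r,ξ) conj(h(s,ξ)) dr ds μ(dξ)`. The double time
integral is nonnegative for every `ξ`, so that the outer integral is that of a nonnegative
function. -/
def hatNormSq {d : ℕ} (H : ℝ) (μ : Measure (Space d)) (h : ℝ → Space d → ℂ) : ℝ≥0∞ :=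
  ENNReal.ofReal ((2 * Real.pi) ^ (2 * d)) * ∫⁻ ξ, timeNormSq H (fun s => h s ξ) ∂μ

/-- The function `h` belongs to the completion of the elementary functions with respect to
`hatNormSq`, and `Y` is the stochastic integral `∫ h(t,ξ) FW(dt,dξ)`: there are elementary
functions which converge to `h` in that norm and whose integrals `FW(hₙ)` converge to `Y`
in `L²(Ω)`. -/
def IsFourierIntegral {d : ℕ} {Ω : Type*} [MeasurableSpace Ω] (P : Measure Ω)
    (H : ℝ) (μ : Measure (Space d)) (W : Elem d ℝ → Ω → ℝ)
    (h : ℝ → Space d → ℂ) (Y : Ω → ℂ) : Prop :=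
  MemLp Y 2 P ∧ ∃ hn : ℕ → Elem d ℂ,
    Tendsto (fun n => hatNormSq H μ (fun s ξ => (hn n).eval s ξ - h s ξ)) atTop (𝓝 0) ∧
    Tendsto (fun n => eLpNorm (fun ω => fourierNoise W (hn n) ω - Y ω) 2 P) atTop (𝓝 0)

/-! ### Lévy processes -/

/-- `X` is a `d`-dimensional Lévy process: it starts at `0`, has independent and stationary
increments, is stochastically continuous, and almost surely has right-continuous paths with left
limits. -/
structure IsLevyProcess {d : ℕ} {Ω : Type*} [MeasurableSpace Ω] (P : Measure Ω)
    (X : ℝ≥0 → Ω → Space d) : Prop where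
  measurable : ∀ t, Measurable (X t)
  zero : ∀ᵐ ω ∂P, X 0 ω = 0
  indep : HasIndepIncrements X P
  stationary : ∀ s t, IdentDistrib (fun ω => X (s + t) ω - X s ω) (X t) P P
  stochCont : ∀ t, TendstoInMeasure P X (𝓝 t) (X t)
  cadlag : ∀ᵐ ω ∂P, ∀ t, ContinuousWithinAt (fun s => X s ω) (Ici t) t ∧
    ∃ l, Tendsto (fun s => X s ω) (𝓝[<] t) (𝓝 l)

/-- `Ψ` is the characteristic exponent of `X`: `E[e^{-i ξ·X_t}] = e^{-t Ψ(ξ)}` for all `t` and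
`ξ`. (This identity for all `t` determines `Ψ`.) -/
def IsCharExponent {d : ℕ} {Ω : Type*} [MeasurableSpace Ω] (P : Measure Ω)
    (X : ℝ≥0 → Ω → Space d) (Ψ : Space d → ℂ) : Prop :=
  ∀ (t : ℝ≥0) (ξ : Space d),
    ∫ ω, Complex.exp (-Complex.I * ((inner ℝ ξ (X t ω) : ℝ) : ℂ)) ∂P =
      Complex.exp (-((t : ℝ) : ℂ) * Ψ ξ)

/-! ### The hyperbolic equation `∂_tt u = 𝓛 u + Ẇ`, with `F 𝓛 = -Ψ` and `Ψ` real -/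

/-- `sin(√p τ) / √p`, equal to `τ` for `p = 0`. -/
def waveKernel (p τ : ℝ) : ℝ := τ * Real.sinc (√p * τ)

/-- The function
`(s, ξ) ↦ (2π)^{-d} 1_{[0,t]}(s) sin(√Ψ(ξ) (t-s)) / √Ψ(ξ) conj(g(ξ))`. -/
def waveIntegrand {d : ℕ} (Ψ : Space d → ℂ) (t : ℝ) (g : Space d → ℂ)
    (s : ℝ) (ξ : Space d) : ℂ :=
  (((2 * Real.pi) ^ d)⁻¹ : ℝ) *
    (Icc (0 : ℝ) t).indicator (fun s => ((waveKernel (Ψ ξ).re (t - s) : ℝ) : ℂ)) s * conj (g ξ)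

/-- `u` is the weak solution: for `t ≥ 0` and `φ` Schwartz,
`u(t,φ) = (2π)^{-d} ∫_0^t ∫ sin(√Ψ(ξ) (t-s)) / √Ψ(ξ) conj(F φ(ξ)) FW(ds,dξ)`. -/
def IsWeakSolution {d : ℕ} {Ω : Type*} [MeasurableSpace Ω] (P : Measure Ω)
    (H : ℝ) (μ : Measure (Space d)) (Ψ : Space d → ℂ) (W : Elem d ℝ → Ω → ℝ)
    (u : ℝ → 𝓢(Space d, ℂ) → Ω → ℂ) : Prop :=
  ∀ t : ℝ, 0 ≤ t → ∀ φ : 𝓢(Space d, ℂ),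
    IsFourierIntegral P H μ W (waveIntegrand Ψ t (fourierS φ)) (u t φ)

/-- The squared norm `‖φ‖_t² = E|u(t,φ)|²` as a function of `g = F φ`: by the isometry of the
stochastic integral it is the squared norm of the integrand which defines `u(t,φ)`. In this form it
makes sense for every tempered distribution whose Fourier transform is a function `g`. -/
def solNormSq {d : ℕ} (H : ℝ) (μ : Measure (Space d)) (Ψ : Space d → ℂ) (t : ℝ)
    (g : Space d → ℂ) : ℝ≥0∞ :=
  hatNormSq H μ (waveIntegrand Ψ t g)

/-- The Fourier transform of the tempered distribution `T` is the continuous function `g`. -/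
def HasFourierFunction {d : ℕ} (T : 𝓢'(Space d, ℂ)) (g : Space d → ℂ) : Prop :=
  Continuous g ∧ ∀ φ : 𝓢(Space d, ℂ),
    Integrable (fun ξ => g ξ * φ ξ) ∧ T (fourierS φ) = ∫ ξ, g ξ * φ ξ

/-- The Schwartz functions `φₙ` converge to the tempered distribution `T` in the norm `‖·‖_t`. -/
def ConvergesInM {d : ℕ} (H : ℝ) (μ : Measure (Space d)) (Ψ : Space d → ℂ) (t : ℝ)
    (φ : ℕ → 𝓢(Space d, ℂ)) (T : 𝓢'(Space d, ℂ)) : Prop :=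
  ∃ g, HasFourierFunction T g ∧
    Tendsto (fun n => solNormSq H μ Ψ t (fun ξ => fourierS (φ n) ξ - g ξ)) atTop (𝓝 0)

/-- `T` belongs to `M_t`, the completion of the Schwartz space with respect to `‖·‖_t`. -/
def MemM {d : ℕ} (H : ℝ) (μ : Measure (Space d)) (Ψ : Space d → ℂ) (t : ℝ)
    (T : 𝓢'(Space d, ℂ)) : Prop :=
  ∃ φ : ℕ → 𝓢(Space d, ℂ), ConvergesInM H μ Ψ t φ T

/-- `U` is a random field solution: `δ_x` belongs to `M_t` for all `t > 0` and all `x`, and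
`U(t,x) = u(t,δ_x)`, that is, `U(t,x)` is the limit in `L²(Ω)` of `u(t,φₙ)`, for `u` the weak
solution and `φₙ` Schwartz functions with `φₙ → δ_x` in `M_t`. -/
def IsRandomFieldSolution {d : ℕ} {Ω : Type*} [MeasurableSpace Ω] (P : Measure Ω)
    (H : ℝ) (μ : Measure (Space d)) (Ψ : Space d → ℂ) (W : Elem d ℝ → Ω → ℝ)
    (U : ℝ → Space d → Ω → ℂ) : Prop :=
  (∀ (x : Space d) (t : ℝ), 0 < t → MemM H μ Ψ t (TemperedDistribution.delta x)) ∧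
  ∃ u : ℝ → 𝓢(Space d, ℂ) → Ω → ℂ, IsWeakSolution P H μ Ψ W u ∧
    ∀ (t : ℝ) (x : Space d), 0 ≤ t → MemLp (U t x) 2 P ∧
      ∃ φ : ℕ → 𝓢(Space d, ℂ), ConvergesInM H μ Ψ t φ (TemperedDistribution.delta x) ∧
        Tendsto (fun n => eLpNorm (fun ω => u t (φ n) ω - U t x ω) 2 P) atTop (𝓝 0)

/-- The hyperbolic equation with zero initial data, driven by `W`, has a random field solution. -/
def HasRandomFieldSolution {d : ℕ} {Ω : Type*} [MeasurableSpace Ω] (P : Measure Ω)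
    (H : ℝ) (μ : Measure (Space d)) (Ψ : Space d → ℂ) (W : Elem d ℝ → Ω → ℝ) : Prop :=
  ∃ U : ℝ → Space d → Ω → ℂ, IsRandomFieldSolution P H μ Ψ W U

end FractionalSPDE

end

/-!
For `p ≥ 0` let `N_t(p)` be the squared time norm of `s ↦ 1_{[0,t]}(s) sin(√p (t-s)) / √p`. The
squared norm `‖T‖_t²` of a distribution with Fourier transform `g` is `∫ |g(ξ)|² N_t(Ψ(ξ)) μ(dξ)`
(`solNormSq_eq`), so everything rests on the size of `N_t(p)`: for each `t`,
`N_t(p) ≤ C_t (1 + p)^{-(H + 1/2)}`, and a matching lower bound holds at `t = 1` for `p ≥ 36` and at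
`t = 1/6` for `p ≤ 36`.

*The bounds on `N_t`.* The kernel `|r - s|^{2H-2}` is a mixture, over rates `l > 0` with density
proportional to `l^{2-2H}` and over starting points `u`, of the products of the exponential kernels
`1_{u ≤ r} e^{-l (r - u)}` (`lintegral_mixMeasure_expKernel`). Hence the squared time norm of `φ` is
`α_H` times the squared `L²` norm of the transform of `φ` against these kernels
(`timeNormSq_eq_lintegral`). In particular it is the square of a seminorm. The transform of the wave kernel is explicit (see
`waveResponse`), with a square of order at most `1 / (p (l² + p))`; integrating over `l` gives the
upper bound, and the rates `√p < l ≤ 2√p` alone give the lower bound for large `p`. For bounded `p`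
the wave kernel is nonnegative at short times, and the lower bound is elementary.

*Necessity.* If `δ_0` is in `M_t`, choose a Schwartz function `φ` with `‖φ - δ_0‖_t ≤ 1`. As
`1 = Fφ + (1 - Fφ)` and `Fφ` is in `L²(μ)`, the function `N_t(Ψ)` is `μ`-integrable. The times
`t = 1` and `t = 1/6` together control `(1 + Ψ)^{-(H + 1/2)}` at all frequencies
(`lintegral_spectralWeight_lt_top`).

*Sufficiency.* If the measure `(1 + Ψ)^{-(H + 1/2)} μ` is finite, the bounded function `e^{-i x·ξ}`
is in its `L²` space, where Schwartz functions are dense. By the upper bound on `N_t` an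
approximating sequence converges to `δ_x` in every `M_t` (`exists_tendsto_deltaHat`). The weak
solution `u(t, φ)` and the limit `u(t, δ_x)` are then produced from the isometry of the stochastic
integral.

*The stochastic integral.* On elementary functions the isometry
(`IsNoise.lintegral_fourierNoise_sub`) is Parseval's identity `∫ f (φ * ψ̃) = ∫ Fφ conj(Fψ) dμ`. The
integrability that it requires holds because `f` is uniformly locally integrable: its integral
against a translated bump function is bounded by an integral over `μ` that does not depend on the
translation. The integrand of `u(t, φ)` is Lipschitz in time, so it is a uniform limit of step
functions in time whose coefficients, functions in `L²(μ)`, are approximated by Schwartz functions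
(`timeApprox_waveIntegrand`).
-/

open MeasureTheory ProbabilityTheory Filter Set
open scoped ENNReal NNReal Topology SchwartzMap FourierTransform ComplexConjugate

noncomputable section

namespace FractionalSPDE

/-! ### The kernel `|r - s|^{2H-2}` as a superposition of exponential kernels -/

/-- The exponential kernel `1_{u ≤ r} e^{-l (r - u)}`, with parameter `z = (l, u)`. -/
def expKernel (z : ℝ × ℝ) (r : ℝ) : ℝ := if z.2 ≤ r then Real.exp (-(z.1 * (r - z.2))) else 0

/-- The density `2 l^{2-2H} / Γ(2-2H)` of the mixing measure. -/
def rateDensity (H l : ℝ) : ℝ := 2 * l ^ (2 - 2 * H) / Real.Gamma (2 - 2 * H)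

/-- The measure on the rates `l > 0` with density `rateDensity`. -/
def rateMeasure (H : ℝ) : Measure ℝ :=
  (volume.restrict (Ioi 0)).withDensity fun l => ENNReal.ofReal (rateDensity H l)

/-- The mixing measure on the parameters `(l, u)` of the exponential kernels: with respect to it
`|r - s|^{2H-2}` is the integral of `expKernel z r * expKernel z s`. -/
def mixMeasure (H : ℝ) : Measure (ℝ × ℝ) := (rateMeasure H).prod volume

instance (H : ℝ) : SFinite (rateMeasure H) := by unfold rateMeasure; infer_instance

instance (H : ℝ) : SFinite (mixMeasure H) := by unfold mixMeasure; infer_instance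

theorem measurable_rateDensity (H : ℝ) : Measurable (rateDensity H) := by
  unfold rateDensity; fun_prop

theorem rateDensity_nonneg {H : ℝ} (hH1 : H < 1) {l : ℝ} (hl : 0 ≤ l) : 0 ≤ rateDensity H l := by
  have := Real.Gamma_pos_of_pos (show 0 < 2 - 2 * H by linarith)
  unfold rateDensity; positivity

theorem expKernel_nonneg (z : ℝ × ℝ) (r : ℝ) : 0 ≤ expKernel z r := by
  unfold expKernel; split_ifs <;> positivity

theorem measurable_expKernel : Measurable fun q : (ℝ × ℝ) × ℝ => expKernel q.1 q.2 := by
  unfold expKernel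
  refine Measurable.ite (measurableSet_le (by fun_prop) (by fun_prop)) (by fun_prop) (by fun_prop)

theorem lintegral_rateMeasure (H : ℝ) {g : ℝ → ℝ≥0∞} (hg : Measurable g) :
    ∫⁻ l, g l ∂rateMeasure H = ∫⁻ l in Ioi 0, ENNReal.ofReal (rateDensity H l) * g l := by
  unfold rateMeasure
  rw [lintegral_withDensity_eq_lintegral_mul _
    ((measurable_rateDensity H).ennreal_ofReal) hg]
  rfl

theorem lintegral_mixMeasure (H : ℝ) {g : ℝ × ℝ → ℝ≥0∞} (hg : Measurable g) :
    ∫⁻ z, g z ∂mixMeasure H =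
      ∫⁻ l in Ioi 0, ENNReal.ofReal (rateDensity H l) * ∫⁻ u, g (l, u) := by
  unfold mixMeasure
  rw [lintegral_prod _ hg.aemeasurable, lintegral_rateMeasure H hg.lintegral_prod_right']

theorem lintegral_expKernel_mul {l : ℝ} (hl : 0 < l) (r s : ℝ) :
    ∫⁻ u, ENNReal.ofReal (expKernel (l, u) r * expKernel (l, u) s) =
      ENNReal.ofReal (Real.exp (-(|r - s| * l)) / (2 * l)) := by
  have h1 : ∀ u, ENNReal.ofReal (expKernel (l, u) r * expKernel (l, u) s) =
      (Iic (min r s)).indicator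
        (fun u => ENNReal.ofReal (Real.exp (-(l * (r + s))) * Real.exp (2 * l * u))) u := by
    intro u
    by_cases hr : u ≤ r <;> by_cases hs : u ≤ s <;> simp [expKernel, hr, hs]
    rw [← Real.exp_add, ← Real.exp_add]
    congr 2; ring
  simp_rw [h1]
  rw [lintegral_indicator measurableSet_Iic, ← ofReal_integral_eq_lintegral_ofReal]
  · rw [integral_const_mul, integral_exp_mul_Iic (by positivity)]
    congr 1
    rw [mul_div_assoc', ← Real.exp_add]
    congr 2
    rcases le_total r s with h | h
    · rw [min_eq_left h, abs_of_nonpos (by linarith)]; ring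
    · rw [min_eq_right h, abs_of_nonneg (by linarith)]; ring
  · exact (integrableOn_exp_mul_Iic (by positivity) _).const_mul _
  · exact Eventually.of_forall fun u => by positivity

/-- `|r - s|^{2H-2}` is a mixture of products of exponential kernels: integrating in `u` produces
`e^{-l|r-s|} / (2l)`, and integrating in `l` produces the power by the definition of `Γ`. -/
theorem lintegral_mixMeasure_expKernel {H : ℝ} (hH1 : H < 1) {r s : ℝ} (hrs : r ≠ s) :
    ∫⁻ z, ENNReal.ofReal (expKernel z r * expKernel z s) ∂mixMeasure H =
      ENNReal.ofReal (|r - s| ^ (2 * H - 2)) := by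
  have hG := Real.Gamma_pos_of_pos (show 0 < 2 - 2 * H by linarith)
  have hd : 0 < |r - s| := abs_pos.2 (sub_ne_zero.2 hrs)
  have hm : Measurable fun z : ℝ × ℝ => ENNReal.ofReal (expKernel z r * expKernel z s) := by
    refine Measurable.ennreal_ofReal (Measurable.mul ?_ ?_)
    · exact measurable_expKernel.comp (measurable_id.prodMk measurable_const)
    · exact measurable_expKernel.comp (measurable_id.prodMk measurable_const)
  rw [lintegral_mixMeasure H hm]
  have h2 : ∀ l ∈ Ioi (0 : ℝ), ENNReal.ofReal (rateDensity H l) *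
      ∫⁻ u, ENNReal.ofReal (expKernel (l, u) r * expKernel (l, u) s) =
      ENNReal.ofReal ((Real.Gamma (2 - 2 * H))⁻¹ *
        (l ^ (2 - 2 * H - 1) * Real.exp (-(|r - s| * l)))) := by
    intro l hl
    have hl' : 0 < l := hl
    rw [lintegral_expKernel_mul hl', ← ENNReal.ofReal_mul (rateDensity_nonneg hH1 hl'.le)]
    congr 1
    rw [rateDensity, Real.rpow_sub_one hl'.ne']
    field_simp
  rw [setLIntegral_congr_fun measurableSet_Ioi h2]
  have h3 := Real.integral_rpow_mul_exp_neg_mul_Ioi (show 0 < 2 - 2 * H by linarith) hd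
  rw [← ofReal_integral_eq_lintegral_ofReal]
  · rw [integral_const_mul, h3]
    congr 1
    rw [one_div, Real.inv_rpow hd.le, ← Real.rpow_neg hd.le, mul_comm, mul_assoc,
      mul_inv_cancel₀ hG.ne', mul_one]
    congr 1; ring
  · refine Integrable.const_mul (not_imp_comm.1 integral_undef ?_) _
    rw [h3]; positivity
  · filter_upwards [ae_restrict_mem measurableSet_Ioi] with l hl
    have : (0 : ℝ) < l := hl
    have := Real.Gamma_pos_of_pos (show 0 < 2 - 2 * H by linarith)
    positivity

theorem integrable_expKernel_mul {H : ℝ} (hH1 : H < 1) {r s : ℝ} (hrs : r ≠ s) :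
    Integrable (fun z => expKernel z r * expKernel z s) (mixMeasure H) := by
  refine ⟨?_, ?_⟩
  · refine (Measurable.mul ?_ ?_).aestronglyMeasurable
    · exact measurable_expKernel.comp (measurable_id.prodMk measurable_const)
    · exact measurable_expKernel.comp (measurable_id.prodMk measurable_const)
  · rw [hasFiniteIntegral_iff_ofReal
      (Eventually.of_forall fun z => mul_nonneg (expKernel_nonneg _ _) (expKernel_nonneg _ _)),
      lintegral_mixMeasure_expKernel hH1 hrs]
    exact ENNReal.ofReal_lt_top

theorem integral_expKernel_mul {H : ℝ} (hH1 : H < 1) {r s : ℝ} (hrs : r ≠ s) :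
    ∫ z, expKernel z r * expKernel z s ∂mixMeasure H = |r - s| ^ (2 * H - 2) := by
  rw [integral_eq_lintegral_of_nonneg_ae
    (Eventually.of_forall fun z => mul_nonneg (expKernel_nonneg _ _) (expKernel_nonneg _ _))
    (integrable_expKernel_mul hH1 hrs).aestronglyMeasurable,
    lintegral_mixMeasure_expKernel hH1 hrs, ENNReal.toReal_ofReal (by positivity)]

/-! ### The time norm of bounded functions on a bounded time interval -/

theorem integrableOn_abs_sub_rpow {H : ℝ} (hH : 1 / 2 < H) (T : ℝ) :
    IntegrableOn (fun p : ℝ × ℝ => |p.1 - p.2| ^ (2 * H - 2)) (Ioc 0 T ×ˢ Ioc 0 T) := by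
  have h1 : Integrable ((Icc (-|T|) |T|).indicator fun v : ℝ => |v| ^ (2 * H - 2)) := by
    rw [integrable_indicator_iff measurableSet_Icc]
    have : IntervalIntegrable (fun v : ℝ => |v| ^ (2 * H - 2)) volume (-|T|) |T| := by
      have h0 : ∀ c, 0 ≤ c →
          IntervalIntegrable (fun v : ℝ => |v| ^ (2 * H - 2)) volume 0 c := fun c hc =>
        (intervalIntegral.intervalIntegrable_rpow' (a := 0) (b := c)
          (by linarith : -1 < 2 * H - 2)).congr (fun v hv => by
            rw [uIoc_of_le hc] at hv
            rw [abs_of_pos hv.1])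
      refine IntervalIntegrable.trans (b := 0) ?_ (h0 _ (abs_nonneg _))
      have := (h0 _ (abs_nonneg T)).comp_sub_left 0
      simpa using this.symm
    rw [intervalIntegrable_iff_integrableOn_Icc_of_le (by linarith [abs_nonneg T])] at this
    exact this
  have h2 : Integrable ((Ioc 0 T).indicator fun _ : ℝ => (1 : ℝ)) := by
    rw [integrable_indicator_iff measurableSet_Ioc]; simp
  have h3 := h2.convolution_integrand (ContinuousLinearMap.mul ℝ ℝ) h1
  rw [← integrable_indicator_iff (measurableSet_Ioc.prod measurableSet_Ioc)]
  refine (h3.indicator (measurableSet_Ioc.prod measurableSet_Ioc : MeasurableSet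
    (Ioc 0 T ×ˢ Ioc 0 T))).congr (Eventually.of_forall fun p => ?_)
  by_cases hp : p ∈ Ioc 0 T ×ˢ Ioc 0 T
  · simp only [indicator_of_mem hp]
    have h4 : p.1 - p.2 ∈ Icc (-|T|) |T| := by
      have := hp.1.1; have := hp.1.2; have := hp.2.1; have := hp.2.2
      have := le_abs_self T
      constructor <;> linarith
    rw [indicator_of_mem h4, indicator_of_mem hp.2]; simp
  · simp [indicator_of_notMem hp]

/-- Bounded measurable functions of the time `s > 0` that vanish after time `T`; the predicate also
fixes the bound `M`. -/
structure IsBddTime (T M : ℝ) (φ : ℝ → ℂ) : Prop where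
  measurable : Measurable φ
  bound : ∀ s, 0 < s → ‖φ s‖ ≤ M
  supp : ∀ s, T < s → φ s = 0

theorem IsBddTime.mono {T T' M M' : ℝ} {φ : ℝ → ℂ} (h : IsBddTime T M φ) (hT : T ≤ T')
    (hM : M ≤ M') : IsBddTime T' M' φ :=
  ⟨h.measurable, fun s hs => (h.bound s hs).trans hM, fun s hs => h.supp s (hT.trans_lt hs)⟩

theorem IsBddTime.add {T M M' : ℝ} {φ ψ : ℝ → ℂ} (h : IsBddTime T M φ) (h' : IsBddTime T M' ψ) :
    IsBddTime T (M + M') (fun s => φ s + ψ s) :=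
  ⟨h.measurable.add h'.measurable,
    fun s hs => (norm_add_le _ _).trans (add_le_add (h.bound s hs) (h'.bound s hs)),
    fun s hs => by simp [h.supp s hs, h'.supp s hs]⟩

theorem IsBddTime.const_mul {T M : ℝ} {φ : ℝ → ℂ} (h : IsBddTime T M φ) (c : ℂ) :
    IsBddTime T (‖c‖ * M) (fun s => c * φ s) :=
  ⟨h.measurable.const_mul c,
    fun s hs => by
      rw [norm_mul]; exact mul_le_mul_of_nonneg_left (h.bound s hs) (norm_nonneg _),
    fun s hs => by simp [h.supp s hs]⟩

theorem energy_integrand_norm_le {H T M M' : ℝ} {φ ψ : ℝ → ℂ} (hφ : IsBddTime T M φ)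
    (hψ : IsBddTime T M' ψ) {p : ℝ × ℝ} (hp : p ∈ Ioi (0 : ℝ) ×ˢ Ioi (0 : ℝ)) :
    ‖((|p.1 - p.2| ^ (2 * H - 2) : ℝ) : ℂ) * φ p.1 * conj (ψ p.2)‖ ≤
      (Ioc 0 T ×ˢ Ioc 0 T).indicator (fun p => M * M' * |p.1 - p.2| ^ (2 * H - 2)) p := by
  by_cases h1 : p.1 ≤ T
  · by_cases h2 : p.2 ≤ T
    · rw [indicator_of_mem (show p ∈ Ioc 0 T ×ˢ Ioc 0 T from ⟨⟨hp.1, h1⟩, ⟨hp.2, h2⟩⟩)]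
      rw [norm_mul, norm_mul, RCLike.norm_conj, Complex.norm_real, Real.norm_eq_abs,
        abs_of_nonneg (by positivity)]
      have := mul_le_mul (hφ.bound _ hp.1) (hψ.bound _ hp.2) (norm_nonneg _)
        ((norm_nonneg _).trans (hφ.bound _ hp.1))
      nlinarith [Real.rpow_nonneg (abs_nonneg (p.1 - p.2)) (2 * H - 2)]
    · rw [indicator_of_notMem (fun h => h2 h.2.2), hψ.supp _ (not_le.1 h2)]; simp
  · rw [indicator_of_notMem (fun h => h1 h.1.2), hφ.supp _ (not_le.1 h1)]; simp

theorem integrableOn_energy {H : ℝ} (hH : 1 / 2 < H) {T M M' : ℝ} {φ ψ : ℝ → ℂ}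
    (hφ : IsBddTime T M φ) (hψ : IsBddTime T M' ψ) :
    IntegrableOn (fun p : ℝ × ℝ => ((|p.1 - p.2| ^ (2 * H - 2) : ℝ) : ℂ) * φ p.1 * conj (ψ p.2))
      (Ioi (0 : ℝ) ×ˢ Ioi (0 : ℝ)) := by
  have h1 : Integrable ((Ioc 0 T ×ˢ Ioc 0 T).indicator
      (fun p : ℝ × ℝ => M * M' * |p.1 - p.2| ^ (2 * H - 2))) := by
    rw [integrable_indicator_iff (measurableSet_Ioc.prod measurableSet_Ioc)]
    exact (integrableOn_abs_sub_rpow hH T).const_mul _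
  refine Integrable.mono' h1.integrableOn ?_ ?_
  · have := hφ.measurable
    have := hψ.measurable
    have hc : Measurable fun p : ℝ × ℝ => conj (ψ p.2) :=
      Complex.continuous_conj.measurable.comp (by fun_prop)
    exact Measurable.aestronglyMeasurable (Measurable.mul (by fun_prop) hc)
  · filter_upwards [ae_restrict_mem (measurableSet_Ioi.prod measurableSet_Ioi)] with p hp
    exact energy_integrand_norm_le hφ hψ hp

/-- `α_H ∫_0^T ∫_0^T |r - s|^{2H-2} dr ds`, the squared time norm of `1_{(0,T]}`. -/
def intervalEnergy (H T : ℝ) : ℝ :=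
  alphaH H * ∫ p in Ioc 0 T ×ˢ Ioc (0 : ℝ) T, |p.1 - p.2| ^ (2 * H - 2)

theorem alphaH_pos {H : ℝ} (hH : 1 / 2 < H) : 0 < alphaH H := by
  unfold alphaH; nlinarith

theorem intervalEnergy_nonneg {H : ℝ} (hH : 1 / 2 < H) (T : ℝ) : 0 ≤ intervalEnergy H T :=
  mul_nonneg (alphaH_pos hH).le (integral_nonneg fun _ => by positivity)

theorem timeNormSq_le {H : ℝ} (hH : 1 / 2 < H) {T M : ℝ} {φ : ℝ → ℂ} (hφ : IsBddTime T M φ) :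
    timeNormSq H φ ≤ ENNReal.ofReal (intervalEnergy H T * M ^ 2) := by
  rw [timeNormSq, if_pos (integrableOn_energy hH hφ hφ)]
  refine ENNReal.ofReal_le_ofReal ?_
  rw [intervalEnergy, mul_assoc]
  refine mul_le_mul_of_nonneg_left ?_ (alphaH_pos hH).le
  refine (Complex.re_le_norm _).trans ((norm_integral_le_integral_norm _).trans ?_)
  rw [← integral_mul_const]
  have h1 : IntegrableOn (fun p : ℝ × ℝ => M * M * |p.1 - p.2| ^ (2 * H - 2))
      (Ioc 0 T ×ˢ Ioc 0 T) := (integrableOn_abs_sub_rpow hH T).const_mul _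
  calc _ ≤ ∫ p in Ioi (0 : ℝ) ×ˢ Ioi (0 : ℝ), (Ioc 0 T ×ˢ Ioc 0 T).indicator
        (fun p => M * M * |p.1 - p.2| ^ (2 * H - 2)) p := by
        refine integral_mono_ae (integrableOn_energy hH hφ hφ).norm ?_ ?_
        · exact ((integrable_indicator_iff (measurableSet_Ioc.prod measurableSet_Ioc)).2
            h1).integrableOn
        · filter_upwards [ae_restrict_mem (measurableSet_Ioi.prod measurableSet_Ioi)] with p hp
          exact energy_integrand_norm_le hφ hφ hp
    _ = _ := by
        rw [integral_indicator (measurableSet_Ioc.prod measurableSet_Ioc),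
          Measure.restrict_restrict (measurableSet_Ioc.prod measurableSet_Ioc),
          inter_eq_left.2 (Set.prod_mono Ioc_subset_Ioi_self Ioc_subset_Ioi_self)]
        congr 1; ext p; ring

/-- The transform `φ ↦ ∫_0^∞ expKernel z r φ(r) dr`, which is an isometry from the time norm to
`L²(mixMeasure H)`, up to the factor `α_H`. -/
def expTransform (φ : ℝ → ℂ) (z : ℝ × ℝ) : ℂ := ∫ r in Ioi (0 : ℝ), (expKernel z r : ℂ) * φ r

theorem measurable_expTransform {φ : ℝ → ℂ} (hφ : Measurable φ) : Measurable (expTransform φ) := by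
  have h : StronglyMeasurable fun q : (ℝ × ℝ) × ℝ => (expKernel q.1 q.2 : ℂ) * φ q.2 := by
    have := measurable_expKernel
    exact Measurable.stronglyMeasurable (by fun_prop)
  exact (h.integral_prod_right' (ν := volume.restrict (Ioi (0 : ℝ)))).measurable

theorem expKernel_le_one {z : ℝ × ℝ} (hz : 0 ≤ z.1) (r : ℝ) : expKernel z r ≤ 1 := by
  unfold expKernel
  split_ifs with h
  · exact Real.exp_le_one_iff.2 (by nlinarith)
  · exact zero_le_one

theorem integrableOn_expKernel_mul {T M : ℝ} {φ : ℝ → ℂ} (hφ : IsBddTime T M φ) {z : ℝ × ℝ}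
    (hz : 0 ≤ z.1) : IntegrableOn (fun r => (expKernel z r : ℂ) * φ r) (Ioi 0) := by
  have h1 : Integrable ((Ioc 0 T).indicator fun _ : ℝ => M) := by
    rw [integrable_indicator_iff measurableSet_Ioc]; simp
  refine Integrable.mono' h1.integrableOn ?_ ?_
  · have h : Measurable fun r => expKernel z r :=
      measurable_expKernel.comp (measurable_const.prodMk measurable_id)
    have := hφ.measurable
    exact Measurable.aestronglyMeasurable (by fun_prop)
  · filter_upwards [ae_restrict_mem measurableSet_Ioi] with r hr
    by_cases h : r ≤ T
    · rw [indicator_of_mem (show r ∈ Ioc 0 T from ⟨hr, h⟩), norm_mul, Complex.norm_real,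
        Real.norm_eq_abs, abs_of_nonneg (expKernel_nonneg _ _)]
      have := hφ.bound r hr
      have := expKernel_le_one hz r
      have := expKernel_nonneg z r
      nlinarith [norm_nonneg (φ r)]
    · rw [hφ.supp r (not_le.1 h)]; simp [indicator, h]

theorem ae_fst_nonneg_mixMeasure (H : ℝ) : ∀ᵐ z ∂mixMeasure H, 0 ≤ z.1 := by
  have h1 : ∀ᵐ l ∂rateMeasure H, 0 ≤ l := by
    have : rateMeasure H ≪ volume.restrict (Ioi 0) := withDensity_absolutelyContinuous _ _
    refine this.ae_le ?_
    filter_upwards [ae_restrict_mem measurableSet_Ioi] with l hl using le_of_lt hl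
  exact Measure.quasiMeasurePreserving_fst.ae h1

/-- The isometry identity: the double time integral is the squared `L²` norm of the exponential
transform, by Fubini. -/
theorem energy_eq_integral_expTransform {H : ℝ} (hH : 1 / 2 < H) (hH1 : H < 1) {T M : ℝ}
    {φ : ℝ → ℂ} (hφ : IsBddTime T M φ) :
    Integrable (fun z => ‖expTransform φ z‖ ^ 2) (mixMeasure H) ∧
    ∫ p in Ioi (0 : ℝ) ×ˢ Ioi (0 : ℝ),
      ((|p.1 - p.2| ^ (2 * H - 2) : ℝ) : ℂ) * φ p.1 * conj (φ p.2) =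
    ((∫ z, ‖expTransform φ z‖ ^ 2 ∂mixMeasure H : ℝ) : ℂ) := by
  set ρ : Measure (ℝ × ℝ) := volume.restrict (Ioi (0 : ℝ) ×ˢ Ioi (0 : ℝ)) with hρ
  have hρ' : ρ = (volume.restrict (Ioi (0 : ℝ))).prod (volume.restrict (Ioi (0 : ℝ))) := by
    rw [hρ, Measure.prod_restrict]; rfl
  have hne : ∀ᵐ p ∂ρ, p.1 ≠ p.2 := by
    refine ae_restrict_of_ae ?_
    rw [Measure.volume_eq_prod, Measure.ae_prod_iff_ae_ae]
    · exact Eventually.of_forall fun x => by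
        have : ∀ᵐ y : ℝ, y ≠ x := by simp [ae_iff]
        filter_upwards [this] with y hy using hy.symm
    · exact (measurableSet_eq_fun measurable_fst measurable_snd).compl
  have hK := measurable_expKernel
  have hφm := hφ.measurable
  have hcm : Measurable fun s => conj (φ s) := Complex.continuous_conj.measurable.comp hφm
  set F : (ℝ × ℝ) × (ℝ × ℝ) → ℂ := fun q =>
    ((expKernel q.2 q.1.1 : ℂ) * φ q.1.1) * ((expKernel q.2 q.1.2 : ℂ) * conj (φ q.1.2)) with hF
  have hFm : Measurable F := by
    have h1 : Measurable fun q : (ℝ × ℝ) × (ℝ × ℝ) => expKernel q.2 q.1.1 :=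
      hK.comp (measurable_snd.prodMk (measurable_fst.comp measurable_fst))
    have h2 : Measurable fun q : (ℝ × ℝ) × (ℝ × ℝ) => expKernel q.2 q.1.2 :=
      hK.comp (measurable_snd.prodMk (measurable_snd.comp measurable_fst))
    have h3 : Measurable fun q : (ℝ × ℝ) × (ℝ × ℝ) => conj (φ q.1.2) :=
      hcm.comp (measurable_snd.comp measurable_fst)
    exact Measurable.mul (by fun_prop) (Measurable.mul (by fun_prop) h3)
  have hF1 : ∀ p z, F (p, z) =
      ((expKernel z p.1 * expKernel z p.2 : ℝ) : ℂ) * (φ p.1 * conj (φ p.2)) := by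
    intro p z; simp only [hF]; push_cast; ring
  have hFnorm : ∀ p z, ‖F (p, z)‖ =
      expKernel z p.1 * expKernel z p.2 * ‖φ p.1 * conj (φ p.2)‖ := by
    intro p z
    rw [hF1, norm_mul, Complex.norm_real, Real.norm_eq_abs,
      abs_of_nonneg (mul_nonneg (expKernel_nonneg _ _) (expKernel_nonneg _ _))]
  have hen := integrableOn_energy hH hφ hφ
  have hFi : Integrable F (ρ.prod (mixMeasure H)) := by
    rw [integrable_prod_iff hFm.aestronglyMeasurable]
    constructor
    · filter_upwards [hne] with p hp
      simp_rw [hF1]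
      exact (integrable_expKernel_mul hH1 hp).ofReal.mul_const _
    · refine hen.norm.congr ?_
      filter_upwards [hne] with p hp
      simp_rw [hFnorm]
      rw [integral_mul_const, integral_expKernel_mul hH1 hp, mul_assoc, norm_mul,
        Complex.norm_real, Real.norm_eq_abs, abs_of_nonneg (by positivity)]
  have h1 : ∫ p, ((|p.1 - p.2| ^ (2 * H - 2) : ℝ) : ℂ) * φ p.1 * conj (φ p.2) ∂ρ =
      ∫ p, ∫ z, F (p, z) ∂mixMeasure H ∂ρ := by
    refine integral_congr_ae ?_
    filter_upwards [hne] with p hp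
    simp_rw [hF1]
    rw [integral_mul_const, integral_complex_ofReal, integral_expKernel_mul hH1 hp, mul_assoc]
  have h2 : ∀ z, ∫ p, F (p, z) ∂ρ = ((‖expTransform φ z‖ ^ 2 : ℝ) : ℂ) := by
    intro z
    simp only [hF]
    rw [hρ', integral_prod_mul (fun r => (expKernel z r : ℂ) * φ r)
      (fun s => (expKernel z s : ℂ) * conj (φ s))]
    have : ∫ s in Ioi (0 : ℝ), (expKernel z s : ℂ) * conj (φ s) = conj (expTransform φ z) := by
      rw [expTransform, ← integral_conj]
      simp
    rw [this]
    change expTransform φ z * _ = _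
    rw [Complex.mul_conj, Complex.normSq_eq_norm_sq]
  constructor
  · have := hFi.integral_prod_right
    simp_rw [h2] at this
    exact this.re
  · rw [h1, integral_integral_swap hFi]
    simp_rw [h2]
    exact integral_complex_ofReal

theorem timeNormSq_eq_lintegral {H : ℝ} (hH : 1 / 2 < H) (hH1 : H < 1) {T M : ℝ} {φ : ℝ → ℂ}
    (hφ : IsBddTime T M φ) :
    timeNormSq H φ = ENNReal.ofReal (alphaH H) * ∫⁻ z, ‖expTransform φ z‖ₑ ^ 2 ∂mixMeasure H := by
  obtain ⟨h1, h2⟩ := energy_eq_integral_expTransform hH hH1 hφ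
  rw [timeNormSq, if_pos (integrableOn_energy hH hφ hφ), h2, Complex.ofReal_re,
    ENNReal.ofReal_mul (alphaH_pos hH).le,
    ofReal_integral_eq_lintegral_ofReal h1 (Eventually.of_forall fun _ => by positivity)]
  congr 2
  ext z
  rw [ENNReal.ofReal_pow (norm_nonneg _), ofReal_norm]

/-- The double time integral which defines the time norm is nonnegative. -/
theorem energy_re_nonneg {H : ℝ} (hH : 1 / 2 < H) (hH1 : H < 1) {T M : ℝ} {φ : ℝ → ℂ}
    (hφ : IsBddTime T M φ) :
    0 ≤ (∫ p in Ioi (0 : ℝ) ×ˢ Ioi (0 : ℝ),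
      ((|p.1 - p.2| ^ (2 * H - 2) : ℝ) : ℂ) * φ p.1 * conj (φ p.2)).re := by
  rw [(energy_eq_integral_expTransform hH hH1 hφ).2, Complex.ofReal_re]
  exact integral_nonneg fun _ => by positivity

theorem timeNormSq_const_mul {H : ℝ} (hH : 1 / 2 < H) (hH1 : H < 1) {T M : ℝ} {φ : ℝ → ℂ}
    (hφ : IsBddTime T M φ) (c : ℂ) :
    timeNormSq H (fun s => c * φ s) = ‖c‖ₑ ^ 2 * timeNormSq H φ := by
  rw [timeNormSq_eq_lintegral hH hH1 hφ, timeNormSq_eq_lintegral hH hH1 (hφ.const_mul c)]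
  have : ∀ z, expTransform (fun s => c * φ s) z = c * expTransform φ z := by
    intro z
    rw [expTransform, expTransform, ← integral_const_mul]
    congr 1; ext r; ring
  simp_rw [this, enorm_mul, mul_pow]
  rw [lintegral_const_mul' _ _ (by simp)]
  ring

theorem enorm_add_sq_le {E : Type*} [SeminormedAddCommGroup E] (a b : E) :
    ‖a + b‖ₑ ^ 2 ≤ 2 * ‖a‖ₑ ^ 2 + 2 * ‖b‖ₑ ^ 2 := by
  have h : ‖a + b‖ ^ 2 ≤ 2 * ‖a‖ ^ 2 + 2 * ‖b‖ ^ 2 := by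
    have := norm_add_le a b
    nlinarith [sq_nonneg (‖a‖ - ‖b‖), norm_nonneg (a + b), norm_nonneg a, norm_nonneg b]
  have := ENNReal.ofReal_le_ofReal h
  rw [ENNReal.ofReal_add (by positivity) (by positivity), ENNReal.ofReal_mul (by norm_num),
    ENNReal.ofReal_mul (by norm_num)] at this
  simpa [ENNReal.ofReal_pow, ofReal_norm] using this

theorem timeNormSq_add_le {H : ℝ} (hH : 1 / 2 < H) (hH1 : H < 1) {T M M' : ℝ} {φ ψ : ℝ → ℂ}
    (hφ : IsBddTime T M φ) (hψ : IsBddTime T M' ψ) :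
    timeNormSq H (fun s => φ s + ψ s) ≤ 2 * timeNormSq H φ + 2 * timeNormSq H ψ := by
  rw [timeNormSq_eq_lintegral hH hH1 hφ, timeNormSq_eq_lintegral hH hH1 hψ,
    timeNormSq_eq_lintegral hH hH1 (hφ.add hψ)]
  calc _ ≤ ENNReal.ofReal (alphaH H) * ∫⁻ z, (2 * ‖expTransform φ z‖ₑ ^ 2 +
        2 * ‖expTransform ψ z‖ₑ ^ 2) ∂mixMeasure H := by
        refine mul_le_mul' le_rfl (lintegral_mono_ae ?_)
        filter_upwards [ae_fst_nonneg_mixMeasure H] with z hz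
        have : expTransform (fun s => φ s + ψ s) z = expTransform φ z + expTransform ψ z := by
          rw [expTransform, expTransform, expTransform,
            ← integral_add (integrableOn_expKernel_mul hφ hz) (integrableOn_expKernel_mul hψ hz)]
          congr 1; ext r; ring
        rw [this]
        exact enorm_add_sq_le _ _
    _ = _ := by
        rw [lintegral_add_left
          (((measurable_expTransform hφ.measurable).enorm.pow_const 2).const_mul 2),
          lintegral_const_mul' _ _ (by simp), lintegral_const_mul' _ _ (by simp)]
        ring

/-! ### Two-sided bounds for the time norm of the wave kernel -/

/-- The time factor `s ↦ 1_{[0,t]}(s) sin(√p (t-s)) / √p` of the integrand of the weak solution. -/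
def waveTime (p t : ℝ) : ℝ → ℂ :=
  (Icc (0 : ℝ) t).indicator fun s => ((waveKernel p (t - s) : ℝ) : ℂ)

theorem continuous_waveKernel : Continuous fun q : ℝ × ℝ => waveKernel q.1 q.2 := by
  unfold waveKernel
  exact continuous_snd.mul (Real.continuous_sinc.comp (by fun_prop))

theorem abs_waveKernel_le (p τ : ℝ) : |waveKernel p τ| ≤ |τ| := by
  unfold waveKernel
  rw [abs_mul]
  exact mul_le_of_le_one_right (abs_nonneg _) (Real.abs_sinc_le_one _)

theorem waveKernel_of_pos {p : ℝ} (hp : 0 < p) (τ : ℝ) :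
    waveKernel p τ = Real.sin (√p * τ) / √p := by
  have hq : √p ≠ 0 := (Real.sqrt_pos.2 hp).ne'
  unfold waveKernel
  rcases eq_or_ne τ 0 with rfl | hτ
  · simp
  · rw [Real.sinc_of_ne_zero (mul_ne_zero hq hτ)]; field_simp

theorem isBddTime_waveTime (p : ℝ) {t : ℝ} (ht : 0 ≤ t) : IsBddTime t t (waveTime p t) where
  measurable := by
    refine Measurable.indicator ?_ measurableSet_Icc
    exact (Complex.continuous_ofReal.comp (continuous_waveKernel.comp
      (show Continuous fun s : ℝ => (p, t - s) by fun_prop))).measurable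
  bound s hs := by
    unfold waveTime
    by_cases h : s ∈ Icc 0 t
    · rw [indicator_of_mem h, Complex.norm_real, Real.norm_eq_abs]
      refine (abs_waveKernel_le _ _).trans ?_
      rw [abs_of_nonneg (by linarith [h.2])]; linarith
    · rw [indicator_of_notMem h]; simpa
  supp s hs := by
    unfold waveTime
    exact indicator_of_notMem (fun h => (not_le.2 hs) h.2) _

/-- The response `∫_0^w e^{-l(w-v)} sin(q v)/q dv` of the exponential kernel of rate `l` to a sine
of frequency `q`. -/
def waveResponse (l q w : ℝ) : ℝ :=
  (l * Real.sin (q * w) - q * Real.cos (q * w) + q * Real.exp (-(l * w))) / (q * (l ^ 2 + q ^ 2))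

/-- Up to a decaying factor, the exponential transform of the wave kernel on `[a, t]` is
`waveResponse`. -/
theorem integral_exp_mul_sin {l q : ℝ} (hq : 0 < q) (u a t : ℝ) :
    ∫ r in a..t, Real.exp (-(l * (r - u))) * (Real.sin (q * (t - r)) / q) =
      Real.exp (-(l * (a - u))) * waveResponse l q (t - a) := by
  have hD : l ^ 2 + q ^ 2 ≠ 0 := by positivity
  have hder : ∀ r ∈ uIcc a t, HasDerivAt (fun r => Real.exp (-(l * (r - u))) *
      ((-l * Real.sin (q * (t - r)) + q * Real.cos (q * (t - r))) / (q * (l ^ 2 + q ^ 2))))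
      (Real.exp (-(l * (r - u))) * (Real.sin (q * (t - r)) / q)) r := by
    intro r _
    have h1 : HasDerivAt (fun r => Real.exp (-(l * (r - u))))
        (Real.exp (-(l * (r - u))) * -(l * 1)) r :=
      ((((hasDerivAt_id r).sub_const u).const_mul l).neg).exp
    have h0 : HasDerivAt (fun r => q * (t - r)) (q * -1) r :=
      ((hasDerivAt_id r).const_sub t).const_mul q
    have h2 := ((h0.sin.const_mul (-l)).add (h0.cos.const_mul q)).div_const (q * (l ^ 2 + q ^ 2))
    refine (h1.mul h2).congr_deriv ?_
    simp only [Pi.add_apply]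
    field_simp
    ring
  rw [intervalIntegral.integral_eq_sub_of_hasDerivAt hder
    (Continuous.intervalIntegrable (by fun_prop) _ _)]
  have h3 : Real.exp (-(l * (t - u))) = Real.exp (-(l * (a - u))) * Real.exp (-(l * (t - a))) := by
    rw [← Real.exp_add]; congr 1; ring
  rw [h3, waveResponse]
  simp only [sub_self, mul_zero, Real.sin_zero, Real.cos_zero]
  field_simp
  ring

theorem expTransform_waveTime {p : ℝ} (hp : 0 < p) {t : ℝ} (ht : 0 ≤ t) (l : ℝ) {u : ℝ}
    (hu : u ≤ t) : expTransform (waveTime p t) (l, u) =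
      ((Real.exp (-(l * (max u 0 - u))) * waveResponse l (√p) (t - max u 0) : ℝ) : ℂ) := by
  have hq := Real.sqrt_pos.2 hp
  rw [← integral_exp_mul_sin hq, intervalIntegral.integral_of_le (max_le hu ht), expTransform,
    ← integral_complex_ofReal, ← integral_indicator measurableSet_Ioi,
    ← integral_indicator measurableSet_Ioc]
  refine integral_congr_ae ?_
  have : ∀ᵐ r : ℝ, r ≠ u := by simp [ae_iff]
  filter_upwards [this] with r hr
  by_cases h1 : r ∈ Ioc (max u 0) t
  · have h2 : 0 < r := (le_max_right _ _).trans_lt h1.1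
    have h3 : u ≤ r := ((le_max_left _ _).trans_lt h1.1).le
    rw [indicator_of_mem h1, indicator_of_mem (show r ∈ Ioi 0 from h2), waveTime,
      indicator_of_mem (show r ∈ Icc 0 t from ⟨h2.le, h1.2⟩), waveKernel_of_pos hp]
    simp [expKernel, h3]
  · rw [indicator_of_notMem h1]
    by_cases h2 : r ∈ Ioi (0 : ℝ)
    · rw [indicator_of_mem h2]
      by_cases h3 : r ≤ t
      · have h4 : ¬ u ≤ r := fun h => h1 ⟨max_lt (lt_of_le_of_ne h hr.symm) h2, h3⟩
        simp [expKernel, h4]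
      · rw [waveTime, indicator_of_notMem (fun h => h3 h.2)]; simp
    · rw [indicator_of_notMem h2]

theorem expTransform_waveTime_of_lt (p : ℝ) {t u : ℝ} (l : ℝ) (hu : t < u) :
    expTransform (waveTime p t) (l, u) = 0 := by
  rw [expTransform]
  refine integral_eq_zero_of_ae (Eventually.of_forall fun r => ?_)
  by_cases h : u ≤ r
  · simp [waveTime, indicator_of_notMem (fun h' : r ∈ Icc 0 t => not_le.2 hu (h.trans h'.2))]
  · simp [expKernel, h]

theorem waveResponse_sq_le {l q w : ℝ} (hl : 0 < l) (hq : 0 < q) (hw : 0 ≤ w) :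
    waveResponse l q w ^ 2 ≤ 5 / (q ^ 2 * (l ^ 2 + q ^ 2)) := by
  have h1 : |l * Real.sin (q * w) - q * Real.cos (q * w) + q * Real.exp (-(l * w))| ≤
      l + 2 * q := by
    have e0 := Real.exp_pos (-(l * w))
    have e1 : Real.exp (-(l * w)) ≤ 1 := Real.exp_le_one_iff.2 (by nlinarith)
    have s1 := Real.neg_one_le_sin (q * w)
    have s2 := Real.sin_le_one (q * w)
    have c1 := Real.neg_one_le_cos (q * w)
    have c2 := Real.cos_le_one (q * w)
    rw [abs_le]
    constructor <;> nlinarith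
  have h2 : (l * Real.sin (q * w) - q * Real.cos (q * w) + q * Real.exp (-(l * w))) ^ 2 ≤
      5 * (l ^ 2 + q ^ 2) := by
    rw [← sq_abs]
    have := abs_nonneg (l * Real.sin (q * w) - q * Real.cos (q * w) + q * Real.exp (-(l * w)))
    nlinarith [sq_nonneg (2 * l - q)]
  rw [waveResponse, div_pow, div_le_div_iff₀ (by positivity) (by positivity)]
  calc _ ≤ 5 * (l ^ 2 + q ^ 2) * (q ^ 2 * (l ^ 2 + q ^ 2)) := by gcongr
    _ = _ := by ring

/-- The starting points `u ∈ [0, t]` contribute the summand `t`; those with `u < 0` contribute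
`1 / (2l)`, by the decay `e^{lu}` of the exponential kernel up to time `0`. -/
theorem lintegral_expTransform_waveTime_le {p : ℝ} (hp : 0 < p) {t : ℝ} (ht : 0 ≤ t) {l : ℝ}
    (hl : 0 < l) : ∫⁻ u, ‖expTransform (waveTime p t) (l, u)‖ₑ ^ 2 ≤
      ENNReal.ofReal (5 / (p * (l ^ 2 + p)) * (t + 1 / (2 * l))) := by
  have hq := Real.sqrt_pos.2 hp
  have hqq := Real.sq_sqrt hp.le
  set c : ℝ := 5 / (p * (l ^ 2 + p)) with hc
  have hc0 : 0 ≤ c := by positivity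
  have hb : ∀ u, ‖expTransform (waveTime p t) (l, u)‖ₑ ^ 2 ≤
      (Icc 0 t).indicator (fun _ => ENNReal.ofReal c) u +
      (Iic 0).indicator (fun u => ENNReal.ofReal (c * Real.exp (2 * l * u))) u := by
    intro u
    rcases lt_or_ge t u with h | h
    · simp [expTransform_waveTime_of_lt p l h]
    · rw [expTransform_waveTime hp ht l h, ← ofReal_norm, Complex.norm_real,
        ← ENNReal.ofReal_pow (norm_nonneg _), Real.norm_eq_abs, sq_abs, mul_pow]
      have hr := waveResponse_sq_le (w := t - max u 0) hl hq (by
        rw [sub_nonneg]; exact max_le h ht)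
      rw [hqq, ← hc] at hr
      rcases le_total 0 u with h0 | h0
      · rw [indicator_of_mem (show u ∈ Icc 0 t from ⟨h0, h⟩)]
        refine le_add_right (ENNReal.ofReal_le_ofReal ?_)
        rw [max_eq_left h0] at hr ⊢
        simpa using hr
      · rw [indicator_of_mem (show u ∈ Iic 0 from h0)]
        refine le_add_left (ENNReal.ofReal_le_ofReal ?_)
        rw [max_eq_right h0] at hr ⊢
        have : Real.exp (-(l * (0 - u))) ^ 2 = Real.exp (2 * l * u) := by
          rw [← Real.exp_nat_mul]; congr 1; push_cast; ring
        rw [this, mul_comm c]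
        gcongr
  refine (lintegral_mono hb).trans ?_
  rw [lintegral_add_left (measurable_const.indicator measurableSet_Icc),
    lintegral_indicator measurableSet_Icc, lintegral_indicator measurableSet_Iic,
    ← ofReal_integral_eq_lintegral_ofReal ((integrableOn_exp_mul_Iic (by positivity) 0).const_mul c)
      (Eventually.of_forall fun u => by positivity),
    integral_const_mul, integral_exp_mul_Iic (by positivity)]
  simp only [lintegral_const, MeasurableSet.univ, Measure.restrict_apply, univ_inter,
    Real.volume_Icc, sub_zero, mul_zero, Real.exp_zero]
  rw [← ENNReal.ofReal_mul hc0, ← ENNReal.ofReal_add (by positivity) (by positivity), mul_add]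

/-- The denominator is bounded below by `p` for `l ≤ √p` and by `l²` for `l > √p`. -/
theorem lintegral_rpow_div_sq_add_le {a p : ℝ} (ha : -1 < a) (ha1 : a < 1) (hp : 0 < p) :
    ∫⁻ l in Ioi 0, ENNReal.ofReal (l ^ a / (l ^ 2 + p)) ≤
      ENNReal.ofReal ((1 / (a + 1) + 1 / (1 - a)) * √p ^ (a - 1)) := by
  have hq := Real.sqrt_pos.2 hp
  set q := √p with hqd
  have hqq : q ^ 2 = p := Real.sq_sqrt hp.le
  have h1 : 0 < a + 1 := by linarith
  have h2 : 0 < 1 - a := by linarith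
  rw [← Ioc_union_Ioi_eq_Ioi hq.le]
  refine (lintegral_union_le _ _ _).trans ?_
  rw [add_mul, ENNReal.ofReal_add (by positivity) (by positivity)]
  gcongr
  · calc _ ≤ ∫⁻ l in Ioc 0 q, ENNReal.ofReal (l ^ a * p⁻¹) := by
          refine setLIntegral_mono' measurableSet_Ioc fun l hl => ENNReal.ofReal_le_ofReal ?_
          have := hl.1
          rw [← div_eq_mul_inv]
          gcongr
          nlinarith
      _ = ENNReal.ofReal (∫ l in Ioc 0 q, l ^ a * p⁻¹) := by
          rw [ofReal_integral_eq_lintegral_ofReal]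
          · have := (intervalIntegral.intervalIntegrable_rpow' (a := 0) (b := q) ha).1
            exact this.mul_const _
          · filter_upwards [ae_restrict_mem measurableSet_Ioc] with l hl
            have := hl.1
            positivity
      _ ≤ _ := by
          rw [integral_mul_const, ← intervalIntegral.integral_of_le hq.le,
            integral_rpow (Or.inl ha), Real.zero_rpow h1.ne', sub_zero]
          refine le_of_eq ?_
          congr 1
          have : q ^ (a - 1) = q ^ (a + 1) * p⁻¹ := by
            rw [← hqq, ← Real.rpow_natCast, ← Real.rpow_neg hq.le, ← Real.rpow_add hq]
            congr 1; push_cast; ring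
          rw [this]; ring
  · calc _ ≤ ∫⁻ l in Ioi q, ENNReal.ofReal (l ^ (a - 2)) := by
          refine setLIntegral_mono' measurableSet_Ioi fun l hl => ENNReal.ofReal_le_ofReal ?_
          have hl0 : 0 < l := hq.trans hl
          have h3 : l ^ (a - 2) = l ^ a / l ^ 2 := by
            rw [← Real.rpow_natCast, ← Real.rpow_sub hl0]; norm_num
          rw [h3]
          gcongr
          linarith
      _ = ENNReal.ofReal (∫ l in Ioi q, l ^ (a - 2)) := by
          rw [ofReal_integral_eq_lintegral_ofReal]
          · exact integrableOn_Ioi_rpow_of_lt (by linarith) hq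
          · filter_upwards [ae_restrict_mem measurableSet_Ioi] with l hl
            have := hq.trans hl
            positivity
      _ ≤ _ := by
          rw [integral_Ioi_rpow_of_lt (by linarith) hq]
          refine le_of_eq ?_
          congr 1
          have : a - 2 + 1 = a - 1 := by ring
          rw [this, one_div, ← neg_sub a 1, inv_neg]; ring

theorem measurable_enorm_expTransform_sq {p t : ℝ} (ht : 0 ≤ t) :
    Measurable fun z => ‖expTransform (waveTime p t) z‖ₑ ^ 2 :=
  (measurable_expTransform (isBddTime_waveTime p ht).measurable).enorm.pow_const 2

theorem sqrt_rpow_eq {p : ℝ} (hp : 0 < p) (H : ℝ) :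
    √p ^ (2 - 2 * H - 1) / p = (1 / p) ^ (H + 1 / 2) := by
  rw [Real.sqrt_eq_rpow, ← Real.rpow_mul hp.le, one_div p, Real.inv_rpow hp.le,
    ← Real.rpow_neg hp.le]
  nth_rw 2 [← Real.rpow_one p]
  rw [← Real.rpow_sub hp]
  congr 1; ring

/-- The upper bound for large frequencies, where `N_t(p)` is the squared time norm of
`waveTime p t`: the bound for each rate `l` is integrated against the mixing density. -/
theorem timeNormSq_waveTime_le_of_one_le {H : ℝ} (hH : 1 / 2 < H) (hH1 : H < 1) {t : ℝ}
    (ht : 0 ≤ t) : ∃ C : ℝ, 0 ≤ C ∧ ∀ p, 1 ≤ p →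
      timeNormSq H (waveTime p t) ≤ ENNReal.ofReal (C * (1 / p) ^ (H + 1 / 2)) := by
  set b : ℝ := 2 - 2 * H with hb
  have hG := Real.Gamma_pos_of_pos (show 0 < b by linarith)
  set A : ℝ := 1 / (b + 1) + 1 / (1 - b) with hA
  set B : ℝ := 1 / (b - 1 + 1) + 1 / (1 - (b - 1)) with hB
  have hA0 : 0 ≤ A := by
    have : 0 < b + 1 := by linarith
    have : 0 < 1 - b := by linarith
    positivity
  have hB0 : 0 ≤ B := by
    have : 0 < b - 1 + 1 := by linarith
    have : 0 < 1 - (b - 1) := by linarith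
    positivity
  have hα := alphaH_pos hH
  refine ⟨alphaH H * (10 / Real.Gamma b * (t * A + B / 2)), by positivity, fun p hp => ?_⟩
  have hp0 : 0 < p := by linarith
  have hq := Real.sqrt_pos.2 hp0
  rw [timeNormSq_eq_lintegral hH hH1 (isBddTime_waveTime p ht),
    lintegral_mixMeasure H (measurable_enorm_expTransform_sq ht), mul_assoc,
    ENNReal.ofReal_mul hα.le]
  gcongr
  set k : ℝ := 10 / Real.Gamma b / p with hk
  have hk0 : 0 ≤ k := by positivity
  calc _ ≤ ∫⁻ l in Ioi 0, (ENNReal.ofReal (k * t) * ENNReal.ofReal (l ^ b / (l ^ 2 + p)) +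
        ENNReal.ofReal (k / 2) * ENNReal.ofReal (l ^ (b - 1) / (l ^ 2 + p))) := by
        refine setLIntegral_mono' measurableSet_Ioi fun l hl => ?_
        have hl0 : 0 < l := hl
        refine (mul_le_mul' le_rfl (lintegral_expTransform_waveTime_le hp0 ht hl0)).trans ?_
        rw [← ENNReal.ofReal_mul (rateDensity_nonneg hH1 hl0.le),
          ← ENNReal.ofReal_mul (by positivity), ← ENNReal.ofReal_mul (by positivity),
          ← ENNReal.ofReal_add (by positivity) (by positivity)]
        refine le_of_eq ?_
        congr 1
        rw [rateDensity, hk, Real.rpow_sub_one hl0.ne', ← hb]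
        field_simp
        ring
    _ ≤ ENNReal.ofReal (k * t) * ENNReal.ofReal (A * √p ^ (b - 1)) +
        ENNReal.ofReal (k / 2) * ENNReal.ofReal (B * √p ^ (b - 1 - 1)) := by
        rw [lintegral_add_left (by fun_prop), lintegral_const_mul' _ _ ENNReal.ofReal_ne_top,
          lintegral_const_mul' _ _ ENNReal.ofReal_ne_top]
        gcongr
        · exact lintegral_rpow_div_sq_add_le (by linarith) (by linarith) hp0
        · exact lintegral_rpow_div_sq_add_le (by linarith) (by linarith) hp0
    _ ≤ ENNReal.ofReal (10 / Real.Gamma b * (t * A + B / 2) * (√p ^ (b - 1) / p)) := by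
        rw [← ENNReal.ofReal_mul (by positivity), ← ENNReal.ofReal_mul (by positivity),
          ← ENNReal.ofReal_add (by positivity) (by positivity)]
        refine ENNReal.ofReal_le_ofReal ?_
        have h1 : √p ^ (b - 1 - 1) ≤ √p ^ (b - 1) :=
          Real.rpow_le_rpow_of_exponent_le (Real.one_le_sqrt.2 hp) (by linarith)
        calc _ ≤ k * t * (A * √p ^ (b - 1)) + k / 2 * (B * √p ^ (b - 1)) := by gcongr
          _ = _ := by rw [hk]; ring
    _ = _ := by rw [sqrt_rpow_eq hp0]

/-- The squared time norm of `waveTime p t` is at most `C_t (1 + p)^{-(H + 1/2)}`. -/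
theorem timeNormSq_waveTime_le {H : ℝ} (hH : 1 / 2 < H) (hH1 : H < 1) {t : ℝ} (ht : 0 ≤ t) :
    ∃ C : ℝ, 0 ≤ C ∧ ∀ p, 0 ≤ p →
      timeNormSq H (waveTime p t) ≤ ENNReal.ofReal (C * (1 / (1 + p)) ^ (H + 1 / 2)) := by
  obtain ⟨C, hC, h⟩ := timeNormSq_waveTime_le_of_one_le hH hH1 ht
  have hI := intervalEnergy_nonneg hH t
  have h2 : (0 : ℝ) < 2 ^ (H + 1 / 2) := by positivity
  refine ⟨2 ^ (H + 1 / 2) * (C + intervalEnergy H t * t ^ 2), by positivity, fun p hp => ?_⟩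
  rcases le_total 1 p with h1 | h1
  · refine (h p h1).trans (ENNReal.ofReal_le_ofReal ?_)
    have h3 : (1 / p) ^ (H + 1 / 2) ≤ 2 ^ (H + 1 / 2) * (1 / (1 + p)) ^ (H + 1 / 2) := by
      rw [← Real.mul_rpow (by norm_num) (by positivity)]
      refine Real.rpow_le_rpow (by positivity) ?_ (by linarith)
      rw [mul_one_div, div_le_div_iff₀ (by positivity) (by positivity)]; linarith
    calc _ ≤ C * (2 ^ (H + 1 / 2) * (1 / (1 + p)) ^ (H + 1 / 2)) := by gcongr
      _ ≤ (C + intervalEnergy H t * t ^ 2) * (2 ^ (H + 1 / 2) * (1 / (1 + p)) ^ (H + 1 / 2)) := by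
          gcongr
          have : 0 ≤ intervalEnergy H t * t ^ 2 := by positivity
          linarith
      _ = _ := by ring
  · refine (timeNormSq_le hH (isBddTime_waveTime p ht)).trans (ENNReal.ofReal_le_ofReal ?_)
    have h3 : 1 ≤ 2 ^ (H + 1 / 2) * (1 / (1 + p)) ^ (H + 1 / 2) := by
      rw [← Real.mul_rpow (by norm_num) (by positivity)]
      refine Real.one_le_rpow ?_ (by linarith)
      rw [mul_one_div, le_div_iff₀ (by positivity)]; linarith
    calc _ ≤ (C + intervalEnergy H t * t ^ 2) * 1 := by linarith
      _ ≤ (C + intervalEnergy H t * t ^ 2) * (2 ^ (H + 1 / 2) * (1 / (1 + p)) ^ (H + 1 / 2)) := by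
          gcongr
      _ = _ := by ring

/-- A lower bound for the response when the rate is comparable with the frequency. The constant
term `1/2` survives integration in `w`, whereas the response itself may vanish at some times. -/
theorem le_waveResponse_sq {l q w : ℝ} (hq : 0 < q) (hl : q ≤ l) (hl2 : l ≤ 2 * q) (hw : 0 ≤ w) :
    1 / (25 * q ^ 4) * (1 / 2 - l / q / 2 * Real.sin (2 * q * w) - Real.exp (-2 * q * w)) ≤
      waveResponse l q w ^ 2 := by
  have hl0 : 0 < l := by linarith
  set s := Real.sin (q * w) with hs
  set c := Real.cos (q * w) with hc
  set e := Real.exp (-(l * w)) with he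
  have hsc : s ^ 2 + c ^ 2 = 1 := Real.sin_sq_add_cos_sq _
  have h1 : Real.sin (2 * q * w) = 2 * s * c := by
    rw [show 2 * q * w = 2 * (q * w) by ring, Real.sin_two_mul]
  have h2 : e ^ 2 ≤ Real.exp (-2 * q * w) := by
    rw [he, ← Real.exp_nat_mul]
    refine Real.exp_le_exp.2 ?_
    push_cast
    nlinarith
  set m := l / q with hm
  have hm1 : 1 ≤ m := (one_le_div hq).2 hl
  have hlm : l = m * q := by rw [hm]; field_simp
  have h3 : 1 / 2 - m / 2 * Real.sin (2 * q * w) - Real.exp (-2 * q * w) ≤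
      (m * s - c + e) ^ 2 := by
    rw [h1]
    have : 0 ≤ (m ^ 2 - 1) * s ^ 2 := mul_nonneg (by nlinarith) (sq_nonneg _)
    nlinarith [sq_nonneg (m * s - c + 2 * e)]
  have h4 : waveResponse l q w ^ 2 = (1 / (l ^ 2 + q ^ 2)) ^ 2 * (m * s - c + e) ^ 2 := by
    rw [waveResponse, ← mul_pow]
    congr 1
    rw [← hs, ← hc, ← he]
    have hD : l ^ 2 + q ^ 2 ≠ 0 := by positivity
    field_simp
    rw [hm]
    field_simp
  have h5 : 1 / (25 * q ^ 4) ≤ (1 / (l ^ 2 + q ^ 2)) ^ 2 := by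
    rw [div_pow, one_pow]
    refine one_div_le_one_div_of_le (by positivity) ?_
    have : l ^ 2 + q ^ 2 ≤ 5 * q ^ 2 := by nlinarith
    calc _ ≤ (5 * q ^ 2) ^ 2 := by gcongr
      _ = _ := by ring
  rw [h4]
  calc _ ≤ 1 / (25 * q ^ 4) * (m * s - c + e) ^ 2 := by gcongr
    _ ≤ _ := by gcongr

/-- The condition `6 ≤ q` makes the oscillating and the decaying terms of `le_waveResponse_sq`
integrate to at most `1/4` in total, half of the contribution of the constant term `1/2`. -/
theorem le_integral_waveResponse_sq {l q : ℝ} (hq : 6 ≤ q) (hl : q ≤ l) (hl2 : l ≤ 2 * q) :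
    1 / (100 * q ^ 4) ≤ ∫ u in (0 : ℝ)..1, waveResponse l q (1 - u) ^ 2 := by
  have hq0 : 0 < q := by linarith
  rw [intervalIntegral.integral_comp_sub_left (fun w => waveResponse l q w ^ 2) 1]
  simp only [sub_self, sub_zero]
  have hD : q * (l ^ 2 + q ^ 2) ≠ 0 := by positivity
  -- an antiderivative of the lower bound of `le_waveResponse_sq`
  have hder : ∀ w ∈ uIcc (0 : ℝ) 1, HasDerivAt (fun w => 1 / (25 * q ^ 4) *
      (1 / 2 * w + l / q / (4 * q) * Real.cos (2 * q * w) + 1 / (2 * q) * Real.exp (-2 * q * w)))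
      (1 / (25 * q ^ 4) *
        (1 / 2 - l / q / 2 * Real.sin (2 * q * w) - Real.exp (-2 * q * w))) w := by
    intro w _
    have h1 : HasDerivAt (fun w => 2 * q * w) (2 * q * 1) w := (hasDerivAt_id w).const_mul _
    have h2 : HasDerivAt (fun w => -2 * q * w) (-2 * q * 1) w := (hasDerivAt_id w).const_mul _
    have h3 := ((((hasDerivAt_id w).const_mul (1 / 2)).add (h1.cos.const_mul (l / q / (4 * q)))).add
      (h2.exp.const_mul (1 / (2 * q)))).const_mul (1 / (25 * q ^ 4))
    refine h3.congr_deriv ?_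
    field_simp
    ring
  have hint := intervalIntegral.integral_eq_sub_of_hasDerivAt hder
    (Continuous.intervalIntegrable (by fun_prop) _ _)
  calc _ ≤ ∫ w in (0 : ℝ)..1, 1 / (25 * q ^ 4) *
        (1 / 2 - l / q / 2 * Real.sin (2 * q * w) - Real.exp (-2 * q * w)) := by
        rw [hint]
        have hm2 : l / q ≤ 2 := (div_le_iff₀ hq0).2 hl2
        have hm0 : 0 ≤ l / q := div_nonneg (hq0.le.trans hl) hq0.le
        have c1 := Real.neg_one_le_cos (2 * q * 1)
        have e0 := Real.exp_pos (-2 * q * 1)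
        rw [← mul_sub]
        have : 1 / (100 * q ^ 4) = 1 / (25 * q ^ 4) * (1 / 4) := by field_simp; norm_num
        rw [this]
        refine mul_le_mul_of_nonneg_left ?_ (by positivity)
        simp only [mul_zero, Real.cos_zero, Real.exp_zero, mul_one] at c1 e0 ⊢
        have h5 : l / q / (4 * q) ≤ 1 / 12 := by
          rw [div_le_iff₀ (by positivity)]; linarith
        have h6 : 0 ≤ l / q / (4 * q) := by positivity
        have h7 : 1 / (2 * q) ≤ 1 / 12 := one_div_le_one_div_of_le (by norm_num) (by linarith)
        have h8 : 0 ≤ 1 / (2 * q) := by positivity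
        nlinarith [mul_nonneg h8 e0.le]
    _ ≤ _ := by
        refine intervalIntegral.integral_mono_on zero_le_one
          (Continuous.intervalIntegrable (by fun_prop) _ _)
          (Continuous.intervalIntegrable ?_ _ _) fun w hw => le_waveResponse_sq hq0 hl hl2 hw.1
        unfold waveResponse
        fun_prop

/-- For large frequencies the lower bound comes from the exponential kernels whose rate `l` is of
the order of the frequency, `√p < l ≤ 2√p`. -/
theorem le_timeNormSq_waveTime_one {H : ℝ} (hH : 1 / 2 < H) (hH1 : H < 1) :
    ∃ c : ℝ, 0 < c ∧ ∀ p, 36 ≤ p →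
      ENNReal.ofReal (c * (1 / (1 + p)) ^ (H + 1 / 2)) ≤ timeNormSq H (waveTime p 1) := by
  have hG := Real.Gamma_pos_of_pos (show 0 < 2 - 2 * H by linarith)
  have hα := alphaH_pos hH
  refine ⟨alphaH H * (1 / (50 * Real.Gamma (2 - 2 * H))), by positivity, fun p hp => ?_⟩
  have hp0 : 0 < p := by linarith
  have hq0 := Real.sqrt_pos.2 hp0
  have hqq := Real.sq_sqrt hp0.le
  have hq6 : 6 ≤ √p := Real.le_sqrt_of_sq_le (by linarith)
  set q := √p with hq
  rw [timeNormSq_eq_lintegral hH hH1 (isBddTime_waveTime p zero_le_one),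
    lintegral_mixMeasure H (measurable_enorm_expTransform_sq zero_le_one), mul_assoc,
    ENNReal.ofReal_mul hα.le]
  gcongr
  have hin : ∀ l ∈ Ioc q (2 * q), ENNReal.ofReal (1 / (100 * q ^ 4)) ≤
      ∫⁻ u, ‖expTransform (waveTime p 1) (l, u)‖ₑ ^ 2 := by
    intro l hl
    refine (ENNReal.ofReal_le_ofReal (le_integral_waveResponse_sq hq6 hl.1.le hl.2)).trans ?_
    rw [intervalIntegral.integral_of_le zero_le_one, ofReal_integral_eq_lintegral_ofReal]
    · refine le_trans ?_ (setLIntegral_le_lintegral (Ioc 0 1) _)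
      refine setLIntegral_mono' measurableSet_Ioc fun u hu => ?_
      rw [expTransform_waveTime hp0 zero_le_one l hu.2, max_eq_left hu.1.le, ← ofReal_norm,
        Complex.norm_real, ← ENNReal.ofReal_pow (norm_nonneg _), Real.norm_eq_abs, sq_abs]
      simp [hq]
    · refine Continuous.integrableOn_Ioc ?_
      have hl0 : 0 < l := hq0.trans hl.1
      have hD : q * (l ^ 2 + q ^ 2) ≠ 0 := by positivity
      unfold waveResponse
      fun_prop
    · exact Eventually.of_forall fun u => by positivity
  calc _ ≤ ENNReal.ofReal (2 * q ^ (2 - 2 * H) / Real.Gamma (2 - 2 * H) * (1 / (100 * q ^ 4)) *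
        q) := by
        refine ENNReal.ofReal_le_ofReal ?_
        have h1 : (1 / (1 + p)) ^ (H + 1 / 2) ≤ (1 / p) ^ (H + 1 / 2) := by
          refine Real.rpow_le_rpow (by positivity) ?_ (by linarith)
          exact one_div_le_one_div_of_le hp0 (by linarith)
        have h2 : 2 * q ^ (2 - 2 * H) / Real.Gamma (2 - 2 * H) * (1 / (100 * q ^ 4)) * q =
            1 / (50 * Real.Gamma (2 - 2 * H)) * (q ^ (2 - 2 * H - 1) / p) := by
          rw [Real.rpow_sub_one hq0.ne', ← hqq]
          field_simp
          norm_num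
        rw [h2, hq, sqrt_rpow_eq hp0]
        gcongr
    _ = ∫⁻ _ in Ioc q (2 * q),
        ENNReal.ofReal (2 * q ^ (2 - 2 * H) / Real.Gamma (2 - 2 * H) * (1 / (100 * q ^ 4))) := by
        rw [setLIntegral_const, Real.volume_Ioc, ← ENNReal.ofReal_mul (by positivity)]
        congr 2; ring
    _ ≤ ∫⁻ l in Ioc q (2 * q), ENNReal.ofReal (rateDensity H l) *
        ∫⁻ u, ‖expTransform (waveTime p 1) (l, u)‖ₑ ^ 2 := by
        refine setLIntegral_mono' measurableSet_Ioc fun l hl => ?_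
        rw [ENNReal.ofReal_mul (by positivity)]
        refine mul_le_mul' (ENNReal.ofReal_le_ofReal ?_) (hin l hl)
        unfold rateDensity
        have := hl.1.le
        gcongr
        linarith
    _ ≤ _ := lintegral_mono_set fun l hl => hq0.trans hl.1

theorem intervalEnergy_pos {H T : ℝ} (hH : 1 / 2 < H) (hH1 : H < 1) (hT : 0 < T) (hT1 : T ≤ 1) :
    0 < intervalEnergy H T := by
  refine mul_pos (alphaH_pos hH) ?_
  have hne : ∀ᵐ p : ℝ × ℝ, p.1 ≠ p.2 := by
    rw [Measure.volume_eq_prod, Measure.ae_prod_iff_ae_ae]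
    · exact Eventually.of_forall fun x => by
        have : ∀ᵐ y : ℝ, y ≠ x := by simp [ae_iff]
        filter_upwards [this] with y hy using hy.symm
    · exact (measurableSet_eq_fun measurable_fst measurable_snd).compl
  have hvol : volume (Ioc 0 T ×ˢ Ioc 0 T) = ENNReal.ofReal T * ENNReal.ofReal T := by
    rw [Measure.volume_eq_prod, Measure.prod_prod]; simp
  calc (0 : ℝ) < ∫ _ in Ioc 0 T ×ˢ Ioc 0 T, (1 : ℝ) := by
        rw [setIntegral_const, measureReal_def, hvol, ENNReal.toReal_mul,
          ENNReal.toReal_ofReal hT.le]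
        simp [hT]
    _ ≤ _ := by
        refine setIntegral_mono_ae_restrict ?_ (integrableOn_abs_sub_rpow hH T) ?_
        · refine integrableOn_const ?_
          rw [hvol]
          exact (ENNReal.mul_lt_top ENNReal.ofReal_lt_top ENNReal.ofReal_lt_top).ne
        · filter_upwards [ae_restrict_of_ae hne,
            ae_restrict_mem (measurableSet_Ioc.prod measurableSet_Ioc)] with p hp hp2
          refine Real.one_le_rpow_of_pos_of_le_one_of_nonpos (abs_pos.2 (sub_ne_zero.2 hp)) ?_
            (by linarith)
          have := hp2.1.1; have := hp2.1.2; have := hp2.2.1; have := hp2.2.2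
          rw [abs_le]; constructor <;> linarith

/-- The time norm of a nonnegative function dominates that of a smaller constant on `(0, S]`, since
the kernel is nonnegative. -/
theorem le_timeNormSq_of_le {H : ℝ} (hH : 1 / 2 < H) {T S M m : ℝ} {φ : ℝ → ℝ}
    (hφ : IsBddTime T M fun s => (φ s : ℂ)) (h0 : ∀ s, 0 < s → 0 ≤ φ s) (hm : 0 ≤ m)
    (hS : ∀ s ∈ Ioc 0 S, m ≤ φ s) :
    ENNReal.ofReal (intervalEnergy H S * m ^ 2) ≤ timeNormSq H fun s => (φ s : ℂ) := by
  have hi := integrableOn_energy hH hφ hφ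
  have hre : ∀ p : ℝ × ℝ, ((|p.1 - p.2| ^ (2 * H - 2) : ℝ) : ℂ) * φ p.1 * conj (φ p.2 : ℂ) =
      ((|p.1 - p.2| ^ (2 * H - 2) * φ p.1 * φ p.2 : ℝ) : ℂ) := by
    intro p; rw [Complex.conj_ofReal]; push_cast; ring
  rw [timeNormSq, if_pos hi]
  simp_rw [hre] at hi ⊢
  rw [integral_complex_ofReal, Complex.ofReal_re]
  refine ENNReal.ofReal_le_ofReal ?_
  rw [intervalEnergy, mul_assoc]
  refine mul_le_mul_of_nonneg_left ?_ (alphaH_pos hH).le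
  have hi' : IntegrableOn (fun p : ℝ × ℝ => |p.1 - p.2| ^ (2 * H - 2) * φ p.1 * φ p.2)
    (Ioi (0 : ℝ) ×ˢ Ioi (0 : ℝ)) := hi.re
  rw [← integral_mul_const]
  have hsub : Ioc 0 S ×ˢ Ioc 0 S ⊆ Ioi (0 : ℝ) ×ˢ Ioi (0 : ℝ) :=
    Set.prod_mono Ioc_subset_Ioi_self Ioc_subset_Ioi_self
  calc _ ≤ ∫ p in Ioc 0 S ×ˢ Ioc 0 S, |p.1 - p.2| ^ (2 * H - 2) * φ p.1 * φ p.2 := by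
        refine setIntegral_mono_on ((integrableOn_abs_sub_rpow hH S).mul_const _)
          (hi'.mono_set hsub) (measurableSet_Ioc.prod measurableSet_Ioc) fun p hp => ?_
        have h1 := hS _ hp.1
        have h2 := hS _ hp.2
        have h3 := hm.trans h1
        rw [mul_assoc, sq]
        gcongr
    _ ≤ _ := by
        refine setIntegral_mono_set hi' ?_ hsub.eventuallyLE
        filter_upwards [ae_restrict_mem (measurableSet_Ioi.prod measurableSet_Ioi)] with p hp
        have := h0 _ hp.1
        have := h0 _ hp.2
        positivity

/-- For bounded frequencies the kernel at the short time `1/6` has not yet changed sign. -/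
theorem le_timeNormSq_waveTime_sixth {H : ℝ} (hH : 1 / 2 < H) (hH1 : H < 1) :
    ∃ c : ℝ, 0 < c ∧ ∀ p, 0 ≤ p → p ≤ 36 →
      ENNReal.ofReal (c * (1 / (1 + p)) ^ (H + 1 / 2)) ≤ timeNormSq H (waveTime p (1 / 6)) := by
  have hI := intervalEnergy_pos (T := 1 / 12) hH hH1 (by norm_num) (by norm_num)
  refine ⟨intervalEnergy H (1 / 12) * (1 / 24) ^ 2, by positivity, fun p hp hp36 => ?_⟩
  have hq6 : √p ≤ 6 := Real.sqrt_le_iff.2 ⟨by norm_num, by linarith⟩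
  -- here `√p τ ≤ 1`, and `sin x ≥ x / 2` on `[0, 1]`
  have hk : ∀ τ, 0 ≤ τ → τ ≤ 1 / 6 → τ / 2 ≤ waveKernel p τ := by
    intro τ h0 h1
    unfold waveKernel
    rcases eq_or_lt_of_le (mul_nonneg (Real.sqrt_nonneg p) h0) with h | h
    · rw [← h, Real.sinc_zero]; linarith
    · rw [Real.sinc_of_ne_zero h.ne']
      have h2 : √p * τ ≤ 1 := by nlinarith [Real.sqrt_nonneg p]
      have h3 := Real.sin_gt_sub_cube h
      have h4 : 1 / 2 ≤ Real.sin (√p * τ) / (√p * τ) := by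
        rw [le_div_iff₀ h]
        nlinarith [mul_nonneg h.le (sub_nonneg.2 h2), mul_nonneg (mul_nonneg h.le h.le)
          (sub_nonneg.2 h2)]
      calc τ / 2 = τ * (1 / 2) := by ring
        _ ≤ _ := by gcongr
  have heq : waveTime p (1 / 6) = fun s =>
      (((Icc (0 : ℝ) (1 / 6)).indicator (fun s => waveKernel p (1 / 6 - s)) s : ℝ) : ℂ) := by
    ext s
    unfold waveTime
    by_cases hs : s ∈ Icc (0 : ℝ) (1 / 6)
    · rw [indicator_of_mem hs, indicator_of_mem hs]
    · rw [indicator_of_notMem hs, indicator_of_notMem hs]; simp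
  have hbd := isBddTime_waveTime p (show (0 : ℝ) ≤ 1 / 6 by norm_num)
  rw [heq] at hbd ⊢
  refine le_trans (ENNReal.ofReal_le_ofReal ?_) (le_timeNormSq_of_le (S := 1 / 12) (m := 1 / 24) hH
    hbd ?_ (by norm_num) ?_)
  · refine mul_le_of_le_one_right (by positivity)
      (Real.rpow_le_one (by positivity) ?_ (by linarith))
    rw [div_le_one (by positivity)]; linarith
  · intro s hs
    refine indicator_nonneg (fun r hr => ?_) s
    have := hk (1 / 6 - r) (by linarith [hr.2]) (by linarith [hr.1])
    linarith [hr.2]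
  · intro s hs
    rw [indicator_of_mem (show s ∈ Icc (0 : ℝ) (1 / 6) from ⟨hs.1.le, by linarith [hs.2]⟩)]
    have := hk (1 / 6 - s) (by linarith [hs.2]) (by linarith [hs.1])
    linarith [hs.2]

/-! ### Characteristic exponents -/

theorem exp_neg_charExponent {d : ℕ} {Ω : Type*} [MeasurableSpace Ω] {P : Measure Ω}
    {X : ℝ≥0 → Ω → Space d} {Ψ : Space d → ℂ} (hΨ : IsCharExponent P X Ψ)
    (hsymm : ∀ ξ, (Ψ ξ).im = 0) (ξ : Space d) :
    ((Real.exp (-(Ψ ξ).re) : ℝ) : ℂ) =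
      ∫ ω, Complex.exp (-Complex.I * ((inner ℝ ξ (X 1 ω) : ℝ) : ℂ)) ∂P := by
  have h : Ψ ξ = ((Ψ ξ).re : ℂ) := Complex.ext (by simp) (by simp [hsymm ξ])
  rw [hΨ 1 ξ, h]
  simp

theorem norm_exp_neg_I_mul (x : ℝ) : ‖Complex.exp (-Complex.I * (x : ℂ))‖ = 1 := by
  have : -Complex.I * (x : ℂ) = ((-x : ℝ) : ℂ) * Complex.I := by push_cast; ring
  rw [this, Complex.norm_exp_ofReal_mul_I]

theorem charExponent_re_nonneg {d : ℕ} {Ω : Type*} [MeasurableSpace Ω] {P : Measure Ω}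
    [IsProbabilityMeasure P] {X : ℝ≥0 → Ω → Space d} {Ψ : Space d → ℂ}
    (hΨ : IsCharExponent P X Ψ) (hsymm : ∀ ξ, (Ψ ξ).im = 0) (ξ : Space d) : 0 ≤ (Ψ ξ).re := by
  have h : ‖((Real.exp (-(Ψ ξ).re) : ℝ) : ℂ)‖ ≤ 1 := by
    rw [exp_neg_charExponent hΨ hsymm]
    refine (norm_integral_le_integral_norm _).trans ?_
    simp_rw [norm_exp_neg_I_mul]
    simp
  rw [Complex.norm_real, Real.norm_eq_abs, Real.abs_exp, Real.exp_le_one_iff] at h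
  linarith

/-- As `Ψ` is real, it is recovered as `-log` of the characteristic function at time `1`, without a
choice of branch. -/
theorem continuous_charExponent_re {d : ℕ} {Ω : Type*} [MeasurableSpace Ω] {P : Measure Ω}
    [IsProbabilityMeasure P] {X : ℝ≥0 → Ω → Space d} (hX : Measurable (X 1)) {Ψ : Space d → ℂ}
    (hΨ : IsCharExponent P X Ψ) (hsymm : ∀ ξ, (Ψ ξ).im = 0) :
    Continuous fun ξ => (Ψ ξ).re := by
  have h1 : Continuous fun ξ => ∫ ω,
      Complex.exp (-Complex.I * ((inner ℝ ξ (X 1 ω) : ℝ) : ℂ)) ∂P := by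
    refine continuous_of_dominated (bound := fun _ => 1) (fun ξ => ?_) (fun ξ => ?_)
      (integrable_const _) ?_
    · have : Measurable fun ω => (inner ℝ ξ (X 1 ω) : ℝ) := by fun_prop
      exact Measurable.aestronglyMeasurable (by fun_prop)
    · exact Eventually.of_forall fun ω => (norm_exp_neg_I_mul _).le
    · exact Eventually.of_forall fun ω => by fun_prop
  have h2 : Continuous fun ξ => Real.exp (-(Ψ ξ).re) := by
    simp_rw [← exp_neg_charExponent hΨ hsymm] at h1
    have h := Complex.continuous_re.comp h1
    simp only [Function.comp_def, Complex.ofReal_re] at h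
    exact h
  have h3 : (fun ξ => (Ψ ξ).re) = fun ξ => -Real.log (Real.exp (-(Ψ ξ).re)) := by
    ext ξ; simp
  rw [h3]
  exact (h2.log fun ξ => (Real.exp_pos _).ne').neg

/-! ### The Fourier transform on the Schwartz space -/

theorem fourierS_eq_fourier {d : ℕ} (φ : 𝓢(Space d, ℂ)) (ξ : Space d) :
    fourierS φ ξ = 𝓕 φ ((2 * Real.pi)⁻¹ • ξ) := rfl

theorem fourierS_add {d : ℕ} (φ ψ : 𝓢(Space d, ℂ)) :
    fourierS (φ + ψ) = fourierS φ + fourierS ψ := by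
  simp [fourierS, FourierTransform.fourier_add]

theorem fourierS_smul {d : ℕ} (c : ℂ) (φ : 𝓢(Space d, ℂ)) :
    fourierS (c • φ) = c • fourierS φ := by
  simp [fourierS, FourierTransform.fourier_smul]

theorem fourierS_sub {d : ℕ} (φ ψ : 𝓢(Space d, ℂ)) :
    fourierS (φ - ψ) = fourierS φ - fourierS ψ := by
  rw [sub_eq_add_neg, sub_eq_add_neg, fourierS_add, ← neg_one_smul ℂ ψ, fourierS_smul,
    neg_one_smul]

theorem fourierS_surjective {d : ℕ} (χ : 𝓢(Space d, ℂ)) : ∃ φ, fourierS φ = χ := by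
  refine ⟨𝓕⁻ (SchwartzMap.compCLMOfContinuousLinearEquiv ℂ (dilation d).symm χ), ?_⟩
  ext ξ
  rw [fourierS, FourierTransform.fourier_fourierInv_eq]
  simp

/-- The complex conjugate of a Schwartz function. -/
def conjS {d : ℕ} (φ : 𝓢(Space d, ℂ)) : 𝓢(Space d, ℂ) :=
  SchwartzMap.postcompCLM (𝕜 := ℝ) (Complex.conjCLE : ℂ →L[ℝ] ℂ) φ

/-- The reflection `x ↦ φ(-x)` of a Schwartz function. -/
def reflS {d : ℕ} (φ : 𝓢(Space d, ℂ)) : 𝓢(Space d, ℂ) :=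
  SchwartzMap.compCLMOfContinuousLinearEquiv ℂ (ContinuousLinearEquiv.neg ℝ) φ

@[simp] theorem conjS_apply {d : ℕ} (φ : 𝓢(Space d, ℂ)) (x : Space d) :
    conjS φ x = conj (φ x) := rfl

@[simp] theorem reflS_apply {d : ℕ} (φ : 𝓢(Space d, ℂ)) (x : Space d) :
    reflS φ x = φ (-x) := rfl

theorem fourierS_conjS_apply {d : ℕ} (φ : 𝓢(Space d, ℂ)) (ξ : Space d) :
    fourierS (conjS φ) ξ = conj (fourierS φ (-ξ)) := by
  rw [fourierS_apply, fourierS_apply, ← integral_conj]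
  congr 1; ext x
  simp [← Complex.exp_conj]

theorem fourierS_reflS_apply {d : ℕ} (φ : 𝓢(Space d, ℂ)) (ξ : Space d) :
    fourierS (reflS φ) ξ = fourierS φ (-ξ) := by
  rw [fourierS_apply, fourierS_apply, ← integral_neg_eq_self]
  congr 1; ext x
  simp

theorem fourierS_translate_apply {d : ℕ} (φ : 𝓢(Space d, ℂ)) (y ξ : Space d) :
    fourierS (SchwartzMap.compSubConstCLM ℂ y φ) ξ =
      Complex.exp (-Complex.I * ((inner ℝ ξ y : ℝ) : ℂ)) * fourierS φ ξ := by
  rw [fourierS_apply, fourierS_apply, ← integral_const_mul, ← integral_add_right_eq_self _ y]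
  congr 1; ext x
  simp only [SchwartzMap.compSubConstCLM_apply, add_sub_cancel_right]
  rw [← mul_assoc, ← Complex.exp_add, inner_add_right]
  congr 2; push_cast; ring

theorem fourierS_fourierS_apply {d : ℕ} (φ : 𝓢(Space d, ℂ)) (ξ : Space d) :
    fourierS (fourierS φ) ξ = ((2 * Real.pi) ^ d : ℝ) * φ (-ξ) := by
  have hpi : (2 * Real.pi) ≠ 0 := by positivity
  have h1 : φ (-ξ) = ∫ v, Complex.exp (-Complex.I * ((inner ℝ ξ ((2 * Real.pi) • v) : ℝ) : ℂ)) *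
      𝓕 φ v := by
    conv_lhs => rw [← FourierTransform.fourierInv_fourier_eq (F := 𝓢(Space d, ℂ)) φ]
    rw [SchwartzMap.fourierInv_coe, Real.fourierInv_eq']
    congr 1; ext v
    rw [smul_eq_mul, inner_neg_right, inner_smul_right, real_inner_comm]
    congr 2; push_cast; ring
  have h2 := Measure.integral_comp_smul (μ := (volume : Measure (Space d)))
    (fun v => Complex.exp (-Complex.I * ((inner ℝ ξ ((2 * Real.pi) • v) : ℝ) : ℂ)) * 𝓕 φ v)
    ((2 * Real.pi)⁻¹)
  rw [← h1] at h2
  rw [fourierS_apply]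
  simp_rw [smul_smul, mul_inv_cancel₀ hpi, one_smul] at h2
  simp_rw [fourierS_eq_fourier]
  rw [h2, finrank_euclideanSpace_fin, inv_pow, inv_inv, abs_of_pos (by positivity),
    Complex.real_smul]

/-! ### The spectral measure -/

section Spectral

variable {d : ℕ} {f : Space d → ℝ≥0∞} {μ : Measure (Space d)}

theorem isFiniteMeasureOnCompacts_of_hasTemperateGrowth (hμ : μ.HasTemperateGrowth) :
    IsFiniteMeasureOnCompacts μ := by
  obtain ⟨n, hn⟩ := hμ.exists_integrable
  refine ⟨fun K hK => ?_⟩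
  obtain ⟨R, hR⟩ := hK.isBounded.exists_norm_le
  have ha : ∀ r : ℝ, 0 ≤ r → ‖(1 + r) ^ (-(n : ℝ))‖ = (1 + r) ^ (-(n : ℝ)) := fun r hr =>
    Real.norm_of_nonneg (by positivity)
  have hsub : K ⊆ {x | ‖(1 + |R|) ^ (-(n : ℝ))‖ₑ ≤ ‖(1 + ‖x‖) ^ (-(n : ℝ))‖ₑ} := by
    intro x hx
    rw [mem_ofPred_eq, ← ofReal_norm, ← ofReal_norm, ha _ (abs_nonneg R), ha _ (norm_nonneg x)]
    refine ENNReal.ofReal_le_ofReal ?_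
    refine Real.rpow_le_rpow_of_nonpos (by positivity) ?_ (by simp)
    linarith [hR x hx, le_abs_self R]
  refine (measure_mono hsub).trans_lt ?_
  refine (meas_ge_le_lintegral_div hn.aestronglyMeasurable.enorm ?_ (by simp)).trans_lt ?_
  · simp only [ne_eq, enorm_eq_zero]
    exact (Real.rpow_pos_of_pos (by positivity) _).ne'
  · refine ENNReal.div_lt_top hn.hasFiniteIntegral.ne ?_
    simp only [ne_eq, enorm_eq_zero]
    exact (Real.rpow_pos_of_pos (by positivity) _).ne'

/-- `μ` is symmetric on Schwartz functions, because `f` is real. -/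
theorem IsSpectralPair.integral_reflS (h : IsSpectralPair f μ) (χ : 𝓢(Space d, ℂ)) :
    ∫ ξ, χ (-ξ) ∂μ = ∫ ξ, χ ξ ∂μ := by
  obtain ⟨φ, rfl⟩ := fourierS_surjective χ
  have h1 := h.fourier φ
  have h2 := h.fourier (conjS φ)
  simp_rw [fourierS_conjS_apply] at h2
  rw [integral_conj] at h2
  have h3 : ∫ x, ((f x).toReal : ℂ) * conjS φ x = conj (∫ x, ((f x).toReal : ℂ) * φ x) := by
    rw [← integral_conj]; simp
  rw [h3, h1] at h2
  exact ((starRingEnd ℂ).injective h2).symm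

/-- `f` is uniformly locally integrable: `f` integrated against a translated bump function is an
integral of a Schwartz function against `μ`, and a translation only changes the phase of the
Fourier transform. -/
theorem IsSpectralPair.exists_lintegral_ball_le (h : IsSpectralPair f μ) :
    ∃ C : ℝ≥0∞, C ≠ ∞ ∧ ∀ y : Space d,
      ∫⁻ x in Metric.ball y 1, ENNReal.ofReal (f x).toReal ≤ C := by
  have := h.tempered
  let b : ContDiffBump (0 : Space d) := ⟨1, 2, one_pos, one_lt_two⟩
  let χ : 𝓢(Space d, ℂ) :=
    SchwartzMap.postcompCLM (𝕜 := ℝ) Complex.ofRealCLM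
      (b.hasCompactSupport.toSchwartzMap b.contDiff)
  have hχ : ∀ x, χ x = (b x : ℂ) := fun x => rfl
  refine ⟨ENNReal.ofReal (∫ ξ, ‖fourierS χ ξ‖ ∂μ), ENNReal.ofReal_ne_top, fun y => ?_⟩
  have hi := h.integrable (SchwartzMap.compSubConstCLM ℂ y χ)
  have he : ∀ x, ((f x).toReal : ℂ) * SchwartzMap.compSubConstCLM ℂ y χ x =
      (((f x).toReal * b (x - y) : ℝ) : ℂ) := fun x => by
    rw [SchwartzMap.compSubConstCLM_apply, hχ]; push_cast; rfl
  have hF := h.fourier (SchwartzMap.compSubConstCLM ℂ y χ)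
  simp_rw [he] at hi hF
  have hi' : Integrable fun x => (f x).toReal * b (x - y) := hi.re
  have hb0 : ∀ x, 0 ≤ (f x).toReal * b (x - y) := fun x =>
    mul_nonneg ENNReal.toReal_nonneg b.nonneg
  calc _ ≤ ∫⁻ x in Metric.ball y 1, ENNReal.ofReal ((f x).toReal * b (x - y)) := by
        refine setLIntegral_mono' measurableSet_ball fun x hx => ENNReal.ofReal_le_ofReal ?_
        have : b (x - y) = 1 := b.one_of_mem_closedBall (by
          rw [mem_closedBall_zero_iff, ← dist_eq_norm]; exact (Metric.mem_ball.1 hx).le)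
        rw [this, mul_one]
    _ ≤ ∫⁻ x, ENNReal.ofReal ((f x).toReal * b (x - y)) := setLIntegral_le_lintegral _ _
    _ = ENNReal.ofReal (∫ x, (f x).toReal * b (x - y)) :=
        (ofReal_integral_eq_lintegral_ofReal hi' (Eventually.of_forall hb0)).symm
    _ ≤ _ := by
        refine ENNReal.ofReal_le_ofReal ?_
        rw [integral_complex_ofReal] at hF
        calc _ = ‖((∫ x, (f x).toReal * b (x - y) : ℝ) : ℂ)‖ := by
              rw [Complex.norm_real, Real.norm_eq_abs, abs_of_nonneg (integral_nonneg hb0)]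
          _ ≤ ∫ ξ, ‖fourierS (SchwartzMap.compSubConstCLM ℂ y χ) ξ‖ ∂μ := by
              rw [hF]; exact norm_integral_le_integral_norm _
          _ = _ := by simp_rw [fourierS_translate_apply, norm_mul, norm_exp_neg_I_mul, one_mul]

/-- The weight `(1 + ‖x‖)^{-(d+1)}`. -/
def weight (x : Space d) : ℝ≥0∞ := ENNReal.ofReal ((1 + ‖x‖) ^ (-(d + 1 : ℝ)))

theorem measurable_weight : Measurable (weight (d := d)) := by
  unfold weight
  have h : Continuous fun x : Space d => (1 + ‖x‖) ^ (-(d + 1 : ℝ)) :=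
    Continuous.rpow_const (by fun_prop) fun x => Or.inl (by positivity)
  exact h.measurable.ennreal_ofReal

theorem lintegral_weight_ne_top : ∫⁻ x : Space d, weight x ≠ ∞ := by
  have h : Integrable fun x : Space d => (1 + ‖x‖) ^ (-(d + 1 : ℝ)) :=
    integrable_one_add_norm (by simp)
  exact ((hasFiniteIntegral_iff_ofReal (Eventually.of_forall fun x => by positivity)).1
    h.hasFiniteIntegral).ne

/-- The weight is dominated by a superposition of indicators of unit balls, with integrable
density. -/
theorem weight_le (x : Space d) : weight x ≤ ENNReal.ofReal (2 ^ (d + 1 : ℝ)) *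
    (volume (Metric.ball (0 : Space d) 1))⁻¹ *
      ∫⁻ u, weight u * (Metric.ball u 1).indicator 1 x := by
  have hv : volume (Metric.ball x 1) = volume (Metric.ball (0 : Space d) 1) := by
    rw [Measure.addHaar_ball_center]
  have hv0 : volume (Metric.ball (0 : Space d) 1) ≠ 0 :=
    (Metric.measure_ball_pos _ _ one_pos).ne'
  have hvt : volume (Metric.ball (0 : Space d) 1) ≠ ∞ := measure_ball_lt_top.ne
  have h2 : ENNReal.ofReal (2 ^ (-(d + 1 : ℝ))) * weight x * volume (Metric.ball (0 : Space d) 1) ≤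
      ∫⁻ u, weight u * (Metric.ball u 1).indicator 1 x := by
    rw [← hv, ← setLIntegral_const]
    calc _ ≤ ∫⁻ u in Metric.ball x 1, weight u * (Metric.ball u 1).indicator 1 x := by
          refine setLIntegral_mono' measurableSet_ball fun u hu => ?_
          rw [indicator_of_mem (Metric.mem_ball_comm.1 hu)]
          simp only [Pi.one_apply, mul_one, weight]
          rw [← ENNReal.ofReal_mul (by positivity), ← Real.mul_rpow (by norm_num) (by positivity)]
          refine ENNReal.ofReal_le_ofReal
            (Real.rpow_le_rpow_of_nonpos (by positivity) ?_ (by linarith [d.cast_nonneg (α := ℝ)]))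
          have h3 : ‖u‖ ≤ ‖x‖ + 1 := by
            have := norm_le_norm_add_norm_sub' u x
            rw [Metric.mem_ball, dist_eq_norm] at hu
            linarith
          linarith [norm_nonneg x]
      _ ≤ _ := setLIntegral_le_lintegral _ _
  calc weight x = ENNReal.ofReal (2 ^ (d + 1 : ℝ)) * (volume (Metric.ball (0 : Space d) 1))⁻¹ *
        (ENNReal.ofReal (2 ^ (-(d + 1 : ℝ))) * weight x *
          volume (Metric.ball (0 : Space d) 1)) := by
        have h4 : ENNReal.ofReal (2 ^ (d + 1 : ℝ)) * ENNReal.ofReal (2 ^ (-(d + 1 : ℝ))) = 1 := by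
          rw [← ENNReal.ofReal_mul (by positivity), ← Real.rpow_add two_pos]; simp
        calc weight x = 1 * 1 * weight x := by simp
          _ = (ENNReal.ofReal (2 ^ (d + 1 : ℝ)) * ENNReal.ofReal (2 ^ (-(d + 1 : ℝ)))) *
              ((volume (Metric.ball (0 : Space d) 1))⁻¹ * volume (Metric.ball (0 : Space d) 1)) *
                weight x := by rw [h4, ENNReal.inv_mul_cancel hv0 hvt]
          _ = _ := by ring
    _ ≤ _ := by gcongr

/-- The translates of `f` are uniformly integrable against the weight, which is a superposition of
unit balls. -/
theorem IsSpectralPair.exists_lintegral_weight_le (h : IsSpectralPair f μ) :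
    ∃ C : ℝ≥0∞, C ≠ ∞ ∧ ∀ y : Space d,
      ∫⁻ x, ENNReal.ofReal (f (x - y)).toReal * weight x ≤ C := by
  obtain ⟨C, hC, hball⟩ := h.exists_lintegral_ball_le
  set K : ℝ≥0∞ := ENNReal.ofReal (2 ^ (d + 1 : ℝ)) *
    (volume (Metric.ball (0 : Space d) 1))⁻¹ with hK
  have hKt : K ≠ ∞ := ENNReal.mul_ne_top ENNReal.ofReal_ne_top
    (ENNReal.inv_ne_top.2 (Metric.measure_ball_pos _ _ one_pos).ne')
  have hfm : Measurable fun x => ENNReal.ofReal (f x).toReal :=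
    h.measurable.ennreal_toReal.ennreal_ofReal
  refine ⟨K * (C * ∫⁻ u : Space d, weight u), ENNReal.mul_ne_top hKt
    (ENNReal.mul_ne_top hC lintegral_weight_ne_top), fun y => ?_⟩
  have hind : Measurable fun q : Space d × Space d =>
      (Metric.ball q.2 1).indicator (1 : Space d → ℝ≥0∞) q.1 := by
    have : (fun q : Space d × Space d => (Metric.ball q.2 1).indicator (1 : Space d → ℝ≥0∞) q.1) =
        {q : Space d × Space d | dist q.1 q.2 < 1}.indicator 1 := by
      ext q; simp [indicator, Metric.mem_ball]
    rw [this]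
    exact measurable_const.indicator (measurableSet_lt (by fun_prop) (by fun_prop))
  have hfy : Measurable fun x => ENNReal.ofReal (f (x - y)).toReal :=
    hfm.comp (measurable_id.sub_const y)
  have hw := measurable_weight (d := d)
  calc _ ≤ ∫⁻ x, ENNReal.ofReal (f (x - y)).toReal *
        (K * ∫⁻ u, weight u * (Metric.ball u 1).indicator 1 x) :=
        lintegral_mono fun x => mul_le_mul' le_rfl (weight_le x)
    _ = K * ∫⁻ x, ∫⁻ u, ENNReal.ofReal (f (x - y)).toReal *
        (weight u * (Metric.ball u 1).indicator 1 x) := by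
        rw [← lintegral_const_mul' _ _ hKt]
        congr 1; ext x
        rw [lintegral_const_mul' _ _ ENNReal.ofReal_ne_top]
        ring
    _ = K * ∫⁻ u, ∫⁻ x, ENNReal.ofReal (f (x - y)).toReal *
        (weight u * (Metric.ball u 1).indicator 1 x) := by
        rw [lintegral_lintegral_swap]
        exact (Measurable.mul (hfy.comp measurable_fst)
          (Measurable.mul (by fun_prop) hind)).aemeasurable
    _ ≤ K * ∫⁻ u : Space d, weight u * C := by
        refine mul_le_mul' le_rfl (lintegral_mono fun u => ?_)
        calc _ = weight u * ∫⁻ x in Metric.ball u 1, ENNReal.ofReal (f (x - y)).toReal := by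
              rw [← lintegral_indicator measurableSet_ball,
                ← lintegral_const_mul' _ _ (by unfold weight; exact ENNReal.ofReal_ne_top)]
              congr 1; ext x
              by_cases hx : x ∈ Metric.ball u 1
              · simp only [indicator_of_mem hx, Pi.one_apply, mul_one]; ring
              · simp only [indicator_of_notMem hx, mul_zero]
          _ ≤ _ := by
              refine mul_le_mul' le_rfl (le_trans (le_of_eq ?_) (hball (u - y)))
              rw [← lintegral_indicator measurableSet_ball,
                ← lintegral_indicator measurableSet_ball, ← lintegral_sub_right_eq_self
                  ((Metric.ball (u - y) 1).indicator fun x => ENNReal.ofReal (f x).toReal) y]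
              congr 1; ext x
              have : x ∈ Metric.ball u 1 ↔ x - y ∈ Metric.ball (u - y) 1 := by
                simp [Metric.mem_ball]
              by_cases hx : x ∈ Metric.ball u 1
              · rw [indicator_of_mem hx, indicator_of_mem (this.1 hx)]
              · rw [indicator_of_notMem hx, indicator_of_notMem (fun h => hx (this.2 h))]
    _ = _ := by rw [lintegral_mul_const _ hw]; ring

theorem exists_enorm_le_weight (φ : 𝓢(Space d, ℂ)) :
    ∃ C : ℝ≥0∞, C ≠ ∞ ∧ ∀ x, ‖φ x‖ₑ ≤ C * weight x := by
  have h := fun x => SchwartzMap.one_add_le_sup_seminorm_apply (𝕜 := ℝ) (m := (d + 1, 0))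
    (k := d + 1) (n := 0) le_rfl le_rfl φ x
  set M := 2 ^ (d + 1, 0).1 * (((Finset.Iic (d + 1, 0)).sup fun m =>
    SchwartzMap.seminorm ℝ m.1 m.2) φ) with hM
  refine ⟨ENNReal.ofReal M, ENNReal.ofReal_ne_top, fun x => ?_⟩
  have hx := h x
  rw [norm_iteratedFDeriv_zero] at hx
  have hM0 : 0 ≤ M := le_trans (by positivity) hx
  rw [weight, ← ENNReal.ofReal_mul hM0, ← ofReal_norm]
  refine ENNReal.ofReal_le_ofReal ?_
  have h1 : (1 + ‖x‖) ^ (-(d + 1 : ℝ)) = ((1 + ‖x‖) ^ (d + 1))⁻¹ := by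
    rw [Real.rpow_neg (by positivity), ← Real.rpow_natCast]; push_cast; rfl
  rw [h1, ← div_eq_mul_inv, le_div_iff₀ (by positivity), mul_comm]
  exact hx

theorem IsSpectralPair.integrable_prod (h : IsSpectralPair f μ) (φ ψ : 𝓢(Space d, ℂ)) :
    Integrable (fun p : Space d × Space d => ((f (p.1 - p.2)).toReal : ℂ) * φ p.1 * conj (ψ p.2))
      (volume.prod volume) := by
  obtain ⟨C, hC, hle⟩ := h.exists_lintegral_weight_le
  obtain ⟨D, hD, hφ⟩ := exists_enorm_le_weight φ
  have hm : Measurable fun p : Space d × Space d =>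
      ((f (p.1 - p.2)).toReal : ℂ) * φ p.1 * conj (ψ p.2) := by
    have h1 : Measurable fun p : Space d × Space d => (f (p.1 - p.2)).toReal :=
      h.measurable.ennreal_toReal.comp (by fun_prop)
    have h2 : Continuous fun p : Space d × Space d => φ p.1 * conj (ψ p.2) :=
      (φ.continuous.comp continuous_fst).mul
        (Complex.continuous_conj.comp (ψ.continuous.comp continuous_snd))
    simp_rw [mul_assoc]
    exact (Complex.measurable_ofReal.comp h1).mul h2.measurable
  refine ⟨hm.aestronglyMeasurable, ?_⟩
  rw [HasFiniteIntegral, lintegral_prod_symm _ hm.enorm.aemeasurable]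
  calc _ ≤ ∫⁻ y, D * C * ‖ψ y‖ₑ := by
        refine lintegral_mono fun y => ?_
        calc _ ≤ ∫⁻ x, D * ‖ψ y‖ₑ * (ENNReal.ofReal (f (x - y)).toReal * weight x) := by
              refine lintegral_mono fun x => ?_
              simp only [enorm_mul, RCLike.enorm_conj]
              rw [← ofReal_norm ((f (x - y)).toReal : ℂ), Complex.norm_real, Real.norm_eq_abs,
                abs_of_nonneg ENNReal.toReal_nonneg]
              calc _ ≤ ENNReal.ofReal (f (x - y)).toReal * (D * weight x) * ‖ψ y‖ₑ := by
                    gcongr; exact hφ x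
                _ = _ := by ring
          _ ≤ _ := by
              rw [lintegral_const_mul' _ _ (ENNReal.mul_ne_top hD enorm_ne_top)]
              calc _ ≤ D * ‖ψ y‖ₑ * C := by gcongr; exact hle y
                _ = _ := by ring
    _ < ∞ := by
        rw [lintegral_const_mul' _ _ (ENNReal.mul_ne_top hD hC)]
        exact ENNReal.mul_lt_top (ENNReal.mul_lt_top hD.lt_top hC.lt_top)
          ψ.integrable.hasFiniteIntegral

/-- The spectral inner product `∫ Fφ conj(Fψ) dμ`. -/
def specInner (μ : Measure (Space d)) (φ ψ : 𝓢(Space d, ℂ)) : ℂ :=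
  ∫ ξ, fourierS φ ξ * conj (fourierS ψ ξ) ∂μ

/-- The spatial covariance in spectral form; `f` is integrated against the Schwartz function
`z ↦ ∫ φ(z + y) conj(ψ(y)) dy`, whose Fourier transform is `Fφ conj(Fψ)`. -/
theorem IsSpectralPair.integral_integral_eq (h : IsSpectralPair f μ) (φ ψ : 𝓢(Space d, ℂ)) :
    ∫ x, ∫ y, ((f (x - y)).toReal : ℂ) * φ x * conj (ψ y) = specInner μ φ ψ := by
  have hi := h.integrable_prod φ ψ
  have hmp := measurePreserving_add_prod (volume : Measure (Space d)) (volume : Measure (Space d))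
  have hi2 := (hmp.integrable_comp hi.aestronglyMeasurable).2 hi
  set Θ : 𝓢(Space d, ℂ) :=
    SchwartzMap.convolution (ContinuousLinearMap.mul ℂ ℂ) (reflS (conjS ψ)) φ with hΘ
  have hΘ1 : ∀ z, Θ z = ∫ y, φ (z + y) * conj (ψ y) := by
    intro z
    rw [hΘ, SchwartzMap.convolution_apply, convolution_def, ← integral_neg_eq_self]
    congr 1; ext y
    simp [mul_comm]
  have hΘ2 : ∀ ξ, fourierS Θ ξ = fourierS φ ξ * conj (fourierS ψ ξ) := by
    intro ξ
    have : fourierS Θ ξ = fourierS (reflS (conjS ψ)) ξ * fourierS φ ξ := by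
      rw [fourierS_eq_fourier, hΘ, SchwartzMap.fourier_convolution]; rfl
    rw [this, fourierS_reflS_apply, fourierS_conjS_apply, neg_neg, mul_comm]
  have h1 : ∫ p, ((f (p.1 - p.2)).toReal : ℂ) * φ p.1 * conj (ψ p.2) ∂(volume.prod volume) =
      ∫ p : Space d × Space d, ((f p.1).toReal : ℂ) * (φ (p.1 + p.2) * conj (ψ p.2))
        ∂(volume.prod volume) := by
    conv_lhs => rw [← hmp.map_eq]
    rw [integral_map hmp.measurable.aemeasurable
      (by rw [hmp.map_eq]; exact hi.aestronglyMeasurable)]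
    simp_rw [add_sub_cancel_right, mul_assoc]
  have hi3 : Integrable (fun p : Space d × Space d =>
      ((f p.1).toReal : ℂ) * (φ (p.1 + p.2) * conj (ψ p.2))) (volume.prod volume) := by
    refine hi2.congr (Eventually.of_forall fun p => ?_)
    simp only [Function.comp, add_sub_cancel_right, mul_assoc]
  rw [← integral_prod _ hi, h1, integral_prod _ hi3]
  simp_rw [integral_const_mul, ← hΘ1, specInner, ← hΘ2]
  exact h.fourier Θ

end Spectral

/-! ### The isometry on elementary functions -/

/-- The indicator `1_{[0,a]}`. -/
def stepFn (a : ℝ) : ℝ → ℝ := (Icc (0 : ℝ) a).indicator 1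

/-- The time covariance `α_H ∫_0^a ∫_0^b |r - s|^{2H-2} dr ds`. -/
def timeCov (H a b : ℝ) : ℝ :=
  alphaH H * ∫ p in Ioi (0 : ℝ) ×ˢ Ioi (0 : ℝ),
    |p.1 - p.2| ^ (2 * H - 2) * stepFn a p.1 * stepFn b p.2

theorem isBddTime_stepFn (a : ℝ) : IsBddTime a 1 fun s => (stepFn a s : ℂ) where
  measurable := Complex.measurable_ofReal.comp (measurable_one.indicator measurableSet_Icc)
  bound s _ := by
    unfold stepFn
    by_cases h : s ∈ Icc 0 a <;> simp [h]
  supp s hs := by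
    unfold stepFn
    rw [indicator_of_notMem (fun h => (not_le.2 hs) h.2)]; simp

theorem integrableOn_kernel_stepFn {H : ℝ} (hH : 1 / 2 < H) (a b : ℝ) :
    IntegrableOn (fun p : ℝ × ℝ => |p.1 - p.2| ^ (2 * H - 2) * stepFn a p.1 * stepFn b p.2)
      (Ioi (0 : ℝ) ×ˢ Ioi (0 : ℝ)) := by
  have h := integrableOn_energy hH ((isBddTime_stepFn a).mono (le_max_left a b) le_rfl)
    ((isBddTime_stepFn b).mono (le_max_right a b) le_rfl)
  have h2 := h.re
  refine h2.congr (Eventually.of_forall fun p => ?_)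
  simp only [Complex.conj_ofReal, RCLike.re_to_complex, ← Complex.ofReal_mul, Complex.ofReal_re]

theorem Elem.eval_eq_sum {d : ℕ} {𝕜 : Type} [NormedRing 𝕜] [NormedAlgebra ℝ 𝕜] (h : Elem d 𝕜)
    {S : Finset {a : ℝ // 0 < a}} (hS : h.support ⊆ S) (t : ℝ) (x : Space d) :
    h.eval t x = ∑ a ∈ S, stepFn a t • h a x := by
  rw [Elem.eval, Finsupp.sum_of_support_subset _ hS _ (by simp)]
  refine Finset.sum_congr rfl fun a _ => ?_
  unfold stepFn
  by_cases ht : t ∈ Icc (0 : ℝ) a <;> simp [ht]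

theorem integral_integral_finsetSum {α β ι : Type*} [MeasurableSpace α] [MeasurableSpace β]
    {μ : Measure α} {ν : Measure β} [SFinite μ] [SFinite ν] (S : Finset ι) {F : ι → α → β → ℝ}
    (hF : ∀ i ∈ S, Integrable (fun p : α × β => F i p.1 p.2) (μ.prod ν)) :
    ∫ x, ∫ y, ∑ i ∈ S, F i x y ∂ν ∂μ = ∑ i ∈ S, ∫ x, ∫ y, F i x y ∂ν ∂μ := by
  have h1 : Integrable (fun p : α × β => ∑ i ∈ S, F i p.1 p.2) (μ.prod ν) :=
    integrable_finsetSum S hF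
  rw [← integral_prod _ h1, integral_finsetSum S hF]
  exact Finset.sum_congr rfl fun i hi => integral_prod _ (hF i hi)

/-- A real Schwartz function as a complex one. -/
def toComplexS {d : ℕ} (φ : 𝓢(Space d, ℝ)) : 𝓢(Space d, ℂ) :=
  SchwartzMap.postcompCLM (𝕜 := ℝ) Complex.ofRealCLM φ

theorem toComplexS_apply {d : ℕ} (φ : 𝓢(Space d, ℝ)) (x : Space d) :
    toComplexS φ x = (φ x : ℂ) := rfl

theorem toComplexS_sub {d : ℕ} (φ ψ : 𝓢(Space d, ℝ)) :
    toComplexS (φ - ψ) = toComplexS φ - toComplexS ψ := by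
  simp [toComplexS]

section Covariance

variable {d : ℕ} {f : Space d → ℝ≥0∞} {μ : Measure (Space d)}

theorem specInner_integrable (hμ : μ.HasTemperateGrowth) (φ ψ : 𝓢(Space d, ℂ)) :
    Integrable (fun ξ => φ ξ * conj (ψ ξ)) μ :=
  (SchwartzMap.pairing (ContinuousLinearMap.mul ℂ ℂ) φ (conjS ψ)).integrable

theorem specInner_add_left (hμ : μ.HasTemperateGrowth) (φ φ' ψ : 𝓢(Space d, ℂ)) :
    specInner μ (φ + φ') ψ = specInner μ φ ψ + specInner μ φ' ψ := by
  unfold specInner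
  rw [← integral_add (specInner_integrable hμ _ _) (specInner_integrable hμ _ _)]
  congr 1; ext ξ
  rw [fourierS_add, add_apply]; ring

theorem specInner_add_right (hμ : μ.HasTemperateGrowth) (φ ψ ψ' : 𝓢(Space d, ℂ)) :
    specInner μ φ (ψ + ψ') = specInner μ φ ψ + specInner μ φ ψ' := by
  unfold specInner
  rw [← integral_add (specInner_integrable hμ _ _) (specInner_integrable hμ _ _)]
  congr 1; ext ξ
  rw [fourierS_add, add_apply, map_add]; ring

theorem specInner_smul_left (c : ℂ) (φ ψ : 𝓢(Space d, ℂ)) :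
    specInner μ (c • φ) ψ = c * specInner μ φ ψ := by
  unfold specInner
  rw [← integral_const_mul]
  congr 1; ext ξ
  rw [fourierS_smul, smul_apply, smul_eq_mul]; ring

theorem specInner_smul_right (c : ℂ) (φ ψ : 𝓢(Space d, ℂ)) :
    specInner μ φ (c • ψ) = conj c * specInner μ φ ψ := by
  unfold specInner
  rw [← integral_const_mul]
  congr 1; ext ξ
  rw [fourierS_smul, smul_apply, smul_eq_mul, map_mul]; ring

theorem specInner_sub_left (hμ : μ.HasTemperateGrowth) (φ φ' ψ : 𝓢(Space d, ℂ)) :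
    specInner μ (φ - φ') ψ = specInner μ φ ψ - specInner μ φ' ψ := by
  rw [sub_eq_add_neg, ← neg_one_smul ℂ φ', specInner_add_left hμ, specInner_smul_left]; ring

theorem specInner_sub_right (hμ : μ.HasTemperateGrowth) (φ ψ ψ' : 𝓢(Space d, ℂ)) :
    specInner μ φ (ψ - ψ') = specInner μ φ ψ - specInner μ φ ψ' := by
  rw [sub_eq_add_neg, ← neg_one_smul ℂ ψ', specInner_add_right hμ, specInner_smul_right]
  simp; ring

theorem IsSpectralPair.specInner_toComplexS (h : IsSpectralPair f μ) (φ ψ : 𝓢(Space d, ℝ)) :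
    specInner μ (toComplexS φ) (toComplexS ψ) =
      ((∫ x, ∫ y, (f (x - y)).toReal * φ x * ψ y : ℝ) : ℂ) := by
  rw [← h.integral_integral_eq, ← integral_complex_ofReal]
  congr 1; ext x
  rw [← integral_complex_ofReal]
  congr 1; ext y
  rw [toComplexS_apply, toComplexS_apply, Complex.conj_ofReal]; push_cast; rfl

theorem IsSpectralPair.integrable_prod_real (h : IsSpectralPair f μ) (φ ψ : 𝓢(Space d, ℝ)) :
    Integrable (fun p : Space d × Space d => (f (p.1 - p.2)).toReal * φ p.1 * ψ p.2)
      (volume.prod volume) := by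
  refine (h.integrable_prod (toComplexS φ) (toComplexS ψ)).re.congr
    (Eventually.of_forall fun p => ?_)
  simp only [toComplexS_apply, Complex.conj_ofReal, RCLike.re_to_complex, ← Complex.ofReal_mul,
    Complex.ofReal_re]

/-- The covariance of the noise on elementary functions, in terms of the time covariance and the
spectral inner product. -/
theorem IsSpectralPair.innerHP_eq_sum (h : IsSpectralPair f μ) {H : ℝ} (hH : 1 / 2 < H)
    (h₁ h₂ : Elem d ℝ) {S : Finset {a : ℝ // 0 < a}} (hS₁ : h₁.support ⊆ S)
    (hS₂ : h₂.support ⊆ S) :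
    innerHP H f h₁ h₂ = ∑ a ∈ S, ∑ b ∈ S,
      timeCov H a b * (specInner μ (toComplexS (h₁ a)) (toComplexS (h₂ b))).re := by
  set J : {a : ℝ // 0 < a} × {a : ℝ // 0 < a} → ℝ := fun q =>
    ∫ x, ∫ y, (f (x - y)).toReal * h₁ q.1 x * h₂ q.2 y with hJ
  have hsp : ∀ t s : ℝ, ∫ x : Space d, ∫ y : Space d,
      |t - s| ^ (2 * H - 2) * (f (x - y)).toReal * h₁.eval t x * h₂.eval s y =
      ∑ q ∈ S ×ˢ S, |t - s| ^ (2 * H - 2) * stepFn q.1 t * stepFn q.2 s * J q := by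
    intro t s
    have h1 : ∀ x y : Space d,
        |t - s| ^ (2 * H - 2) * (f (x - y)).toReal * h₁.eval t x * h₂.eval s y =
        ∑ q ∈ S ×ˢ S, (|t - s| ^ (2 * H - 2) * stepFn q.1 t * stepFn q.2 s) *
          ((f (x - y)).toReal * h₁ q.1 x * h₂ q.2 y) := by
      intro x y
      rw [h₁.eval_eq_sum hS₁, h₂.eval_eq_sum hS₂, mul_assoc, Finset.sum_mul_sum,
        ← Finset.sum_product', Finset.mul_sum]
      refine Finset.sum_congr rfl fun q _ => ?_
      simp only [smul_eq_mul]; ring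
    simp_rw [h1]
    rw [integral_integral_finsetSum _ fun q _ =>
      (h.integrable_prod_real (h₁ q.1) (h₂ q.2)).const_mul _]
    refine Finset.sum_congr rfl fun q _ => ?_
    simp_rw [integral_const_mul]
    rfl
  have hi : ∀ a b : ℝ, Integrable
      (fun p : ℝ × ℝ => |p.1 - p.2| ^ (2 * H - 2) * stepFn a p.1 * stepFn b p.2)
      ((volume.restrict (Ioi 0)).prod (volume.restrict (Ioi 0))) := by
    intro a b
    rw [Measure.prod_restrict]
    exact integrableOn_kernel_stepFn hH a b
  rw [innerHP]
  simp_rw [hsp]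
  rw [integral_integral_finsetSum _ fun q _ => (hi q.1 q.2).mul_const _, Finset.mul_sum,
    ← Finset.sum_product']
  refine Finset.sum_congr rfl fun q _ => ?_
  simp_rw [integral_mul_const]
  rw [← integral_prod _ (hi q.1 q.2), Measure.prod_restrict, h.specInner_toComplexS,
    Complex.ofReal_re, timeCov, ← mul_assoc]
  rfl

/-- The real parts of the inner products of the real and imaginary parts add up: the cross terms
`⟨Re φ, Im ψ⟩` and `⟨Im φ, Re ψ⟩` are real, and are multiplied by `±i`. -/
theorem IsSpectralPair.specInner_re_add_im (h : IsSpectralPair f μ) (φ ψ : 𝓢(Space d, ℂ)) :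
    (specInner μ (toComplexS (SchwartzMap.postcompCLM (𝕜 := ℝ) Complex.reCLM φ))
      (toComplexS (SchwartzMap.postcompCLM (𝕜 := ℝ) Complex.reCLM ψ))).re +
    (specInner μ (toComplexS (SchwartzMap.postcompCLM (𝕜 := ℝ) Complex.imCLM φ))
      (toComplexS (SchwartzMap.postcompCLM (𝕜 := ℝ) Complex.imCLM ψ))).re =
    (specInner μ φ ψ).re := by
  have hd : ∀ χ : 𝓢(Space d, ℂ),
      χ = toComplexS (SchwartzMap.postcompCLM (𝕜 := ℝ) Complex.reCLM χ) +
        Complex.I • toComplexS (SchwartzMap.postcompCLM (𝕜 := ℝ) Complex.imCLM χ) := by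
    intro χ
    ext x
    rw [add_apply, smul_apply, toComplexS_apply, toComplexS_apply,
      smul_eq_mul, mul_comm]
    exact (Complex.re_add_im (χ x)).symm
  have hμ := h.tempered
  conv_rhs => rw [hd φ, hd ψ]
  rw [specInner_add_left hμ, specInner_add_right hμ, specInner_add_right hμ, specInner_smul_left,
    specInner_smul_right, specInner_smul_left, specInner_smul_right]
  simp only [h.specInner_toComplexS, Complex.conj_I]
  simp

/-- As `F(Fφ) = (2π)^d φ(-·)`, this rests on the symmetry of `μ`; it is the source of the factor
`(2π)^{2d}` in `hatNormSq`. -/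
theorem IsSpectralPair.specInner_fourierS (h : IsSpectralPair f μ) (φ ψ : 𝓢(Space d, ℂ)) :
    specInner μ (fourierS φ) (fourierS ψ) =
      ((2 * Real.pi) ^ (2 * d) : ℝ) * ∫ ξ, φ ξ * conj (ψ ξ) ∂μ := by
  have h1 := h.integral_reflS (SchwartzMap.pairing (ContinuousLinearMap.mul ℂ ℂ) φ (conjS ψ))
  simp only [SchwartzMap.pairing_apply_apply, ContinuousLinearMap.mul_apply', conjS_apply] at h1
  rw [← h1, specInner, ← integral_const_mul]
  congr 1; ext ξ
  rw [fourierS_fourierS_apply, fourierS_fourierS_apply, map_mul, Complex.conj_ofReal]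
  push_cast; ring

/-! ### The norm of elementary functions -/

theorem isBddTime_sum (S : Finset {a : ℝ // 0 < a}) (z : {a : ℝ // 0 < a} → ℂ) :
    IsBddTime (∑ a ∈ S, (a : ℝ)) (∑ a ∈ S, ‖z a‖) fun s => ∑ a ∈ S, stepFn a s • z a where
  measurable := by
    refine Finset.measurable_fun_sum S fun a _ => ?_
    exact (measurable_one.indicator measurableSet_Icc : Measurable (stepFn a)).smul_const _
  bound s hs := by
    refine (norm_sum_le _ _).trans (Finset.sum_le_sum fun a _ => ?_)
    have := (isBddTime_stepFn a).bound s hs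
    rw [Complex.norm_real] at this
    rw [norm_smul]
    exact mul_le_of_le_one_left (norm_nonneg _) this
  supp s hs := by
    refine Finset.sum_eq_zero fun a ha => ?_
    have h1 : (a : ℝ) ≤ ∑ a ∈ S, (a : ℝ) :=
      Finset.single_le_sum (f := fun a : {a : ℝ // 0 < a} => (a : ℝ)) (fun b _ => b.2.le) ha
    have h2 : stepFn a s = 0 := indicator_of_notMem (fun h => (h1.trans_lt hs).not_ge h.2) _
    simp [h2]

/-- The time energy of a step function is a quadratic form in its coefficients. -/
theorem energy_sum {H : ℝ} (hH : 1 / 2 < H) (S : Finset {a : ℝ // 0 < a})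
    (z : {a : ℝ // 0 < a} → ℂ) :
    alphaH H * (∫ p in Ioi (0 : ℝ) ×ˢ Ioi (0 : ℝ), ((|p.1 - p.2| ^ (2 * H - 2) : ℝ) : ℂ) *
      (∑ a ∈ S, stepFn a p.1 • z a) * conj (∑ a ∈ S, stepFn a p.2 • z a)).re =
    ∑ a ∈ S, ∑ b ∈ S, timeCov H a b * (z a * conj (z b)).re := by
  have h1 : ∀ p : ℝ × ℝ, ((|p.1 - p.2| ^ (2 * H - 2) : ℝ) : ℂ) *
      (∑ a ∈ S, stepFn a p.1 • z a) * conj (∑ a ∈ S, stepFn a p.2 • z a) =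
      ∑ q ∈ S ×ˢ S, ((|p.1 - p.2| ^ (2 * H - 2) * stepFn q.1 p.1 * stepFn q.2 p.2 : ℝ) : ℂ) *
        (z q.1 * conj (z q.2)) := by
    intro p
    rw [map_sum, mul_assoc, Finset.sum_mul_sum, ← Finset.sum_product', Finset.mul_sum]
    refine Finset.sum_congr rfl fun q _ => ?_
    simp only [Complex.real_smul, map_mul, Complex.conj_ofReal]
    push_cast; ring
  simp_rw [h1]
  rw [integral_finsetSum _ fun q _ => (integrableOn_kernel_stepFn hH q.1 q.2).ofReal.mul_const _,
    ← Finset.sum_product', Complex.re_sum, Finset.mul_sum]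
  refine Finset.sum_congr rfl fun q _ => ?_
  rw [integral_mul_const, integral_complex_ofReal, Complex.re_ofReal_mul, timeCov]
  ring

theorem hatNormSq_sum {H : ℝ} (hH : 1 / 2 < H) (hH1 : H < 1) (hμ : μ.HasTemperateGrowth)
    (S : Finset {a : ℝ // 0 < a}) (δ : {a : ℝ // 0 < a} → 𝓢(Space d, ℂ)) :
    hatNormSq H μ (fun s ξ => ∑ a ∈ S, stepFn a s • δ a ξ) =
      ENNReal.ofReal (∑ a ∈ S, ∑ b ∈ S, timeCov H a b *
        ((2 * Real.pi) ^ (2 * d) * (∫ ξ, δ a ξ * conj (δ b ξ) ∂μ).re)) := by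
  have h1 : ∀ ξ, timeNormSq H (fun s => ∑ a ∈ S, stepFn a s • δ a ξ) =
      ENNReal.ofReal (∑ a ∈ S, ∑ b ∈ S, timeCov H a b * (δ a ξ * conj (δ b ξ)).re) := by
    intro ξ
    have hb := isBddTime_sum S fun a => δ a ξ
    rw [timeNormSq, if_pos (integrableOn_energy hH hb hb), energy_sum hH]
  have hpos : ∀ ξ, 0 ≤ ∑ a ∈ S, ∑ b ∈ S, timeCov H a b * (δ a ξ * conj (δ b ξ)).re := by
    intro ξ
    rw [← energy_sum hH]
    exact mul_nonneg (alphaH_pos hH).le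
      (energy_re_nonneg hH hH1 (isBddTime_sum S fun a => δ a ξ))
  have hint : ∀ a b : {a : ℝ // 0 < a},
      Integrable (fun ξ => timeCov H a b * (δ a ξ * conj (δ b ξ)).re) μ :=
    fun a b => (specInner_integrable hμ (δ a) (δ b)).re.const_mul _
  have hre : ∀ a b, ∫ ξ, (δ a ξ * conj (δ b ξ)).re ∂μ = (∫ ξ, δ a ξ * conj (δ b ξ) ∂μ).re :=
    fun a b => integral_re (𝕜 := ℂ) (specInner_integrable hμ (δ a) (δ b))
  rw [hatNormSq]
  simp_rw [h1]
  rw [← ofReal_integral_eq_lintegral_ofReal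
    (integrable_finsetSum _ fun a _ => integrable_finsetSum _ fun b _ => hint a b)
    (Eventually.of_forall hpos), ← ENNReal.ofReal_mul (by positivity),
    integral_finsetSum _ fun a _ => integrable_finsetSum _ fun b _ => hint a b, Finset.mul_sum]
  congr 1
  refine Finset.sum_congr rfl fun a _ => ?_
  rw [integral_finsetSum _ fun b _ => hint a b, Finset.mul_sum]
  refine Finset.sum_congr rfl fun b _ => ?_
  rw [integral_const_mul, hre]
  ring

/-! ### The noise -/

variable {Ω : Type*} [MeasurableSpace Ω] {P : Measure Ω} {W : Elem d ℝ → Ω → ℝ} {H : ℝ}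

theorem IsNoise.memLp (hW : IsNoise P H f W) (g : Elem d ℝ) : MemLp (W g) 2 P :=
  (hW.gaussian.hasGaussianLaw_eval g).memLp_two

/-- The noise is linear in mean square; only its covariance is needed to see this. -/
theorem IsNoise.integral_sub_sq (hW : IsNoise P H f W) (h : IsSpectralPair f μ)
    (hH : 1 / 2 < H) (g g' : Elem d ℝ) {S : Finset {a : ℝ // 0 < a}} (hS : g.support ⊆ S)
    (hS' : g'.support ⊆ S) :
    ∫ ω, (W g ω - W g' ω) ^ 2 ∂P = ∑ a ∈ S, ∑ b ∈ S, timeCov H a b *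
      (specInner μ (toComplexS (g a - g' a)) (toComplexS (g b - g' b))).re := by
  have hi : ∀ k k', Integrable (fun ω => W k ω * W k' ω) P :=
    fun k k' => (hW.memLp k).integrable_mul (hW.memLp k')
  have h1 : ∀ ω, (W g ω - W g' ω) ^ 2 =
      W g ω * W g ω - W g ω * W g' ω - (W g' ω * W g ω - W g' ω * W g' ω) := fun ω => by ring
  have hd : ∀ k k' l l', Integrable (fun ω => W k ω * W k' ω - W l ω * W l' ω) P :=
    fun k k' l l' => (hi k k').sub (hi l l')
  simp_rw [h1]
  rw [integral_sub (hd g g g g') (hd g' g g' g'),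
    integral_sub (hi g g) (hi g g'), integral_sub (hi g' g) (hi g' g'), hW.covariance,
    hW.covariance, hW.covariance, hW.covariance, h.innerHP_eq_sum hH g g hS hS,
    h.innerHP_eq_sum hH g g' hS hS', h.innerHP_eq_sum hH g' g hS' hS,
    h.innerHP_eq_sum hH g' g' hS' hS']
  simp_rw [← Finset.sum_sub_distrib]
  refine Finset.sum_congr rfl fun a _ => Finset.sum_congr rfl fun b _ => ?_
  have hμ := h.tempered
  rw [toComplexS_sub, toComplexS_sub, specInner_sub_left hμ, specInner_sub_right hμ,
    specInner_sub_right hμ]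
  simp only [Complex.sub_re]
  ring

theorem IsNoise.memLp_fourierNoise (hW : IsNoise P H f W) (h : Elem d ℂ) :
    MemLp (fourierNoise W h) 2 P := by
  have h1 : MemLp (fun ω => (W h.fourier.re ω : ℂ)) 2 P := (hW.memLp h.fourier.re).ofReal
  have h2 : MemLp (fun ω => (W h.fourier.im ω : ℂ)) 2 P := (hW.memLp h.fourier.im).ofReal
  exact h1.add (h2.const_mul Complex.I)

/-- The isometry `E|FW(h)|² = ‖h‖²`, applied to a difference. -/
theorem IsNoise.lintegral_fourierNoise_sub (hW : IsNoise P H f W) (h : IsSpectralPair f μ)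
    (hH : 1 / 2 < H) (hH1 : H < 1) (e e' : Elem d ℂ) :
    ∫⁻ ω, ‖fourierNoise W e ω - fourierNoise W e' ω‖ₑ ^ 2 ∂P =
      hatNormSq H μ (fun s ξ => e.eval s ξ - e'.eval s ξ) := by
  classical
  set S := e.support ∪ e'.support with hS
  have hSe : e.support ⊆ S := Finset.subset_union_left
  have hSe' : e'.support ⊆ S := Finset.subset_union_right
  have hmap : ∀ (k : Elem d ℂ), k.fourier.re.support ⊆ k.support ∧
      k.fourier.im.support ⊆ k.support := fun k =>
    ⟨Finsupp.support_mapRange.trans Finsupp.support_mapRange,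
      Finsupp.support_mapRange.trans Finsupp.support_mapRange⟩
  have hev : (fun s ξ => e.eval s ξ - e'.eval s ξ) =
      fun s ξ => ∑ a ∈ S, stepFn a s • (e a - e' a) ξ := by
    ext s ξ
    rw [e.eval_eq_sum hSe, e'.eval_eq_sum hSe', ← Finset.sum_sub_distrib]
    refine Finset.sum_congr rfl fun a _ => ?_
    rw [sub_apply, smul_sub]
  rw [hev, hatNormSq_sum hH hH1 h.tempered]
  have hn : ∀ ω, ‖fourierNoise W e ω - fourierNoise W e' ω‖ₑ ^ 2 = ENNReal.ofReal
      ((W e.fourier.re ω - W e'.fourier.re ω) ^ 2 +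
        (W e.fourier.im ω - W e'.fourier.im ω) ^ 2) := by
    intro ω
    rw [← ofReal_norm, ← ENNReal.ofReal_pow (norm_nonneg _), ← Complex.normSq_eq_norm_sq,
      Complex.normSq_apply]
    congr 1
    simp [fourierNoise]
    ring
  simp_rw [hn]
  have hi1 : Integrable (fun ω => (W e.fourier.re ω - W e'.fourier.re ω) ^ 2) P :=
    ((hW.memLp e.fourier.re).sub (hW.memLp e'.fourier.re)).integrable_sq
  have hi2 : Integrable (fun ω => (W e.fourier.im ω - W e'.fourier.im ω) ^ 2) P :=
    ((hW.memLp e.fourier.im).sub (hW.memLp e'.fourier.im)).integrable_sq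
  have hi12 : Integrable (fun ω => (W e.fourier.re ω - W e'.fourier.re ω) ^ 2 +
      (W e.fourier.im ω - W e'.fourier.im ω) ^ 2) P := hi1.add hi2
  rw [← ofReal_integral_eq_lintegral_ofReal hi12
    (Eventually.of_forall fun ω => by positivity)]
  congr 1
  have ha : ∫ ω, (W e.fourier.re ω - W e'.fourier.re ω) ^ 2 +
      (W e.fourier.im ω - W e'.fourier.im ω) ^ 2 ∂P =
      ∫ ω, (W e.fourier.re ω - W e'.fourier.re ω) ^ 2 ∂P +
      ∫ ω, (W e.fourier.im ω - W e'.fourier.im ω) ^ 2 ∂P := integral_add hi1 hi2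
  rw [ha, hW.integral_sub_sq h hH _ _ ((hmap e).1.trans hSe) ((hmap e').1.trans hSe'),
    hW.integral_sub_sq h hH _ _ ((hmap e).2.trans hSe) ((hmap e').2.trans hSe'),
    ← Finset.sum_add_distrib]
  refine Finset.sum_congr rfl fun a _ => ?_
  rw [← Finset.sum_add_distrib]
  refine Finset.sum_congr rfl fun b _ => ?_
  have hre : ∀ c, e.fourier.re c - e'.fourier.re c =
      SchwartzMap.postcompCLM (𝕜 := ℝ) Complex.reCLM (fourierS (e c - e' c)) := fun c => by
    rw [fourierS_sub, map_sub]; rfl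
  have him : ∀ c, e.fourier.im c - e'.fourier.im c =
      SchwartzMap.postcompCLM (𝕜 := ℝ) Complex.imCLM (fourierS (e c - e' c)) := fun c => by
    rw [fourierS_sub, map_sub]; rfl
  rw [hre, hre, him, him, ← mul_add, h.specInner_re_add_im, h.specInner_fourierS,
    Complex.re_ofReal_mul]

end Covariance

/-! ### Mean square convergence -/

section MeanSquare

variable {α E : Type*} [MeasurableSpace α] {μ : Measure α} [NormedAddCommGroup E]

theorem eLpNorm_two_sq (f : α → E) : eLpNorm f 2 μ ^ 2 = ∫⁻ x, ‖f x‖ₑ ^ 2 ∂μ := by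
  have h := eLpNorm_nnreal_pow_eq_lintegral (f := f) (μ := μ) (p := 2) two_ne_zero
  simpa only [NNReal.coe_ofNat, ENNReal.coe_ofNat, ENNReal.rpow_ofNat] using h

theorem tendsto_eLpNorm_two_iff {ι : Type*} {l : Filter ι} (f : ι → α → E) :
    Tendsto (fun n => eLpNorm (f n) 2 μ) l (𝓝 0) ↔
      Tendsto (fun n => ∫⁻ x, ‖f n x‖ₑ ^ 2 ∂μ) l (𝓝 0) := by
  simp_rw [← eLpNorm_two_sq]
  constructor
  · intro h
    simpa using ENNReal.Tendsto.pow (n := 2) h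
  · intro h
    have h2 := (ENNReal.continuous_rpow_const (y := (2 : ℝ)⁻¹)).tendsto 0 |>.comp h
    simp only [ENNReal.zero_rpow_of_pos (show (0 : ℝ) < 2⁻¹ by norm_num)] at h2
    refine h2.congr fun n => ?_
    rw [Function.comp, ← ENNReal.rpow_natCast, ← ENNReal.rpow_mul]
    simp

theorem lintegral_enorm_add_sq_le {f g : α → E} (hf : AEStronglyMeasurable f μ) :
    ∫⁻ x, ‖f x + g x‖ₑ ^ 2 ∂μ ≤ 2 * ∫⁻ x, ‖f x‖ₑ ^ 2 ∂μ + 2 * ∫⁻ x, ‖g x‖ₑ ^ 2 ∂μ := by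
  rw [← lintegral_const_mul' _ _ (by simp), ← lintegral_const_mul' _ _ (by simp),
    ← lintegral_add_left' ((hf.enorm.pow_const 2).const_mul 2)]
  exact lintegral_mono fun x => enorm_add_sq_le _ _

/-- A sequence which is Cauchy in mean square has a limit in mean square. -/
theorem exists_tendsto_eLpNorm_two [CompleteSpace E] {F : ℕ → α → E} (hF : ∀ n, MemLp (F n) 2 μ)
    {a : ℕ → ℝ≥0∞} (ha : Tendsto a atTop (𝓝 0))
    (h : ∀ n m, ∫⁻ x, ‖F n x - F m x‖ₑ ^ 2 ∂μ ≤ a n + a m) :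
    ∃ Y, MemLp Y 2 μ ∧ Tendsto (fun n => eLpNorm (fun x => F n x - Y x) 2 μ) atTop (𝓝 0) := by
  have hc : CauchySeq fun n => (hF n).toLp (F n) := by
    rw [Lp.cauchySeq_Lp_iff_cauchySeq_eLpNorm]
    have h1 : ∀ q : ℕ × ℕ, eLpNorm (⇑((hF q.1).toLp (F q.1)) - ⇑((hF q.2).toLp (F q.2))) 2 μ =
        eLpNorm (fun x => F q.1 x - F q.2 x) 2 μ := fun q =>
      eLpNorm_congr_ae ((hF q.1).coeFn_toLp.sub (hF q.2).coeFn_toLp)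
    simp_rw [h1]
    rw [tendsto_eLpNorm_two_iff (fun q : ℕ × ℕ => fun x => F q.1 x - F q.2 x)]
    refine tendsto_of_tendsto_of_tendsto_of_le_of_le tendsto_const_nhds ?_ (fun _ => zero_le)
      fun q => h q.1 q.2
    rw [← prod_atTop_atTop_eq]
    simpa using (ha.comp tendsto_fst).add (ha.comp tendsto_snd)
  obtain ⟨Y, hY⟩ := cauchySeq_tendsto_of_complete hc
  refine ⟨Y, Lp.memLp Y, ?_⟩
  rw [Lp.tendsto_Lp_iff_tendsto_eLpNorm'] at hY
  refine hY.congr fun n => eLpNorm_congr_ae ?_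
  filter_upwards [(hF n).coeFn_toLp] with x hx
  simp [hx]

end MeanSquare

/-! ### Approximation by elementary functions -/

section Approximation

variable {d : ℕ} {μ : Measure (Space d)}

/-- Schwartz functions are dense in `L²(μ)`. -/
theorem exists_schwartz_approx [IsFiniteMeasureOnCompacts μ] {c : Space d → ℂ} (hc : MemLp c 2 μ)
    {ε : ℝ≥0∞} (hε : ε ≠ 0) : ∃ ψ : 𝓢(Space d, ℂ), ∫⁻ ξ, ‖ψ ξ - c ξ‖ₑ ^ 2 ∂μ ≤ ε := by
  obtain ⟨r, hr0, hr⟩ : ∃ r : ℝ, 0 < r ∧ ENNReal.ofReal r ^ 2 ≤ ε := by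
    have h1 : Tendsto (fun r : ℝ => ENNReal.ofReal r ^ 2) (𝓝[>] 0) (𝓝 0) := by
      have h2 : Continuous fun r : ℝ => ENNReal.ofReal r ^ 2 :=
        (ENNReal.continuous_pow 2).comp ENNReal.continuous_ofReal
      simpa using (h2.tendsto 0).mono_left nhdsWithin_le_nhds
    obtain ⟨r, hr, hr2⟩ := ((h1.eventually_le_const (pos_iff_ne_zero.2 hε)).and
      self_mem_nhdsWithin).exists
    exact ⟨r, hr2, hr⟩
  obtain ⟨g, hg1, hg2, hg3⟩ := hc.exist_eLpNorm_sub_le (by simp) (by norm_num) hr0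
  refine ⟨hg1.toSchwartzMap hg2, ?_⟩
  have h3 : ∫⁻ ξ, ‖hg1.toSchwartzMap hg2 ξ - c ξ‖ₑ ^ 2 ∂μ = eLpNorm (c - g) 2 μ ^ 2 := by
    rw [eLpNorm_two_sq]
    congr 1; ext ξ
    rw [Pi.sub_apply, enorm_sub_rev]
    rfl
  rw [h3]
  exact (pow_le_pow_left' hg3 2).trans hr

/-- The elementary function `e` vanishes after time `T` and is within `b(ξ)` of `h`, uniformly in
the time. -/
structure ApproxBy (T : ℝ) (h : ℝ → Space d → ℂ) (e : Elem d ℂ) (b : Space d → ℝ) : Prop where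
  measurable : Measurable b
  supp : ∀ s, T < s → ∀ ξ, e.eval s ξ = 0
  bound : ∀ s, 0 < s → ∀ ξ, ‖e.eval s ξ - h s ξ‖ ≤ b ξ

/-- The function `h` can be approximated by elementary functions, uniformly in the time and in
`L²(μ)` in the frequency. -/
def TimeApprox (μ : Measure (Space d)) (T : ℝ) (h : ℝ → Space d → ℂ) : Prop :=
  ∀ ε : ℝ≥0∞, ε ≠ 0 → ∃ e b, ApproxBy T h e b ∧ ∫⁻ ξ, ‖b ξ‖ₑ ^ 2 ∂μ ≤ ε

theorem Elem.eval_single (a : {a : ℝ // 0 < a}) (ψ : 𝓢(Space d, ℂ)) (s : ℝ) (ξ : Space d) :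
    Elem.eval (Finsupp.single a ψ) s ξ = (Icc (0 : ℝ) a).indicator (fun _ => ψ ξ) s := by
  rw [Elem.eval, Finsupp.sum_single_index]
  simp

theorem Elem.eval_zero (s : ℝ) (ξ : Space d) : Elem.eval (0 : Elem d ℂ) s ξ = 0 := by
  simp [Elem.eval]

theorem Elem.eval_add (e e' : Elem d ℂ) (s : ℝ) (ξ : Space d) :
    Elem.eval (e + e') s ξ = e.eval s ξ + e'.eval s ξ := by
  unfold Elem.eval
  refine Finsupp.sum_add_index' (by simp) fun a ψ ψ' => ?_
  by_cases h : s ∈ Icc (0 : ℝ) a <;> simp [h]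

theorem TimeApprox.zero (T : ℝ) {h : ℝ → Space d → ℂ} (h0 : ∀ s, 0 < s → ∀ ξ, h s ξ = 0) :
    TimeApprox μ T h := fun ε _ =>
  ⟨0, 0, ⟨measurable_zero, fun s _ ξ => Elem.eval_zero s ξ,
    fun s hs ξ => by simp [Elem.eval_zero, h0 s hs ξ]⟩, by simp⟩

theorem TimeApprox.indicator [IsFiniteMeasureOnCompacts μ] {a T : ℝ} (ha : 0 ≤ a) (haT : a ≤ T)
    {c : Space d → ℂ} (hcm : Measurable c) (hc : MemLp c 2 μ) :
    TimeApprox μ T fun s ξ => (Icc (0 : ℝ) a).indicator (fun _ => c ξ) s := by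
  rcases ha.eq_or_lt with rfl | ha
  · exact TimeApprox.zero T fun s hs ξ => indicator_of_notMem (fun h => hs.not_ge h.2) _
  · intro ε hε
    obtain ⟨ψ, hψ⟩ := exists_schwartz_approx hc hε
    refine ⟨Finsupp.single ⟨a, ha⟩ ψ, fun ξ => ‖ψ ξ - c ξ‖, ⟨?_, ?_, ?_⟩, ?_⟩
    · exact (ψ.continuous.measurable.sub hcm).norm
    · intro s hs ξ
      rw [Elem.eval_single]
      exact indicator_of_notMem (fun h => (haT.trans_lt hs).not_ge h.2) _
    · intro s hs ξ
      rw [Elem.eval_single]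
      by_cases h : s ∈ Icc (0 : ℝ) a <;> simp [h]
    · simpa using hψ

theorem TimeApprox.add {T : ℝ} {h h' : ℝ → Space d → ℂ} (hh : TimeApprox μ T h)
    (hh' : TimeApprox μ T h') : TimeApprox μ T fun s ξ => h s ξ + h' s ξ := by
  intro ε hε
  have hε4 : ε / 4 ≠ 0 := by simp [hε]
  obtain ⟨e, b, hb, hbε⟩ := hh _ hε4
  obtain ⟨e', b', hb', hbε'⟩ := hh' _ hε4
  refine ⟨e + e', fun ξ => b ξ + b' ξ, ⟨hb.measurable.add hb'.measurable, ?_, ?_⟩, ?_⟩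
  · intro s hs ξ
    rw [Elem.eval_add, hb.supp s hs, hb'.supp s hs, add_zero]
  · intro s hs ξ
    rw [Elem.eval_add, add_sub_add_comm]
    exact (norm_add_le _ _).trans (add_le_add (hb.bound s hs ξ) (hb'.bound s hs ξ))
  · refine (lintegral_enorm_add_sq_le hb.measurable.aestronglyMeasurable).trans ?_
    calc _ ≤ 2 * (ε / 4) + 2 * (ε / 4) := by gcongr
      _ = 4 * (ε / 4) := by ring
      _ = ε := ENNReal.mul_div_cancel (by simp) (by simp)

theorem TimeApprox.sum {ι : Type*} {T : ℝ} (S : Finset ι) {h : ι → ℝ → Space d → ℂ}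
    (hh : ∀ i ∈ S, TimeApprox μ T (h i)) : TimeApprox μ T fun s ξ => ∑ i ∈ S, h i s ξ := by
  classical
  induction S using Finset.induction_on with
  | empty => exact TimeApprox.zero T (by simp)
  | insert i S hi ih =>
    simp_rw [Finset.sum_insert hi]
    exact (hh i (Finset.mem_insert_self i S)).add
      (ih fun j hj => hh j (Finset.mem_insert_of_mem hj))

theorem TimeApprox.of_close {T : ℝ} {h : ℝ → Space d → ℂ}
    (hh : ∀ ε : ℝ≥0∞, ε ≠ 0 → ∃ h' : ℝ → Space d → ℂ, ∃ b : Space d → ℝ, TimeApprox μ T h' ∧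
      Measurable b ∧ (∀ s, 0 < s → ∀ ξ, ‖h' s ξ - h s ξ‖ ≤ b ξ) ∧ ∫⁻ ξ, ‖b ξ‖ₑ ^ 2 ∂μ ≤ ε) :
    TimeApprox μ T h := by
  intro ε hε
  have hε4 : ε / 4 ≠ 0 := by simp [hε]
  obtain ⟨h', b, hh', hbm, hb, hbε⟩ := hh _ hε4
  obtain ⟨e, b', hb', hbε'⟩ := hh' _ hε4
  refine ⟨e, fun ξ => b' ξ + b ξ, ⟨hb'.measurable.add hbm, hb'.supp, ?_⟩, ?_⟩
  · intro s hs ξ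
    calc ‖e.eval s ξ - h s ξ‖ = ‖(e.eval s ξ - h' s ξ) + (h' s ξ - h s ξ)‖ := by congr 1; ring
      _ ≤ _ := (norm_add_le _ _).trans (add_le_add (hb'.bound s hs ξ) (hb s hs ξ))
  · refine (lintegral_enorm_add_sq_le hb'.measurable.aestronglyMeasurable).trans ?_
    calc _ ≤ 2 * (ε / 4) + 2 * (ε / 4) := by gcongr
      _ = 4 * (ε / 4) := by ring
      _ = ε := ENNReal.mul_div_cancel (by simp) (by simp)

/-- The wave kernel is Lipschitz in time, with a constant that does not depend on the frequency. -/
theorem abs_waveKernel_sub_le {p : ℝ} (hp : 0 ≤ p) (τ σ : ℝ) :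
    |waveKernel p τ - waveKernel p σ| ≤ |τ - σ| := by
  rcases hp.eq_or_lt with rfl | hp
  · simp [waveKernel]
  · have hq := Real.sqrt_pos.2 hp
    rw [waveKernel_of_pos hp, waveKernel_of_pos hp, ← sub_div, abs_div, abs_of_pos hq,
      div_le_iff₀ hq]
    refine (Real.abs_sin_sub_sin_le _ _).trans ?_
    rw [← mul_sub, abs_mul, abs_of_pos hq, mul_comm]

theorem exists_mul_div_lt_le {t s : ℝ} (ht : 0 < t) (hs : 0 < s) (hst : s ≤ t) {n : ℕ}
    (hn : 0 < n) : ∃ j ∈ Finset.range n, j * t / n < s ∧ s ≤ (j + 1) * t / n := by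
  have hn' : (0 : ℝ) < n := by exact_mod_cast hn
  set x := s * n / t with hx
  have hx0 : 0 < x := by positivity
  obtain ⟨j, hj⟩ : ∃ j, ⌈x⌉₊ = j + 1 := Nat.exists_eq_succ_of_ne_zero (Nat.ceil_pos.2 hx0).ne'
  have h1 : x ≤ j + 1 := by
    have := Nat.le_ceil x
    rw [hj] at this; exact_mod_cast this
  have h2 : (j : ℝ) < x := Nat.lt_ceil.1 (by omega)
  have h3 : x ≤ n := by
    rw [hx, div_le_iff₀ ht, mul_comm]; gcongr
  refine ⟨j, Finset.mem_range.2 ?_, ?_, ?_⟩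
  · exact_mod_cast h2.trans_le h3
  · rw [div_lt_iff₀ hn']
    rwa [hx, lt_div_iff₀ ht] at h2
  · rw [le_div_iff₀ hn']
    rwa [hx, div_le_iff₀ ht] at h1

/-- `1_{(a,b]} = 1_{[0,b]} - 1_{[0,a]}` for positive times. -/
theorem indicator_Icc_add_indicator_neg {a b s : ℝ} (hab : a ≤ b) (hs : 0 < s) (v : ℂ) :
    (Icc (0 : ℝ) b).indicator (fun _ => v) s + (Icc (0 : ℝ) a).indicator (fun _ => -v) s =
      if a < s ∧ s ≤ b then v else 0 := by
  by_cases h1 : s ≤ a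
  · simp [indicator, h1, h1.trans hab, hs.le, h1.not_gt]
  · by_cases h2 : s ≤ b
    · simp [indicator, h1, h2, hs.le, not_le.1 h1]
    · simp [indicator, h1, h2]

/-- The integrand of the weak solution is a limit of functions which are step functions of the
time. -/
theorem timeApprox_waveIntegrand [IsFiniteMeasureOnCompacts μ] {Ψ : Space d → ℂ}
    (hΨc : Continuous fun ξ => (Ψ ξ).re) (hΨ0 : ∀ ξ, 0 ≤ (Ψ ξ).re) {t : ℝ} (ht : 0 ≤ t)
    {g : Space d → ℂ} (hgm : Measurable g) (hg : MemLp g 2 μ) :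
    TimeApprox μ t (waveIntegrand Ψ t g) := by
  rcases ht.eq_or_lt with rfl | ht
  · refine TimeApprox.zero 0 fun s hs ξ => ?_
    rw [waveIntegrand, indicator_of_notMem (fun h => hs.not_ge h.2)]; simp
  set C : ℝ := ((2 * Real.pi) ^ d)⁻¹ with hC
  have hC0 : 0 ≤ C := by positivity
  have hL : ∫⁻ ξ, ‖C * ‖g ξ‖‖ₑ ^ 2 ∂μ ≠ ∞ := by
    have h1 : MemLp (fun ξ => C * ‖g ξ‖) 2 μ := hg.norm.const_mul C
    rw [← eLpNorm_two_sq]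
    exact ENNReal.pow_ne_top h1.2.ne
  refine TimeApprox.of_close fun ε hε => ?_
  obtain ⟨n, hn, hn0⟩ : ∃ n : ℕ, ‖t / n‖ₑ ^ 2 * ∫⁻ ξ, ‖C * ‖g ξ‖‖ₑ ^ 2 ∂μ ≤ ε ∧ 0 < n := by
    have h1 : Tendsto (fun n : ℕ => ‖t / n‖ₑ ^ 2 * ∫⁻ ξ, ‖C * ‖g ξ‖‖ₑ ^ 2 ∂μ) atTop (𝓝 0) := by
      have h2 : Tendsto (fun n : ℕ => ‖t / n‖ₑ) atTop (𝓝 0) := by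
        have := (continuous_enorm.tendsto (0 : ℝ)).comp (tendsto_const_div_atTop_nhds_zero_nat t)
        simpa using! this
      have h3 := ENNReal.Tendsto.mul_const (ENNReal.Tendsto.pow (n := 2) h2)
        (Or.inr hL : (0 : ℝ≥0∞) ^ 2 ≠ 0 ∨ ∫⁻ ξ, ‖C * ‖g ξ‖‖ₑ ^ 2 ∂μ ≠ ∞)
      simpa using h3
    exact ((h1.eventually_le_const (pos_iff_ne_zero.2 hε)).and (eventually_gt_atTop 0)).exists
  have hn' : (0 : ℝ) < n := by exact_mod_cast hn0
  -- the time is frozen at the right end point of each cell of a partition of `(0, t]`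
  set v : ℕ → Space d → ℂ := fun j ξ =>
    (C : ℂ) * (waveKernel (Ψ ξ).re (t - (j + 1) * t / n) : ℂ) * conj (g ξ) with hv
  have hvm : ∀ j, Measurable (v j) := by
    intro j
    have h1 : Continuous fun ξ => (waveKernel (Ψ ξ).re (t - (j + 1) * t / n) : ℂ) :=
      Complex.continuous_ofReal.comp (continuous_waveKernel.comp (hΨc.prodMk continuous_const))
    exact (h1.measurable.const_mul _).mul (Complex.continuous_conj.measurable.comp hgm)
  have hvL : ∀ j, MemLp (v j) 2 μ := by
    intro j
    refine (hg.norm.const_mul (C * |t - (j + 1) * t / n|)).of_le (hvm j).aestronglyMeasurable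
      (Eventually.of_forall fun ξ => ?_)
    have h1 : ‖v j ξ‖ = C * |waveKernel (Ψ ξ).re (t - (j + 1) * t / n)| * ‖g ξ‖ := by
      simp only [hv]
      rw [norm_mul, norm_mul, RCLike.norm_conj, Complex.norm_real, Complex.norm_real,
        Real.norm_eq_abs, Real.norm_eq_abs, abs_of_nonneg hC0]
    rw [h1, Real.norm_of_nonneg (by positivity)]
    exact mul_le_mul_of_nonneg_right (mul_le_mul_of_nonneg_left (abs_waveKernel_le _ _) hC0)
      (norm_nonneg _)
  refine ⟨fun s ξ => ∑ j ∈ Finset.range n,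
    ((Icc (0 : ℝ) ((j + 1) * t / n)).indicator (fun _ => v j ξ) s +
      (Icc (0 : ℝ) (j * t / n)).indicator (fun _ => -v j ξ) s),
    fun ξ => t / n * (C * ‖g ξ‖), ?_, ?_, ?_, ?_⟩
  · refine TimeApprox.sum _ fun j hj => TimeApprox.add ?_ ?_
    · refine TimeApprox.indicator (by positivity) ?_ (hvm j) (hvL j)
      have : (j : ℝ) + 1 ≤ n := by exact_mod_cast Finset.mem_range.1 hj
      rw [div_le_iff₀ hn', mul_comm]; gcongr
    · refine TimeApprox.indicator (by positivity) ?_ (hvm j).neg (hvL j).neg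
      have : (j : ℝ) ≤ n := by exact_mod_cast (Finset.mem_range.1 hj).le
      rw [div_le_iff₀ hn', mul_comm]; gcongr
  · exact (hgm.norm.const_mul C).const_mul _
  · intro s hs ξ
    have hle : ∀ j : ℕ, j * t / n ≤ (j + 1) * t / n := fun j => by gcongr; linarith
    simp_rw [fun j : ℕ => indicator_Icc_add_indicator_neg (hle j) hs (v j ξ)]
    rcases le_or_gt s t with hst | hst
    · obtain ⟨j, hj, hj1, hj2⟩ := exists_mul_div_lt_le ht hs hst hn0
      rw [Finset.sum_eq_single_of_mem j hj, if_pos ⟨hj1, hj2⟩]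
      · rw [waveIntegrand, indicator_of_mem (show s ∈ Icc 0 t from ⟨hs.le, hst⟩), ← hC]
        have h1 : v j ξ - (C : ℂ) * (waveKernel (Ψ ξ).re (t - s) : ℂ) * conj (g ξ) =
            (C : ℂ) * ((waveKernel (Ψ ξ).re (t - (j + 1) * t / n) -
              waveKernel (Ψ ξ).re (t - s) : ℝ) : ℂ) * conj (g ξ) := by
          simp only [hv]; push_cast; ring
        rw [h1, norm_mul, norm_mul, RCLike.norm_conj, Complex.norm_real, Complex.norm_real,
          Real.norm_eq_abs, Real.norm_eq_abs, abs_of_nonneg hC0]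
        have h2 := abs_waveKernel_sub_le (hΨ0 ξ) (t - (j + 1) * t / n) (t - s)
        have h3 : |t - (j + 1) * t / n - (t - s)| ≤ t / n := by
          have : (j + 1) * t / n = j * t / n + t / n := by ring
          rw [abs_le]; constructor <;> linarith
        calc _ ≤ C * (t / n) * ‖g ξ‖ := by gcongr; exact h2.trans h3
          _ = _ := by ring
      · intro i _ hij
        refine if_neg fun ⟨h1, h2⟩ => ?_
        rcases lt_or_gt_of_ne hij with h | h
        · have : (i : ℝ) + 1 ≤ j := by exact_mod_cast h
          have : ((i : ℝ) + 1) * t / n ≤ j * t / n := by gcongr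
          linarith
        · have : (j : ℝ) + 1 ≤ i := by exact_mod_cast h
          have : ((j : ℝ) + 1) * t / n ≤ i * t / n := by gcongr
          linarith
    · rw [Finset.sum_eq_zero, waveIntegrand, indicator_of_notMem (fun h => hst.not_ge h.2)]
      · simp; positivity
      · intro j hj
        refine if_neg fun ⟨_, h2⟩ => ?_
        have : (j : ℝ) + 1 ≤ n := by exact_mod_cast Finset.mem_range.1 hj
        have : ((j : ℝ) + 1) * t / n ≤ t := by
          rw [div_le_iff₀ hn', mul_comm]; gcongr
        linarith
  · simp_rw [enorm_mul (t / n), mul_pow]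
    rwa [lintegral_const_mul' _ _ (by simp)]

/-! ### Stochastic integrals of approximable functions -/

theorem hatNormSq_le {H : ℝ} (hH : 1 / 2 < H) {T : ℝ} {k : ℝ → Space d → ℂ} {b : Space d → ℝ}
    (hk : ∀ ξ, IsBddTime T (b ξ) fun s => k s ξ) :
    hatNormSq H μ k ≤ ENNReal.ofReal ((2 * Real.pi) ^ (2 * d)) *
      ENNReal.ofReal (intervalEnergy H T) * ∫⁻ ξ, ‖b ξ‖ₑ ^ 2 ∂μ := by
  rw [hatNormSq, mul_assoc]
  refine mul_le_mul' le_rfl ?_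
  rw [← lintegral_const_mul' _ _ ENNReal.ofReal_ne_top]
  refine (lintegral_mono fun ξ => (timeNormSq_le hH (hk ξ)).trans ?_)
  rw [ENNReal.ofReal_mul (intervalEnergy_nonneg hH T), ← sq_abs, ENNReal.ofReal_pow (abs_nonneg _),
    ← Real.norm_eq_abs, ofReal_norm]

theorem Elem.measurable_eval (e : Elem d ℂ) (ξ : Space d) : Measurable fun s => e.eval s ξ := by
  simp_rw [e.eval_eq_sum (Finset.Subset.refl _)]
  refine Finset.measurable_fun_sum _ fun a _ => ?_
  exact (measurable_one.indicator measurableSet_Icc : Measurable (stepFn a)).smul_const _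

theorem ApproxBy.isBddTime_sub {T : ℝ} {h : ℝ → Space d → ℂ} {e : Elem d ℂ} {b : Space d → ℝ}
    (hb : ApproxBy T h e b) {M : Space d → ℝ} (hh : ∀ ξ, IsBddTime T (M ξ) fun s => h s ξ)
    (ξ : Space d) : IsBddTime T (b ξ) fun s => e.eval s ξ - h s ξ :=
  ⟨(e.measurable_eval ξ).sub (hh ξ).measurable, fun s hs => hb.bound s hs ξ,
    fun s hs => by simp [hb.supp s hs ξ, (hh ξ).supp s hs]⟩

variable {Ω : Type*} [MeasurableSpace Ω] {P : Measure Ω} {W : Elem d ℝ → Ω → ℝ} {H : ℝ}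
  {f : Space d → ℝ≥0∞}

/-- `Y` is the mean square limit of the integrals `FW(eₙ)`, for elementary functions `eₙ` which
converge to `h` uniformly in the time. The measurable error bounds `b` that come with this form of
convergence control the norm `hatNormSq` of the errors without any measurability of the time norm
as a function of the frequency. -/
def IsUniformIntegral (P : Measure Ω) (μ : Measure (Space d)) (W : Elem d ℝ → Ω → ℝ) (T : ℝ)
    (h : ℝ → Space d → ℂ) (Y : Ω → ℂ) : Prop :=
  MemLp Y 2 P ∧ ∃ (e : ℕ → Elem d ℂ) (b : ℕ → Space d → ℝ), (∀ n, ApproxBy T h (e n) (b n)) ∧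
    Tendsto (fun n => ∫⁻ ξ, ‖b n ξ‖ₑ ^ 2 ∂μ) atTop (𝓝 0) ∧
    Tendsto (fun n => eLpNorm (fun ω => fourierNoise W (e n) ω - Y ω) 2 P) atTop (𝓝 0)

theorem IsUniformIntegral.isFourierIntegral (hH : 1 / 2 < H) {T : ℝ} {h : ℝ → Space d → ℂ}
    {Y : Ω → ℂ} (hY : IsUniformIntegral P μ W T h Y) {M : Space d → ℝ}
    (hh : ∀ ξ, IsBddTime T (M ξ) fun s => h s ξ) : IsFourierIntegral P H μ W h Y := by
  obtain ⟨hY2, e, b, hb, hb0, hlim⟩ := hY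
  refine ⟨hY2, e, ?_, hlim⟩
  refine tendsto_of_tendsto_of_tendsto_of_le_of_le tendsto_const_nhds ?_ (fun _ => zero_le)
    fun n => hatNormSq_le hH ((hb n).isBddTime_sub hh)
  have h1 := ENNReal.Tendsto.const_mul hb0 (Or.inr (ENNReal.mul_ne_top ENNReal.ofReal_ne_top
    ENNReal.ofReal_ne_top : ENNReal.ofReal ((2 * Real.pi) ^ (2 * d)) *
      ENNReal.ofReal (intervalEnergy H T) ≠ ∞))
  simpa using h1

theorem TimeApprox.exists_isUniformIntegral (hW : IsNoise P H f W) (hs : IsSpectralPair f μ)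
    (hH : 1 / 2 < H) (hH1 : H < 1) {T : ℝ} {h : ℝ → Space d → ℂ} (hh : TimeApprox μ T h) :
    ∃ Y, IsUniformIntegral P μ W T h Y := by
  choose e b hb hbε using fun n : ℕ => hh ((n : ℝ≥0∞) + 1)⁻¹ (by simp)
  have hb0 : Tendsto (fun n => ∫⁻ ξ, ‖b n ξ‖ₑ ^ 2 ∂μ) atTop (𝓝 0) := by
    refine tendsto_of_tendsto_of_tendsto_of_le_of_le tendsto_const_nhds ?_ (fun _ => zero_le) hbε
    have := (tendsto_add_atTop_iff_nat 1).2 ENNReal.tendsto_inv_nat_nhds_zero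
    simpa using this
  set K := ENNReal.ofReal ((2 * Real.pi) ^ (2 * d)) * ENNReal.ofReal (intervalEnergy H T) with hK
  have hKt : K ≠ ∞ := ENNReal.mul_ne_top ENNReal.ofReal_ne_top ENNReal.ofReal_ne_top
  obtain ⟨Y, hY, hlim⟩ := exists_tendsto_eLpNorm_two
    (fun n => hW.memLp_fourierNoise (e n)) (a := fun n => K * 2 * ∫⁻ ξ, ‖b n ξ‖ₑ ^ 2 ∂μ) (by
      simpa using ENNReal.Tendsto.const_mul hb0
        (Or.inr (ENNReal.mul_ne_top hKt (by simp) : K * 2 ≠ ∞)))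
    (fun n m => by
      rw [hW.lintegral_fourierNoise_sub hs hH hH1]
      refine (hatNormSq_le hH (b := fun ξ => b n ξ + b m ξ) (T := T) fun ξ =>
        ⟨((e n).measurable_eval ξ).sub ((e m).measurable_eval ξ), fun s hs => ?_,
          fun s hs => by simp [(hb n).supp s hs ξ, (hb m).supp s hs ξ]⟩).trans ?_
      · calc ‖(e n).eval s ξ - (e m).eval s ξ‖ =
              ‖((e n).eval s ξ - h s ξ) - ((e m).eval s ξ - h s ξ)‖ := by congr 1; ring
          _ ≤ _ := (norm_sub_le _ _).trans
              (add_le_add ((hb n).bound s hs ξ) ((hb m).bound s hs ξ))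
      · refine (mul_le_mul' hK.ge
          (lintegral_enorm_add_sq_le (hb n).measurable.aestronglyMeasurable)).trans_eq ?_
        ring)
  exact ⟨Y, hY, e, b, hb, hb0, hlim⟩

/-- The stochastic integral is bounded from the norm `hatNormSq` to mean square. The constant `16`
comes from `‖a + b‖² ≤ 2‖a‖² + 2‖b‖²`, used twice for the integrands and twice for the integrals;
any finite constant serves for the passage to the limit. -/
theorem IsUniformIntegral.lintegral_sub_sq_le (hW : IsNoise P H f W) (hs : IsSpectralPair f μ)
    (hH : 1 / 2 < H) (hH1 : H < 1) {T : ℝ} {h h' : ℝ → Space d → ℂ} {Y Y' : Ω → ℂ}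
    (hY : IsUniformIntegral P μ W T h Y) (hY' : IsUniformIntegral P μ W T h' Y')
    {M M' : Space d → ℝ} (hh : ∀ ξ, IsBddTime T (M ξ) fun s => h s ξ)
    (hh' : ∀ ξ, IsBddTime T (M' ξ) fun s => h' s ξ) :
    ∫⁻ ω, ‖Y ω - Y' ω‖ₑ ^ 2 ∂P ≤ 16 * hatNormSq H μ (fun s ξ => h s ξ - h' s ξ) := by
  obtain ⟨hY2, e, b, hb, hb0, hlim⟩ := hY
  obtain ⟨hY2', e', b', hb', hb0', hlim'⟩ := hY'
  rw [tendsto_eLpNorm_two_iff (fun n ω => fourierNoise W (e n) ω - Y ω)] at hlim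
  rw [tendsto_eLpNorm_two_iff (fun n ω => fourierNoise W (e' n) ω - Y' ω)] at hlim'
  set N := hatNormSq H μ (fun s ξ => h s ξ - h' s ξ) with hN
  set K := ENNReal.ofReal ((2 * Real.pi) ^ (2 * d)) * ENNReal.ofReal (intervalEnergy H T) with hK
  have hKt : K ≠ ∞ := ENNReal.mul_ne_top ENNReal.ofReal_ne_top ENNReal.ofReal_ne_top
  -- the distance between the two elementary functions, by the triangle inequality for each `ξ`
  have helem : ∀ n, hatNormSq H μ (fun s ξ => (e n).eval s ξ - (e' n).eval s ξ) ≤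
      4 * K * ∫⁻ ξ, ‖b n ξ‖ₑ ^ 2 ∂μ + 4 * K * ∫⁻ ξ, ‖b' n ξ‖ₑ ^ 2 ∂μ + 4 * N := by
    intro n
    set I := ENNReal.ofReal (intervalEnergy H T) with hI
    have hIt : I ≠ ∞ := ENNReal.ofReal_ne_top
    have hpt : ∀ ξ, timeNormSq H (fun s => (e n).eval s ξ - (e' n).eval s ξ) ≤
        4 * I * ‖b n ξ‖ₑ ^ 2 + 4 * I * ‖b' n ξ‖ₑ ^ 2 +
          4 * timeNormSq H (fun s => h s ξ - h' s ξ) := by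
      intro ξ
      have hsq : ∀ c : ℝ, ENNReal.ofReal (intervalEnergy H T * c ^ 2) = I * ‖c‖ₑ ^ 2 := by
        intro c
        rw [ENNReal.ofReal_mul (intervalEnergy_nonneg hH T), ← sq_abs,
          ENNReal.ofReal_pow (abs_nonneg _), ← Real.norm_eq_abs, ofReal_norm]
      have h1 := (hb n).isBddTime_sub hh ξ
      have h2 := ((hb' n).isBddTime_sub hh' ξ).const_mul (-1)
      have h3 : IsBddTime T (M ξ + ‖(-1 : ℂ)‖ * M' ξ) fun s => h s ξ + (-1) * h' s ξ :=
        (hh ξ).add ((hh' ξ).const_mul (-1))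
      have h4 := timeNormSq_add_le hH hH1 (h1.add h2) h3
      have h5 := timeNormSq_add_le hH hH1 h1 h2
      have e1 := timeNormSq_le hH h1
      have e2 := timeNormSq_le hH h2
      rw [hsq] at e1 e2
      rw [norm_neg, norm_one, one_mul] at e2
      have h6 : (fun s => (e n).eval s ξ - (e' n).eval s ξ) = fun s =>
          ((e n).eval s ξ - h s ξ + -1 * ((e' n).eval s ξ - h' s ξ)) +
            (h s ξ + -1 * h' s ξ) := by
        ext s; ring
      have h7 : (fun s => h s ξ - h' s ξ) = fun s => h s ξ + -1 * h' s ξ := by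
        ext s; ring
      rw [h6, h7]
      calc _ ≤ 2 * (2 * (I * ‖b n ξ‖ₑ ^ 2) + 2 * (I * ‖b' n ξ‖ₑ ^ 2)) +
            2 * timeNormSq H (fun s => h s ξ + -1 * h' s ξ) := by
              refine h4.trans (add_le_add (mul_le_mul' le_rfl (h5.trans ?_)) le_rfl)
              gcongr
        _ ≤ 2 * (2 * (I * ‖b n ξ‖ₑ ^ 2) + 2 * (I * ‖b' n ξ‖ₑ ^ 2)) +
            4 * timeNormSq H (fun s => h s ξ + -1 * h' s ξ) := by
              gcongr; norm_num
        _ = _ := by ring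
    have hm1 : Measurable fun ξ => 4 * I * ‖b n ξ‖ₑ ^ 2 :=
      ((hb n).measurable.enorm.pow_const 2).const_mul _
    have hm2 : Measurable fun ξ => 4 * I * ‖b' n ξ‖ₑ ^ 2 :=
      ((hb' n).measurable.enorm.pow_const 2).const_mul _
    have hm12 : Measurable fun ξ => 4 * I * ‖b n ξ‖ₑ ^ 2 + 4 * I * ‖b' n ξ‖ₑ ^ 2 := hm1.add hm2
    have h4I : 4 * I ≠ ∞ := ENNReal.mul_ne_top (by simp) hIt
    rw [hatNormSq]
    refine (mul_le_mul' le_rfl (lintegral_mono hpt)).trans ?_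
    rw [lintegral_add_left hm12, lintegral_add_left hm1,
      lintegral_const_mul' _ _ h4I, lintegral_const_mul' _ _ h4I,
      lintegral_const_mul' _ _ (by simp), hN, hatNormSq, hK]
    refine le_of_eq ?_
    ring
  have hle : ∀ n, ∫⁻ ω, ‖Y ω - Y' ω‖ₑ ^ 2 ∂P ≤
      4 * (∫⁻ ω, ‖fourierNoise W (e n) ω - Y ω‖ₑ ^ 2 ∂P) +
      4 * (∫⁻ ω, ‖fourierNoise W (e' n) ω - Y' ω‖ₑ ^ 2 ∂P) +
      4 * (4 * K * ∫⁻ ξ, ‖b n ξ‖ₑ ^ 2 ∂μ + 4 * K * ∫⁻ ξ, ‖b' n ξ‖ₑ ^ 2 ∂μ + 4 * N) := by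
    intro n
    have m1 := (hW.memLp_fourierNoise (e n)).1
    have m2 := (hW.memLp_fourierNoise (e' n)).1
    have h1 : ∀ ω, Y ω - Y' ω =
        ((Y ω - fourierNoise W (e n) ω) + (fourierNoise W (e' n) ω - Y' ω)) +
          (fourierNoise W (e n) ω - fourierNoise W (e' n) ω) := fun ω => by ring
    simp_rw [h1]
    refine (lintegral_enorm_add_sq_le ((hY2.1.sub m1).add (m2.sub hY2'.1))).trans ?_
    have h2 := lintegral_enorm_add_sq_le (μ := P) (f := fun ω => Y ω - fourierNoise W (e n) ω)
      (g := fun ω => fourierNoise W (e' n) ω - Y' ω) (hY2.1.sub m1)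
    simp_rw [fun ω => enorm_sub_rev (Y ω) (fourierNoise W (e n) ω)] at h2
    have h3 := helem n
    rw [← hW.lintegral_fourierNoise_sub hs hH hH1] at h3
    calc _ ≤ 2 * (2 * (∫⁻ ω, ‖fourierNoise W (e n) ω - Y ω‖ₑ ^ 2 ∂P) +
          2 * (∫⁻ ω, ‖fourierNoise W (e' n) ω - Y' ω‖ₑ ^ 2 ∂P)) +
          4 * (4 * K * ∫⁻ ξ, ‖b n ξ‖ₑ ^ 2 ∂μ + 4 * K * ∫⁻ ξ, ‖b' n ξ‖ₑ ^ 2 ∂μ + 4 * N) := by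
          refine add_le_add (mul_le_mul' le_rfl h2) (mul_le_mul' (by norm_num) h3)
      _ = _ := by ring
  refine ge_of_tendsto' (x := atTop) ?_ hle
  have h4K : 4 * K ≠ ∞ := ENNReal.mul_ne_top (by simp) hKt
  have t1 := ENNReal.Tendsto.const_mul hlim (Or.inr (by simp : (4 : ℝ≥0∞) ≠ ∞))
  have t2 := ENNReal.Tendsto.const_mul hlim' (Or.inr (by simp : (4 : ℝ≥0∞) ≠ ∞))
  have t3 := ENNReal.Tendsto.const_mul hb0 (Or.inr h4K)
  have t4 := ENNReal.Tendsto.const_mul hb0' (Or.inr h4K)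
  have t5 := ENNReal.Tendsto.const_mul ((t3.add t4).add_const (4 * N))
    (Or.inr (by simp : (4 : ℝ≥0∞) ≠ ∞))
  have t6 := (t1.add t2).add t5
  have hend : 4 * 0 + 4 * 0 + 4 * (4 * K * 0 + 4 * K * 0 + 4 * N) = 16 * N := by ring
  rwa [hend] at t6

end Approximation

/-! ### The Fourier transform of a Dirac mass -/

section Delta

variable {d : ℕ}

theorem HasFourierFunction.unique {T : 𝓢'(Space d, ℂ)} {g g' : Space d → ℂ}
    (hg : HasFourierFunction T g) (hg' : HasFourierFunction T g') : g = g' := by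
  refine (Continuous.ae_eq_iff_eq volume hg.1 hg'.1).1 ?_
  refine ae_eq_of_integral_contDiff_smul_eq hg.1.locallyIntegrable hg'.1.locallyIntegrable
    fun χ hχ hχc => ?_
  have h1 : HasCompactSupport fun ξ => (χ ξ : ℂ) := hχc.comp_left (g := Complex.ofReal) rfl
  have h2 : ContDiff ℝ (⊤ : ℕ∞) fun ξ => (χ ξ : ℂ) := Complex.ofRealCLM.contDiff.comp hχ
  have h3 : ∀ ξ, h1.toSchwartzMap h2 ξ = (χ ξ : ℂ) := fun ξ => rfl
  have h4 := (hg.2 (h1.toSchwartzMap h2)).2.symm.trans (hg'.2 (h1.toSchwartzMap h2)).2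
  simp_rw [h3] at h4
  simpa only [Complex.real_smul, mul_comm] using h4

/-- The Fourier transform `ξ ↦ e^{-i x·ξ}` of `δ_x`. -/
def deltaHat (x ξ : Space d) : ℂ := Complex.exp (-Complex.I * ((inner ℝ x ξ : ℝ) : ℂ))

theorem continuous_deltaHat (x : Space d) : Continuous (deltaHat x) := by
  unfold deltaHat
  fun_prop

theorem norm_deltaHat (x ξ : Space d) : ‖deltaHat x ξ‖ = 1 := norm_exp_neg_I_mul _

theorem hasFourierFunction_delta (x : Space d) :
    HasFourierFunction (TemperedDistribution.delta x) (deltaHat x) := by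
  refine ⟨continuous_deltaHat x, fun φ => ⟨?_, ?_⟩⟩
  · exact φ.integrable.bdd_mul (continuous_deltaHat x).aestronglyMeasurable
      (Eventually.of_forall fun ξ => (norm_deltaHat x ξ).le)
  · rw [TemperedDistribution.delta_apply, fourierS_apply]
    rfl

end Delta

/-! ### The norm of the weak solution -/

section SolutionNorm

variable {d : ℕ} {H : ℝ} {μ : Measure (Space d)} {Ψ : Space d → ℂ} {t : ℝ}

theorem waveIntegrand_eq (Ψ : Space d → ℂ) (t : ℝ) (g : Space d → ℂ) (s : ℝ) (ξ : Space d) :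
    waveIntegrand Ψ t g s ξ =
      ((((2 * Real.pi) ^ d)⁻¹ : ℝ) : ℂ) * conj (g ξ) * waveTime (Ψ ξ).re t s := by
  rw [waveIntegrand, waveTime]
  ring

theorem isBddTime_waveIntegrand (Ψ : Space d → ℂ) (ht : 0 ≤ t) (g : Space d → ℂ) (ξ : Space d) :
    IsBddTime t (‖((((2 * Real.pi) ^ d)⁻¹ : ℝ) : ℂ) * conj (g ξ)‖ * t)
      fun s => waveIntegrand Ψ t g s ξ := by
  simp_rw [waveIntegrand_eq]
  exact (isBddTime_waveTime _ ht).const_mul _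

theorem waveIntegrand_sub (g g' : Space d → ℂ) :
    (fun s ξ => waveIntegrand Ψ t g s ξ - waveIntegrand Ψ t g' s ξ) =
      waveIntegrand Ψ t fun ξ => g ξ - g' ξ := by
  ext s ξ
  simp only [waveIntegrand, map_sub]
  ring

theorem solNormSq_eq (hH : 1 / 2 < H) (hH1 : H < 1) (ht : 0 ≤ t) (g : Space d → ℂ) :
    solNormSq H μ Ψ t g = ∫⁻ ξ, ‖g ξ‖ₑ ^ 2 * timeNormSq H (waveTime (Ψ ξ).re t) ∂μ := by
  have h1 : ∀ ξ, timeNormSq H (fun s => waveIntegrand Ψ t g s ξ) =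
      ENNReal.ofReal ((2 * Real.pi) ^ (2 * d))⁻¹ *
        (‖g ξ‖ₑ ^ 2 * timeNormSq H (waveTime (Ψ ξ).re t)) := by
    intro ξ
    simp_rw [waveIntegrand_eq]
    rw [timeNormSq_const_mul hH hH1 (isBddTime_waveTime _ ht), enorm_mul, mul_pow, mul_assoc,
      RCLike.enorm_conj]
    congr 1
    rw [← ofReal_norm, Complex.norm_real, ← ENNReal.ofReal_pow (norm_nonneg _), Real.norm_eq_abs,
      sq_abs, inv_pow, ← pow_mul, mul_comm d]
  rw [solNormSq, hatNormSq]
  simp_rw [h1]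
  rw [lintegral_const_mul' _ _ ENNReal.ofReal_ne_top, ← mul_assoc,
    ← ENNReal.ofReal_mul (by positivity), mul_inv_cancel₀ (by positivity), ENNReal.ofReal_one,
    one_mul]

/-- The density `(1 / (1 + Ψ))^{H + 1/2}`, which is comparable with the squared norm of the wave
kernel at each frequency. -/
def spectralWeight (H : ℝ) (Ψ : Space d → ℂ) (ξ : Space d) : ℝ≥0∞ :=
  ENNReal.ofReal ((1 / (1 + (Ψ ξ).re)) ^ (H + 1 / 2))

theorem measurable_spectralWeight (hΨc : Continuous fun ξ => (Ψ ξ).re) :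
    Measurable (spectralWeight H Ψ) :=
  (((hΨc.measurable.const_add 1).const_div 1).pow_const _).ennreal_ofReal

theorem spectralWeight_le_one (hH : 1 / 2 < H) (hΨ0 : ∀ ξ, 0 ≤ (Ψ ξ).re) (ξ : Space d) :
    spectralWeight H Ψ ξ ≤ 1 := by
  have h := hΨ0 ξ
  rw [spectralWeight, ← ENNReal.ofReal_one]
  refine ENNReal.ofReal_le_ofReal (Real.rpow_le_one (by positivity) ?_ (by linarith))
  rw [div_le_one (by linarith)]
  linarith

theorem exists_timeNormSq_waveTime_le_spectralWeight (hH : 1 / 2 < H) (hH1 : H < 1)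
    (hΨ0 : ∀ ξ, 0 ≤ (Ψ ξ).re) (ht : 0 ≤ t) : ∃ K : ℝ≥0∞, K ≠ ∞ ∧
      ∀ ξ, timeNormSq H (waveTime (Ψ ξ).re t) ≤ K * spectralWeight H Ψ ξ := by
  obtain ⟨C, hC, h⟩ := timeNormSq_waveTime_le hH hH1 ht
  refine ⟨ENNReal.ofReal C, ENNReal.ofReal_ne_top, fun ξ => (h _ (hΨ0 ξ)).trans_eq ?_⟩
  rw [ENNReal.ofReal_mul hC, spectralWeight]

theorem exists_solNormSq_le (hH : 1 / 2 < H) (hH1 : H < 1) (hΨc : Continuous fun ξ => (Ψ ξ).re)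
    (hΨ0 : ∀ ξ, 0 ≤ (Ψ ξ).re) (ht : 0 ≤ t) : ∃ K : ℝ≥0∞, K ≠ ∞ ∧
      ∀ g : Space d → ℂ, Measurable g →
        solNormSq H μ Ψ t g ≤ K * ∫⁻ ξ, ‖g ξ‖ₑ ^ 2 ∂μ.withDensity (spectralWeight H Ψ) := by
  obtain ⟨K, hK, h⟩ := exists_timeNormSq_waveTime_le_spectralWeight hH hH1 hΨ0 ht
  refine ⟨K, hK, fun g hg => ?_⟩
  rw [solNormSq_eq hH hH1 ht, lintegral_withDensity_eq_lintegral_mul _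
    (measurable_spectralWeight hΨc) (hg.enorm.pow_const 2), ← lintegral_const_mul' _ _ hK]
  refine lintegral_mono fun ξ => (mul_le_mul' le_rfl (h ξ)).trans_eq ?_
  rw [Pi.mul_apply]
  ring

end SolutionNorm

/-! ### Necessity and sufficiency of the spectral condition -/

section Criterion

variable {d : ℕ} {H : ℝ} {μ : Measure (Space d)} {Ψ : Space d → ℂ} {t : ℝ}

/-- If `δ_0` is in `M_t`, the spectral weight is integrable over the frequencies at which it is
controlled from above by the norm of the wave kernel. Indeed `1 = Fφ + (1 - Fφ)` for a Schwartz
function `φ` close to `δ_0`, and `Fφ` is in `L²(μ)`. -/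
theorem MemM.setLIntegral_spectralWeight_lt_top [μ.HasTemperateGrowth] (hH : 1 / 2 < H)
    (hH1 : H < 1) (hΨ0 : ∀ ξ, 0 ≤ (Ψ ξ).re) (ht : 0 ≤ t)
    (hM : MemM H μ Ψ t (TemperedDistribution.delta 0)) {c : ℝ} (hc : 0 < c) {S : Set (Space d)}
    (hS : MeasurableSet S)
    (hcS : ∀ ξ ∈ S, ENNReal.ofReal (c * (1 / (1 + (Ψ ξ).re)) ^ (H + 1 / 2)) ≤
      timeNormSq H (waveTime (Ψ ξ).re t)) :
    ∫⁻ ξ in S, spectralWeight H Ψ ξ ∂μ < ∞ := by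
  obtain ⟨φ, g, hg, hlim⟩ := hM
  obtain rfl := hg.unique (hasFourierFunction_delta 0)
  obtain ⟨n, hn⟩ := (hlim.eventually_le_const one_pos).exists
  rw [solNormSq_eq hH hH1 ht] at hn
  obtain ⟨K, hK, hle⟩ := exists_timeNormSq_waveTime_le_spectralWeight hH hH1 hΨ0 ht
  set χ := fourierS (φ n) with hχ
  have hχ2 : ∫⁻ ξ, ‖χ ξ‖ₑ ^ 2 ∂μ ≠ ∞ := by
    rw [← eLpNorm_two_sq]
    exact ENNReal.pow_ne_top (χ.memLp 2 μ).2.ne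
  have hpt : ∀ ξ ∈ S, ENNReal.ofReal c * spectralWeight H Ψ ξ ≤
      2 * (‖χ ξ - deltaHat 0 ξ‖ₑ ^ 2 * timeNormSq H (waveTime (Ψ ξ).re t)) +
        2 * K * ‖χ ξ‖ₑ ^ 2 := by
    intro ξ hξ
    rw [spectralWeight, ← ENNReal.ofReal_mul hc.le]
    refine (hcS ξ hξ).trans ?_
    have h1 : timeNormSq H (waveTime (Ψ ξ).re t) ≤ K := (hle ξ).trans
      ((mul_le_mul' le_rfl (spectralWeight_le_one hH hΨ0 ξ)).trans_eq (mul_one K))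
    have h2 : (1 : ℝ≥0∞) ≤ 2 * ‖χ ξ - deltaHat 0 ξ‖ₑ ^ 2 + 2 * ‖χ ξ‖ₑ ^ 2 := by
      have h3 := enorm_add_sq_le (χ ξ - deltaHat 0 ξ) (-χ ξ)
      have h4 : χ ξ - deltaHat 0 ξ + -χ ξ = -deltaHat 0 ξ := by ring
      rw [h4, enorm_neg, enorm_neg] at h3
      simpa [← ofReal_norm (deltaHat 0 ξ), norm_deltaHat] using h3
    calc timeNormSq H (waveTime (Ψ ξ).re t)
        ≤ (2 * ‖χ ξ - deltaHat 0 ξ‖ₑ ^ 2 + 2 * ‖χ ξ‖ₑ ^ 2) *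
          timeNormSq H (waveTime (Ψ ξ).re t) := le_mul_of_one_le_left' h2
      _ = 2 * (‖χ ξ - deltaHat 0 ξ‖ₑ ^ 2 * timeNormSq H (waveTime (Ψ ξ).re t)) +
          2 * timeNormSq H (waveTime (Ψ ξ).re t) * ‖χ ξ‖ₑ ^ 2 := by ring
      _ ≤ _ := by gcongr
  have hfin : ENNReal.ofReal c * ∫⁻ ξ in S, spectralWeight H Ψ ξ ∂μ < ∞ := by
    rw [← lintegral_const_mul' _ _ ENNReal.ofReal_ne_top]
    calc _ ≤ ∫⁻ ξ in S, (2 * (‖χ ξ - deltaHat 0 ξ‖ₑ ^ 2 *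
            timeNormSq H (waveTime (Ψ ξ).re t)) + 2 * K * ‖χ ξ‖ₑ ^ 2) ∂μ :=
          setLIntegral_mono' hS hpt
      _ ≤ ∫⁻ ξ, (2 * (‖χ ξ - deltaHat 0 ξ‖ₑ ^ 2 *
            timeNormSq H (waveTime (Ψ ξ).re t)) + 2 * K * ‖χ ξ‖ₑ ^ 2) ∂μ :=
          setLIntegral_le_lintegral _ _
      _ = 2 * (∫⁻ ξ, ‖χ ξ - deltaHat 0 ξ‖ₑ ^ 2 * timeNormSq H (waveTime (Ψ ξ).re t) ∂μ) +
            2 * K * ∫⁻ ξ, ‖χ ξ‖ₑ ^ 2 ∂μ := by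
          -- the second summand is measurable, which is enough to split the integral
          rw [lintegral_add_right _ ((χ.continuous.measurable.enorm.pow_const 2).const_mul _),
            lintegral_const_mul' _ _ (by simp),
            lintegral_const_mul' _ _ (ENNReal.mul_ne_top (by simp) hK)]
      _ < ∞ := by
          refine ENNReal.add_lt_top.2 ⟨?_, ?_⟩
          · exact ENNReal.mul_lt_top (by simp) (hn.trans_lt ENNReal.one_lt_top)
          · exact ENNReal.mul_lt_top (ENNReal.mul_lt_top (by simp) hK.lt_top) hχ2.lt_top
  exact ENNReal.lt_top_of_mul_ne_top_right hfin.ne (ENNReal.ofReal_pos.2 hc).ne'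

theorem lintegral_spectralWeight_lt_top [μ.HasTemperateGrowth] (hH : 1 / 2 < H) (hH1 : H < 1)
    (hΨc : Continuous fun ξ => (Ψ ξ).re) (hΨ0 : ∀ ξ, 0 ≤ (Ψ ξ).re)
    (hM : ∀ t, 0 < t → MemM H μ Ψ t (TemperedDistribution.delta 0)) :
    ∫⁻ ξ, spectralWeight H Ψ ξ ∂μ < ∞ := by
  obtain ⟨c, hc, h⟩ := le_timeNormSq_waveTime_one hH hH1
  obtain ⟨c', hc', h'⟩ := le_timeNormSq_waveTime_sixth hH hH1
  have hS : MeasurableSet {ξ | 36 ≤ (Ψ ξ).re} := measurableSet_le measurable_const hΨc.measurable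
  rw [← lintegral_add_compl _ hS]
  refine ENNReal.add_lt_top.2 ⟨?_, ?_⟩
  · exact (hM 1 one_pos).setLIntegral_spectralWeight_lt_top hH hH1 hΨ0 zero_le_one hc hS
      fun ξ hξ => h _ hξ
  · exact (hM (1 / 6) (by norm_num)).setLIntegral_spectralWeight_lt_top hH hH1 hΨ0 (by norm_num)
      hc' hS.compl fun ξ hξ => h' _ (hΨ0 ξ) (le_of_not_ge hξ)

/-- If the spectral weight is integrable, then every `δ_x` is a limit of Schwartz functions, for
all norms `‖·‖_t` simultaneously. -/
theorem exists_tendsto_deltaHat (hfin : ∫⁻ ξ, spectralWeight H Ψ ξ ∂μ < ∞) (x : Space d) :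
    ∃ φ : ℕ → 𝓢(Space d, ℂ), Tendsto (fun n => ∫⁻ ξ, ‖fourierS (φ n) ξ - deltaHat x ξ‖ₑ ^ 2
      ∂μ.withDensity (spectralWeight H Ψ)) atTop (𝓝 0) := by
  have : IsFiniteMeasure (μ.withDensity (spectralWeight H Ψ)) :=
    isFiniteMeasure_withDensity hfin.ne
  have hx : MemLp (deltaHat x) 2 (μ.withDensity (spectralWeight H Ψ)) :=
    MemLp.of_bound (continuous_deltaHat x).aestronglyMeasurable 1
      (Eventually.of_forall fun ξ => (norm_deltaHat x ξ).le)
  choose ψ hψ using fun n : ℕ => exists_schwartz_approx hx (ε := ((n : ℝ≥0∞) + 1)⁻¹) (by simp)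
  choose φ hφ using fun n => fourierS_surjective (ψ n)
  refine ⟨φ, ?_⟩
  simp_rw [hφ]
  refine tendsto_of_tendsto_of_tendsto_of_le_of_le tendsto_const_nhds ?_ (fun _ => zero_le) hψ
  simpa using (tendsto_add_atTop_iff_nat 1).2 ENNReal.tendsto_inv_nat_nhds_zero

/-- The solution `U t x` is the mean square limit of the integrals `u t (φ x n)` along the sequence
of `exists_tendsto_deltaHat`. They form a Cauchy sequence, since each difference is controlled by
the distances of the two Fourier transforms to that of `δ_x`. -/
theorem hasRandomFieldSolution_of_lintegral_lt_top (hH : 1 / 2 < H) (hH1 : H < 1)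
    {f : Space d → ℝ≥0∞} (hs : IsSpectralPair f μ) {Ω : Type*} [MeasurableSpace Ω]
    {P : Measure Ω} {W : Elem d ℝ → Ω → ℝ} (hW : IsNoise P H f W)
    (hΨc : Continuous fun ξ => (Ψ ξ).re) (hΨ0 : ∀ ξ, 0 ≤ (Ψ ξ).re)
    (hfin : ∫⁻ ξ, spectralWeight H Ψ ξ ∂μ < ∞) : HasRandomFieldSolution P H μ Ψ W := by
  have := hs.tempered
  have := isFiniteMeasureOnCompacts_of_hasTemperateGrowth hs.tempered
  choose φ hφ using exists_tendsto_deltaHat hfin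
  have hmeas : ∀ χ : 𝓢(Space d, ℂ), Measurable χ := fun χ => χ.continuous.measurable
  have hconv : ∀ t, 0 ≤ t → ∀ x, ConvergesInM H μ Ψ t (φ x) (TemperedDistribution.delta x) := by
    intro t ht x
    obtain ⟨K, hK, h⟩ := exists_solNormSq_le (μ := μ) hH hH1 hΨc hΨ0 ht
    refine ⟨deltaHat x, hasFourierFunction_delta x, ?_⟩
    refine tendsto_of_tendsto_of_tendsto_of_le_of_le tendsto_const_nhds ?_ (fun _ => zero_le)
      fun n => h _ ((hmeas _).sub (continuous_deltaHat x).measurable)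
    simpa using ENNReal.Tendsto.const_mul (hφ x) (Or.inr hK)
  have hsol : ∀ (t : ℝ) (χ : 𝓢(Space d, ℂ)), ∃ Y, 0 ≤ t →
      IsUniformIntegral P μ W t (waveIntegrand Ψ t (fourierS χ)) Y := by
    intro t χ
    by_cases ht : 0 ≤ t
    · obtain ⟨Y, hY⟩ := (timeApprox_waveIntegrand (μ := μ) hΨc hΨ0 ht (hmeas (fourierS χ))
        ((fourierS χ).memLp 2 μ)).exists_isUniformIntegral hW hs hH hH1
      exact ⟨Y, fun _ => hY⟩
    · exact ⟨0, fun h => absurd h ht⟩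
  choose u hu using hsol
  have hlim : ∀ (t : ℝ) (x : Space d), ∃ Y : Ω → ℂ, 0 ≤ t → MemLp Y 2 P ∧
      Tendsto (fun n => eLpNorm (fun ω => u t (φ x n) ω - Y ω) 2 P) atTop (𝓝 0) := by
    intro t x
    by_cases ht : 0 ≤ t
    · obtain ⟨K, hK, h⟩ := exists_solNormSq_le (μ := μ) hH hH1 hΨc hΨ0 ht
      set ρ := μ.withDensity (spectralWeight H Ψ) with hρ
      have hK32 : 16 * K * 2 ≠ ∞ :=
        ENNReal.mul_ne_top (ENNReal.mul_ne_top (by simp) hK) (by simp)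
      obtain ⟨Y, hY⟩ := exists_tendsto_eLpNorm_two (μ := P) (F := fun n => u t (φ x n))
        (a := fun n => 16 * K * 2 * ∫⁻ ξ, ‖fourierS (φ x n) ξ - deltaHat x ξ‖ₑ ^ 2 ∂ρ)
        (fun n => (hu t (φ x n) ht).1)
        (by simpa using ENNReal.Tendsto.const_mul (hφ x) (Or.inr hK32))
        (fun n m => by
          refine ((hu t (φ x n) ht).lintegral_sub_sq_le hW hs hH hH1 (hu t (φ x m) ht)
            (isBddTime_waveIntegrand Ψ ht _) (isBddTime_waveIntegrand Ψ ht _)).trans ?_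
          rw [waveIntegrand_sub]
          refine (mul_le_mul' le_rfl (h _ ((hmeas _).sub (hmeas _)))).trans ?_
          have h1 := lintegral_enorm_add_sq_le (μ := ρ)
            (f := fun ξ => fourierS (φ x n) ξ - deltaHat x ξ)
            (g := fun ξ => deltaHat x ξ - fourierS (φ x m) ξ)
            ((hmeas _).sub (continuous_deltaHat x).measurable).aestronglyMeasurable
          simp_rw [sub_add_sub_cancel, fun ξ => enorm_sub_rev (deltaHat x ξ) (fourierS (φ x m) ξ)]
            at h1
          refine (mul_le_mul' le_rfl (mul_le_mul' le_rfl h1)).trans_eq ?_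
          ring)
      exact ⟨Y, fun _ => hY⟩
    · exact ⟨0, fun h => absurd h ht⟩
  choose U hU using hlim
  refine ⟨U, fun x t ht => ⟨φ x, hconv t ht.le x⟩, u, fun t ht χ => ?_, fun t x ht => ?_⟩
  · exact (hu t χ ht).isFourierIntegral hH (isBddTime_waveIntegrand Ψ ht _)
  · exact ⟨(hU t x ht).1, φ x, hconv t ht x, (hU t x ht).2⟩

end Criterion

end FractionalSPDE

end

theorem mainTheorem2 {d : ℕ} (H : ℝ) (hH : 1 / 2 < H) (hH1 : H < 1)
    {Ω' : Type*} [MeasurableSpace Ω'] (P' : Measure Ω') [IsProbabilityMeasure P']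
    (X : ℝ≥0 → Ω' → FractionalSPDE.Space d) (hX : FractionalSPDE.IsLevyProcess P' X)
    (Ψ : FractionalSPDE.Space d → ℂ) (hΨ : FractionalSPDE.IsCharExponent P' X Ψ)
    (hsymm : ∀ ξ, (Ψ ξ).im = 0)
    (f : FractionalSPDE.Space d → ℝ≥0∞) (μ : Measure (FractionalSPDE.Space d))
    (hfμ : FractionalSPDE.IsSpectralPair f μ)
    {Ω : Type*} [MeasurableSpace Ω] (P : Measure Ω) [IsProbabilityMeasure P]
    (W : FractionalSPDE.Elem d ℝ → Ω → ℝ) (hW : FractionalSPDE.IsNoise P H f W) :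
    FractionalSPDE.HasRandomFieldSolution P H μ Ψ W ↔
      ∫⁻ ξ, ENNReal.ofReal ((1 / (1 + (Ψ ξ).re)) ^ (H + 1 / 2)) ∂μ < ∞ := by
  have hΨc := FractionalSPDE.continuous_charExponent_re (hX.measurable 1) hΨ hsymm
  have hΨ0 := FractionalSPDE.charExponent_re_nonneg hΨ hsymm
  have := hfμ.tempered
  constructor
  · rintro ⟨U, hM, -⟩
    exact FractionalSPDE.lintegral_spectralWeight_lt_top hH hH1 hΨc hΨ0 (hM 0)
  · exact FractionalSPDE.hasRandomFieldSolution_of_lintegral_lt_top hH hH1 hfμ hW hΨc hΨ0
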